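/- \textbf{Setting.} Let $\mathcal A$ be a unital complex Banach algebra and $\mathcal B\subseteq\mathcal A$ a unital subalgebra that is complete in the norm of $\mathcal A$. Let $(\mathcal A,\mathcal B,E,E')$ be an operator-valued infinitesimal (OVI) probability space. That is, $E,E':\mathcal A\to\mathcal B$ are linear maps with $E(b)=b$, $E(bab')=bE(a)b'$, $E'(1)=0$ and $E'(bab')=bE'(a)b'$ for all $a\in\mathcal A$, $b,b'\in\mathcal B$. \textbf{Independence.} For $a\in\mathcal A$ let $\mathcal B\langle a\rangle$ be the unital algebra generated by $\mathcal B$ and $a$. Let $\mathcal B\langle a\rangle_0$ be the (not necessarily unital) algebra generated by $\mathcal B a\mathcal B$, i.e. the linear span of all $b_0ab_1a\cdots ab_k$ with $k\ge1$ and $b_0,\dots,b_k\in\mathcal B$. Elements $(a_i)_{i\ge1}$ of $\mathcal A$ are called \begin{itemize} \item \emph{infinitesimally free} if for all $n\ge1$, $i_1\ne i_2\ne\cdots\ne i_n$ and $x_j\in\mathcal B\langle a_{i_j}\rangle$ with $E(x_j)=0$ one has $E(x_1\cdots x_n)=0$ and $E'(x_1\cdots x_n)=\sum_{j=1}^nE(x_1\cdots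 x_{j-1}E'(x_j)x_{j+1}\cdots x_n)$; \item \emph{infinitesimally Boolean independent} if for all $n\ge1$, $i_1\neq i_2\ne\cdots\ne i_n$ and $x_j\in\mathcal B\langle a_{i_j}\rangle_0$ one has $E(x_1\cdots x_n)=E(x_1)\cdots E(x_n)$ and $E'(x_1\cdots x_n)=\sum_{j=1}^nE(x_1)\cdots E(x_{j-1})E'(x_j)E(x_{j+1})\cdots E(x_n)$; \item \emph{infinitesimally monotone independent} if for all $n\ge1$, all $i_1,\dots,i_n$, all $x_l\in\mathcal B\langle a_{i_l}\rangle_0$ and every $j$ with $i_{j-1}<i_j>i_{j+1}$ (where an inequality is dropped if $j=1$, resp. $j=n$) one has $E(x_1\cdots x_n)=E(x_1\cdots x_{j-1}E(x_j)x_{j+1}\cdots x_n)$ and $E'(x_1\cdots x_n)=E(x_1\cdots x_{j-1}E'(x_j)x_{j+1}\cdots x_n)+E'(x_1\cdots x_{j-1}E(x_j)x_{j+1}\cdots x_n)$. \end{itemize} They are \emph{identically distributed} if, for every $n\ge0$ and all $b_1,\dots,b_n\in\mathcal B$, neither $E(a_ib_1a_i\cdots b_na_i)$ nor $E'(a_ib_1a_i\cdots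 b_na_i)$ depends on $i$. \textbf{Laws.} Let $\eta,\eta':\mathcal B\to\mathcal B$ be maps. For $k\ge 0$ let $\mathcal{NC}_2(k)$ be the set of non-crossing pair partitions of $\{1,\dots,k\}$. For $\pi\in\mathcal{NC}_2(k)$ and a family $f=(f_V)_{V\in\pi}$ of maps $\mathcal B\to\mathcal B$, let $f_\pi[b_0,\dots,b_k]\in\mathcal B$ be the nested evaluation of the word $b_0X_1b_1X_2\cdots X_kb_k$ along $\pi$: it is $b_0$ if $k=0$, and if $V=\{1,m\}$ is the block of $1$, it is $b_0\,f_V(u)\,v$, where $u$ and $v$ are the nested evaluations of the words $b_1X_2\cdots X_{m-1}b_{m-1}$ and $b_mX_{m+1}\cdots X_kb_k$ along the restrictions of $\pi$. Put $\eta_\pi[b_0,\dots,b_k]=f_\pi[b_0,\dots,b_k]$ with $f_V=\eta$ for all $V$, and $\partial\eta_\pi[b_0,\dots,b_k]=\sum_{V\in\pi}f^{(V)}_\pi[b_0,\dots,b_k]$, where $f^{(V)}_V=\eta'$ and $f^{(V)}_W=\eta$ for $W\neq V$. Let $\tau(\pi)!=\prod_{V\in\pi}|\{W\in\pi:W\subseteq[\min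 V,\max V]\}|$. The laws $\nu_\eta$ and $\nu'_{\eta,\eta'}$ vanish on $b_0Xb_1X\cdots Xb_k$ for odd $k$. For even $k$ their values there are as follows. \begin{itemize} \item $\mathcal B$-valued semicircle law and infinitesimal semicircle law: $\nu_\eta=\sum_{\pi\in\mathcal{NC}_2(k)}\eta_\pi[b_0,\dots,b_k]$ and $\nu'_{\eta,\eta'}=\sum_{\pi\in\mathcal{NC}_2(k)}\partial\eta_\pi[b_0,\dots,b_k]$. \item $\mathcal B$-valued Bernoulli law and infinitesimal Bernoulli law: $\nu_\eta=b_0\eta(b_1)b_2\eta(b_3)\cdots\eta(b_{k-1})b_k$ and $\nu'_{\eta,\eta'}=\sum_{j=0}^{k/2-1}b_0\eta(b_1)b_2\cdots\eta'(b_{2j+1})\cdots\eta(b_{k-1})b_k$. \item $\mathcal B$-valued arcsine law and infinitesimal arcsine law: $\nu_\eta=\sum_{\pi\in\mathcal{NC}_2(k)}\frac1{\tau(\pi)!}\eta_\pi[b_0,\dots,b_k]$ and $\nu'_{\eta,\eta'}=\sum_{\pi\in\mathcal{NC}_2(k)}\frac1{\tau(\pi)!}\partial\eta_\pi[b_0,\dots,b_k]$.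 \end{itemize} \textbf{Theorem (OVI central limit theorem).} Let $(a_i)_{i\ge1}$ be identically distributed elements of $\mathcal A$ with $E(a_i)=0$ and $E'(a_i)=0$ for all $i$. Let $\eta(b)=E(a_iba_i)$ and $\eta'(b)=E'(a_iba_i)$ be their common variance and infinitesimal variance. Put $S_N=\frac1{\sqrt N}(a_1+\dots+a_N)$. If the $a_i$ are infinitesimally free (resp. Boolean independent, monotone independent), then for all $k\ge0$ and $b_0,\dots,b_k\in\mathcal B$, as $N\to\infty$, in norm, $$E(b_0S_Nb_1S_Nb_2\cdots b_{k-1}S_Nb_k)\longrightarrow\nu_\eta(b_0Xb_1Xb_2\cdots b_{k-1}Xb_k),$$ $$E'(b_0S_Nb_1S_Nb_2\cdots b_{k-1}S_Nb_k)\longrightarrow\nu'_{\eta,\eta'}(b_0Xb_1Xb_2\cdots b_{k-1}Xb_k),$$ where $\nu_\eta,\nu'_{\eta,\eta'}$ are the $\mathcal B$-valued semicircle (resp. Bernoulli, arcsine) law and the $\mathcal B$-valued infinitesimal semicircle (resp. infinitesimal Bernoulli, infinitesimal arcsine) law. -/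

import Mathlib

open Filter Topology

noncomputable section

namespace OVI

/-! ### Operator-valued infinitesimal probability spaces -/

/-- An operator-valued infinitesimal probability space `(A, B, E, E')`: `B` is a unital subalgebra
of the unital complex algebra `A`, `E : A → B` is a conditional expectation and `E' : A → B` is a
linear `B`-bimodule map with `E' 1 = 0`. -/
structure Space (A : Type*) [Ring A] [Algebra ℂ A] (B : Subalgebra ℂ A) where
  /-- the conditional expectation -/
  E : A →ₗ[ℂ] B
  /-- the infinitesimal expectation -/
  E' : A →ₗ[ℂ] B
  E_coe : ∀ b : B, E (b : A) = b
  E_bimodule : ∀ (b b' : B) (a : A), E ((b : A) * a * (b' : A)) = b * E a * b'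
  E'_one : E' 1 = 0
  E'_bimodule : ∀ (b b' : B) (a : A), E' ((b : A) * a * (b' : A)) = b * E' a * b'

section Independence

variable {A : Type*} [Ring A] [Algebra ℂ A] {B : Subalgebra ℂ A}

/-- The ordered product `x₀ x₁ ⋯ x_{n-1}`. -/
def oprod {R : Type*} [Monoid R] {n : ℕ} (x : Fin n → R) : R := (List.ofFn x).prod

/-- Neighbouring indices of the word `i₀ i₁ ⋯ i_{n-1}` are distinct. -/
def Alternating {I : Type*} {n : ℕ} (i : Fin n → I) : Prop :=
  ∀ j l : Fin n, (l : ℕ) = j + 1 → i j ≠ i l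

/-- The letter number `j` of the word `i₀ i₁ ⋯ i_{n-1}` is strictly greater than its neighbours
(the condition on a neighbour that does not exist is void). -/
def IsPeak {I : Type*} [LinearOrder I] {n : ℕ} (i : Fin n → I) (j : Fin n) : Prop :=
  ∀ l : Fin n, ((l : ℕ) + 1 = j ∨ (l : ℕ) = j + 1) → i l < i j

/-- Infinitesimal freeness over `B` of a family of unital subalgebras containing `B`. -/
def InfFreeAlgebras (P : Space A B) {I : Type*} (𝒜 : I → Subalgebra ℂ A) : Prop :=
  (∀ i, B ≤ 𝒜 i) ∧
  ∀ (n : ℕ) (i : Fin n → I) (x : Fin n → A), 1 ≤ n → Alternating i →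
    (∀ j, x j ∈ 𝒜 (i j)) → (∀ j, P.E (x j) = 0) →
      P.E (oprod x) = 0 ∧
      P.E' (oprod x) = ∑ j, P.E (oprod (Function.update x j (P.E' (x j) : A)))

/-- Infinitesimal Boolean independence over `B` of a family of subalgebras which need not be unital
and which are stable under multiplication by `B` from both sides. -/
def InfBooleanAlgebras (P : Space A B) {I : Type*} (𝒜 : I → NonUnitalSubalgebra ℂ A) : Prop :=
  (∀ (i : I) (x : A) (b : B), x ∈ 𝒜 i → (b : A) * x ∈ 𝒜 i ∧ x * (b : A) ∈ 𝒜 i) ∧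
  ∀ (n : ℕ) (i : Fin n → I) (x : Fin n → A), 1 ≤ n → Alternating i →
    (∀ j, x j ∈ 𝒜 (i j)) →
      P.E (oprod x) = oprod (fun j => P.E (x j)) ∧
      P.E' (oprod x) = ∑ j, oprod (Function.update (fun l => P.E (x l)) j (P.E' (x j)))

/-- Infinitesimal monotone independence over `B` of a family, indexed by a linear order, of
subalgebras which need not be unital and which are stable under multiplication by `B` from both
sides. -/
def InfMonotoneAlgebras (P : Space A B) {I : Type*} [LinearOrder I]
    (𝒜 : I → NonUnitalSubalgebra ℂ A) : Prop :=
  (∀ (i : I) (x : A) (b : B), x ∈ 𝒜 i → (b : A) * x ∈ 𝒜 i ∧ x * (b : A) ∈ 𝒜 i) ∧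
  ∀ (n : ℕ) (i : Fin n → I) (x : Fin n → A) (j : Fin n), IsPeak i j →
    (∀ l, x l ∈ 𝒜 (i l)) →
      P.E (oprod x) = P.E (oprod (Function.update x j (P.E (x j) : A))) ∧
      P.E' (oprod x) = P.E (oprod (Function.update x j (P.E' (x j) : A))) +
        P.E' (oprod (Function.update x j (P.E (x j) : A)))

/-- The unital algebra generated by `B` and `a`. -/
def unitalAlg (B : Subalgebra ℂ A) (a : A) : Subalgebra ℂ A :=
  Algebra.adjoin ℂ (insert a (B : Set A))

/-- The algebra generated by `B a B`, without adjoining a unit: the linear span of all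
`b₀ a b₁ a ⋯ a b_k` with `k ≥ 1` and coefficients in `B`. -/
def nonUnitalAlg (B : Subalgebra ℂ A) (a : A) : NonUnitalSubalgebra ℂ A :=
  NonUnitalAlgebra.adjoin ℂ {x | ∃ b b' : B, x = (b : A) * a * (b' : A)}

/-- Elements are infinitesimally free over `B`. -/
def InfFree (P : Space A B) {I : Type*} (a : I → A) : Prop :=
  InfFreeAlgebras P fun i => unitalAlg B (a i)

/-- Elements are infinitesimally Boolean independent over `B`. -/
def InfBoolean (P : Space A B) {I : Type*} (a : I → A) : Prop :=
  InfBooleanAlgebras P fun i => nonUnitalAlg B (a i)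

/-- Elements are infinitesimally monotone independent over `B`. -/
def InfMonotone (P : Space A B) {I : Type*} [LinearOrder I] (a : I → A) : Prop :=
  InfMonotoneAlgebras P fun i => nonUnitalAlg B (a i)

/-- The word `b₀ s b₁ s b₂ ⋯ b_{k-1} s b_k`. -/
def word (s : A) (k : ℕ) (b : ℕ → B) : A :=
  (b 0 : A) * ((List.range k).map fun l => s * (b (l + 1) : A)).prod

/-- The elements `a i` have the same `B`-valued moments `E (a b₁ a b₂ ⋯ b_n a)` and the same
`B`-valued infinitesimal moments `E' (a b₁ a b₂ ⋯ b_n a)`. -/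
def IdentDistributed (P : Space A B) {I : Type*} (a : I → A) : Prop :=
  ∀ (i j : I) (n : ℕ) (b : Fin n → B),
    P.E (a i * oprod fun l => (b l : A) * a i) = P.E (a j * oprod fun l => (b l : A) * a j) ∧
    P.E' (a i * oprod fun l => (b l : A) * a i) = P.E' (a j * oprod fun l => (b l : A) * a j)

/-- `S_N = (a₀ + ⋯ + a_{N-1}) / √N`. -/
def normalizedSum (a : ℕ → A) (N : ℕ) : A :=
  ((Real.sqrt N : ℂ)⁻¹) • ∑ i ∈ Finset.range N, a i

end Independence

/-! ### Non-crossing pair partitions -/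

/-- Partitions of a set of `k` points in linear order. -/
abbrev Part (k : ℕ) := Finpartition (Finset.univ : Finset (Fin k))

/-- No two blocks cross. -/
def NonCrossing {k : ℕ} (π : Part k) : Prop :=
  ∀ V ∈ π.parts, ∀ W ∈ π.parts, V ≠ W →
    ¬ ∃ p ∈ V, ∃ q ∈ W, ∃ r ∈ V, ∃ s ∈ W, p < q ∧ q < r ∧ r < s

open Classical in
/-- The set of non-crossing pair partitions. -/
def NC2 (k : ℕ) : Finset (Part k) :=
  Finset.univ.filter fun π => NonCrossing π ∧ ∀ V ∈ π.parts, V.card = 2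

open Classical in
/-- The tree factorial: the product over the blocks `V` of the number of blocks `W` contained in
the interval `[min V, max V]`. -/
def treeFactorial {k : ℕ} (π : Part k) : ℕ :=
  ∏ V ∈ π.parts,
    (π.parts.filter fun W => ∀ w ∈ W, (∃ v ∈ V, v ≤ w) ∧ ∃ v ∈ V, w ≤ v).card

/-- The largest element of the block of `l`. If `l` is the smaller element of its block in a pair
partition, this is the other element. -/
def partner {k : ℕ} (π : Part k) (l : Fin k) : ℕ := (π.part l).sup fun i => (i : ℕ)

section Laws

variable {R : Type*} [Ring R]

/-- The nested evaluation of the part `b_l X_l b_{l+1} ⋯ X_{r-1} b_r` of the word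
`b₀ X₀ b₁ X₁ ⋯ X_{k-1} b_k` along a non-crossing pair partition of the letters `X₀, …, X_{k-1}`,
where `[l, r)` is a union of blocks: each block `V = {X_p, X_q}` contributes the map `f V`, applied
to the value of the part of the word between `X_p` and `X_q`. If `X_m` is the partner of the
leftmost letter `X_l`, then the value is
`b_l * f {X_l, X_m} (value of b_{l+1} ⋯ b_m) * (value of b_{m+1} ⋯ b_r)`. The value `0` is never
reached for pair partitions without crossings. -/
def nestedEval {k : ℕ} (π : Part k) (f : Finset (Fin k) → R → R) (b : ℕ → R) (l r : ℕ) : R :=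
  if h : l < r ∧ r ≤ k then
    if l < partner π ⟨l, lt_of_lt_of_le h.1 h.2⟩ ∧
        partner π ⟨l, lt_of_lt_of_le h.1 h.2⟩ < r then
      b l *
        f (π.part ⟨l, lt_of_lt_of_le h.1 h.2⟩)
          (nestedEval π f b (l + 1) (partner π ⟨l, lt_of_lt_of_le h.1 h.2⟩)) *
        nestedEval π f b (partner π ⟨l, lt_of_lt_of_le h.1 h.2⟩ + 1) r
    else 0
  else b l
termination_by r - l
decreasing_by all_goals omega

/-- `b₀ η_π(b₁, …, b_{k-1}) b_k`: every block of `π` is evaluated by `η`. -/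
def etaPart {k : ℕ} (η : R → R) (π : Part k) (b : ℕ → R) : R :=
  nestedEval π (fun _ => η) b 0 k

/-- `b₀ ∂η_π(b₁, …, b_{k-1}) b_k`: the sum over the blocks `V` of `π` of the evaluation in which `V`
is evaluated by `η'` and all the other blocks by `η`. -/
def dEtaPart {k : ℕ} (η η' : R → R) (π : Part k) (b : ℕ → R) : R :=
  ∑ V ∈ π.parts, nestedEval π (Function.update (fun _ => η) V η') b 0 k

/-- `b₀ f₀(b₁) b₂ f₁(b₃) b₄ ⋯ f_{m-1}(b_{2m-1}) b_{2m}`. -/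
def altProd (f : ℕ → R → R) (b : ℕ → R) (m : ℕ) : R :=
  b 0 * ((List.range m).map fun j => f j (b (2 * j + 1)) * b (2 * j + 2)).prod

/-! The laws below are given by their values on the monomials `b₀ X b₁ X ⋯ X b_k`; only the values
`b 0, …, b k` matter. -/

/-- The centered `B`-valued semicircle law with variance `η`. -/
def semicircle (η : R → R) (k : ℕ) (b : ℕ → R) : R :=
  if Even k then ∑ π ∈ NC2 k, etaPart η π b else 0

/-- The centered `B`-valued infinitesimal semicircle law. -/
def infSemicircle (η η' : R → R) (k : ℕ) (b : ℕ → R) : R :=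
  if Even k then ∑ π ∈ NC2 k, dEtaPart η η' π b else 0

/-- The centered `B`-valued Bernoulli law with variance `η`. -/
def bernoulli (η : R → R) (k : ℕ) (b : ℕ → R) : R :=
  if Even k then altProd (fun _ => η) b (k / 2) else 0

/-- The centered `B`-valued infinitesimal Bernoulli law. -/
def infBernoulli (η η' : R → R) (k : ℕ) (b : ℕ → R) : R :=
  if Even k then
    ∑ j ∈ Finset.range (k / 2), altProd (Function.update (fun _ => η) j η') b (k / 2)
  else 0

variable [Algebra ℂ R]

/-- The centered `B`-valued arcsine law with variance `η`. -/
def arcsine (η : R → R) (k : ℕ) (b : ℕ → R) : R :=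
  if Even k then ∑ π ∈ NC2 k, ((treeFactorial π : ℂ)⁻¹) • etaPart η π b else 0

/-- The centered `B`-valued infinitesimal arcsine law. -/
def infArcsine (η η' : R → R) (k : ℕ) (b : ℕ → R) : R :=
  if Even k then ∑ π ∈ NC2 k, ((treeFactorial π : ℂ)⁻¹) • dEtaPart η η' π b else 0

end Laws

end OVI

end

/-!
The pair `(E, E')` is a single conditional expectation over the dual numbers `B[ε]`, `ε² = 0`: the
map `E + ε E'` from `A[ε]` to `B[ε]` (`Space.dual`) is `B[ε]`-bilinear, and infinitesimal freeness,
Boolean independence and monotone independence are precisely what is needed for the corresponding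
ordinary independence with respect to this map (`InfFreeAlgebras.dual`, `InfBooleanAlgebras.dual`,
`InfMonotoneAlgebras.dual`). Its variance is the `ε`-linear extension of `η + ε η'` (`dualMap`),
and expanding the laws with this variance in powers of `ε` gives the infinitesimal laws
(`semicircle_dualMap`, `bernoulli_dualMap`, `arcsine_dualMap`). So it suffices to prove the
ordinary operator-valued central limit theorems for an arbitrary bimodule map `D.E : A → B` between
rings. No continuity of `D.E` is available or needed: `N` enters a moment of `S_N` only through
scalar coefficients.

*Reduction to pairings.* The moment of order `k` is `N ^ (-k/2)` times the sum of the moments of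
all index words `Fin k → {0, …, N-1}`. A word is an order preserving relabelling of a unique
surjective word `Fin k → Fin m`, and its moment depends on the latter only, because independence
and the marginal moments determine mixed moments (`IsFree.E_wordProd_congr`,
`IsBoolean.E_wordProd_congr`, `IsMonotone.E_wordProd_congr`). Each surjective word thus contributes
with weight `choose N m / N ^ (k/2)`. A word in which some index occurs once has moment zero. So
only words with `2 * m ≤ k` matter, and in the limit only `m = k / 2` remains, with weight `1 / m!`
(`tendsto_sum_words`, `tendsto_moment`). In these words each index occurs twice.

*Moments of paired words.* For free families, a word with a crossing has moment zero
(`IsFree.E_wordProd_eq_zero_of_crossing`), and in a non-crossing one a pair of letters `a_i` and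
the word `u` between them may be replaced by `η (E u)` (`IsFree.E_wordProd_block`), so the moment is
the nested evaluation (`wordMoment_eq_etaPart`); each pairing comes from `m!` words. Both facts rest
on the factorization `E (x u y) = E (x E(u) y)` for `x`, `y` in the algebra of the indices that do
not occur in `u` (`IsFree.E_mul_mul`). For Boolean families only words whose consecutive letters are paired
contribute (`IsBoolean.E_wordProd_segment`). For monotone families the word contributes only if
indices strictly increase along nesting, and then it gives the nested evaluation again. Hence a
non-crossing pairing is counted by the linear extensions of its nesting forest; by the hook length
formula (`card_linearExtensions_mul_prod_hookLength`) there are `m! / τ(π)!` of them, which leaves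
the weight `1 / τ(π)!` of the arcsine law.
-/

noncomputable section

namespace OVI

/-! ### Conditional expectations and words -/

/-- A `B`-valued probability space given by an embedding `ι : B → A` and a `B`-bimodule map
`E : A → B` with `E ∘ ι = id`. Unlike in `Space`, the ring `B` need not be a subring of `A`, so that
the dual numbers over `A` and `B` are covered. -/
structure CondExp (A B : Type*) [Ring A] [Ring B] where
  /-- the inclusion of the scalars -/
  ι : B →+* A
  /-- the conditional expectation -/
  E : A →+ B
  E_ι : ∀ b, E (ι b) = b
  E_bimodule : ∀ (b b' : B) (a : A), E (ι b * a * ι b') = b * E a * b'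

section Words

variable {A B I : Type*} [Ring A] [Ring B]

namespace CondExp

variable (D : CondExp A B)

lemma E_left (b : B) (a : A) : D.E (D.ι b * a) = b * D.E a := by
  simpa using D.E_bimodule b 1 a

lemma E_right (b : B) (a : A) : D.E (a * D.ι b) = D.E a * b := by
  simpa using D.E_bimodule 1 b a

lemma E_one : D.E 1 = 1 := by
  simpa using D.E_ι 1

end CondExp

/-- The product `a_{i₁} b₁ a_{i₂} b₂ ⋯ a_{i_n} b_n` of the word `(i₁, b₁), …, (i_n, b_n)`. -/
def wordProd (ι : B →+* A) (a : I → A) (w : List (I × B)) : A :=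
  (w.map fun p => a p.1 * ι p.2).prod

section wordProd

variable (ι : B →+* A) (a : I → A)

@[simp] lemma wordProd_nil : wordProd ι a [] = 1 := rfl

@[simp] lemma wordProd_cons (p : I × B) (w : List (I × B)) :
    wordProd ι a (p :: w) = a p.1 * ι p.2 * wordProd ι a w := by
  simp [wordProd]

@[simp] lemma wordProd_append (u v : List (I × B)) :
    wordProd ι a (u ++ v) = wordProd ι a u * wordProd ι a v := by
  simp [wordProd]

/-- A scalar to the right of a word can be absorbed into its last letter, or pulled out to the left
if there is no letter. The result does not depend on the family into which the word is evaluated. -/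
lemma exists_absorb (u : List (I × B)) (d : B) :
    ∃ (d' : B) (u' : List (I × B)), u'.map Prod.fst = u.map Prod.fst ∧
      ∀ a : I → A, wordProd ι a u * ι d = ι d' * wordProd ι a u' := by
  rcases List.eq_nil_or_concat' u with rfl | ⟨u, p, rfl⟩
  · exact ⟨d, [], rfl, fun a => by simp⟩
  · exact ⟨1, u ++ [(p.1, p.2 * d)], by simp, fun a => by simp [mul_assoc]⟩

lemma wordProd_reindex {J : Type*} (φ : J → I) (w : List (J × B)) :
    wordProd ι a (w.map fun p => (φ p.1, p.2)) = wordProd ι (a ∘ φ) w := by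
  simp [wordProd, Function.comp_def]

/-- Words in a single letter belong to every additive and multiplicative `B`-bimodule containing
that letter. -/
lemma wordProd_mem {C : NonUnitalSubring A} (hC : ∀ b, ∀ x ∈ C, x * ι b ∈ C) {i : I}
    (ha : a i ∈ C) {w : List (I × B)} (hne : w ≠ []) (hw : ∀ p ∈ w, p.1 = i) :
    wordProd ι a w ∈ C := by
  induction w with
  | nil => exact absurd rfl hne
  | cons p w ih =>
    have h1 : a p.1 * ι p.2 ∈ C := by
      rw [hw p (by simp)]
      exact hC _ _ ha
    rcases eq_or_ne w [] with rfl | h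
    · simpa using h1
    · rw [wordProd_cons]
      exact C.mul_mem h1 (ih h fun q hq => hw q (by simp [hq]))

end wordProd

/-- Two families have the same one-letter moments. -/
def SameMarginals (D : CondExp A B) (a a' : I → A) : Prop :=
  ∀ (i : I) (l : List B),
    D.E (a i * (l.map fun b => D.ι b * a i).prod) = D.E (a' i * (l.map fun b => D.ι b * a' i).prod)

lemma SameMarginals.wordProd {D : CondExp A B} {a a' : I → A} (h : SameMarginals D a a') {i : I}
    {w : List (I × B)} (hw : ∀ p ∈ w, p.1 = i) :
    D.E (wordProd D.ι a w) = D.E (OVI.wordProd D.ι a' w) := by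
  rcases List.eq_nil_or_concat' w with rfl | ⟨u, p, rfl⟩
  · simp
  -- shifting the brackets, `a b₁ a b₂ ⋯ a b_n = (a ∏ (b_l a)) b_n`
  have key : ∀ (a : I → A) (u : List (I × B)), (∀ q ∈ u, q.1 = i) →
      OVI.wordProd D.ι a u * a i = a i * ((u.map Prod.snd).map fun b => D.ι b * a i).prod := by
    intro a u hu
    induction u with
    | nil => simp
    | cons q u ih =>
      rw [wordProd_cons, mul_assoc, ih fun r hr => hu r (by simp [hr]), hu q (by simp)]
      simp [mul_assoc]
  have hu : ∀ q ∈ u, q.1 = i := fun q hq => hw q (by simp [hq])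
  have hp : p.1 = i := hw p (by simp)
  simp only [wordProd_append, wordProd_cons, wordProd_nil, mul_one, ← mul_assoc, D.E_right, hp,
    key _ u hu, h i]

end Words

/-! ### Freeness -/

section Free

variable {A B I : Type*} [Ring A] [Ring B]

/-- A word of elements of the subrings `𝒜 i` with alternating indices, all of them centered. -/
def IsCenteredWord (D : CondExp A B) (𝒜 : I → Subring A) (L : List (I × A)) : Prop :=
  (L.map Prod.fst).IsChain (· ≠ ·) ∧ ∀ p ∈ L, p.2 ∈ 𝒜 p.1 ∧ D.E p.2 = 0

/-- Freeness over `B` of a family of subrings containing the scalars. -/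
def IsFree (D : CondExp A B) (𝒜 : I → Subring A) : Prop :=
  (∀ i b, D.ι b ∈ 𝒜 i) ∧
    ∀ L : List (I × A), L ≠ [] → IsCenteredWord D 𝒜 L → D.E (L.map Prod.snd).prod = 0

variable {D : CondExp A B} {𝒜 : I → Subring A}

lemma IsFree.comp {J : Type*} (h : IsFree D 𝒜) {φ : J → I} (hφ : Function.Injective φ) :
    IsFree D fun j => 𝒜 (φ j) := by
  refine ⟨fun j b => h.1 _ b, fun L hL hc => ?_⟩
  have := h.2 (L.map fun p => (φ p.1, p.2)) (by simpa using hL) ⟨?_, ?_⟩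
  · simpa [Function.comp_def] using this
  · have h1 := hc.1
    rw [List.isChain_map] at h1
    rw [List.map_map, List.isChain_map]
    exact h1.imp fun p q hpq => fun he => hpq (hφ he)
  · intro p hp
    obtain ⟨q, hq, rfl⟩ := List.mem_map.1 hp
    exact hc.2 q hq

lemma IsCenteredWord.append {L M : List (I × A)} (hL : IsCenteredWord D 𝒜 L)
    (hM : IsCenteredWord D 𝒜 M) (h : ∀ p ∈ L.getLast?, ∀ q ∈ M.head?, p.1 ≠ q.1) :
    IsCenteredWord D 𝒜 (L ++ M) := by
  refine ⟨?_, ?_⟩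
  · rw [List.map_append, List.isChain_append]
    refine ⟨hL.1, hM.1, fun x hx y hy => ?_⟩
    rw [List.getLast?_map, Option.mem_map] at hx
    rw [List.head?_map, Option.mem_map] at hy
    obtain ⟨p, hp, rfl⟩ := hx
    obtain ⟨q, hq, rfl⟩ := hy
    exact h p hp q hq
  · intro p hp
    rcases List.mem_append.1 hp with hp | hp
    exacts [hL.2 p hp, hM.2 p hp]

/-- The span of the nonempty alternating centered products with indices in `J`. -/
def centeredSpan (D : CondExp A B) (𝒜 : I → Subring A) (J : Set I) : AddSubgroup A :=
  AddSubgroup.closure {x | ∃ L : List (I × A), L ≠ [] ∧ IsCenteredWord D 𝒜 L ∧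
    (∀ p ∈ L, p.1 ∈ J) ∧ x = (L.map Prod.snd).prod}

/-- The span of the scalars and the alternating centered products with indices in `J`. -/
def scalarCenteredSpan (D : CondExp A B) (𝒜 : I → Subring A) (J : Set I) : AddSubgroup A :=
  D.ι.range.toAddSubgroup ⊔ centeredSpan D 𝒜 J

lemma mem_scalarCenteredSpan {J : Set I} {x : A} :
    x ∈ scalarCenteredSpan D 𝒜 J ↔ ∃ b, ∃ y ∈ centeredSpan D 𝒜 J, D.ι b + y = x := by
  simp [scalarCenteredSpan, AddSubgroup.mem_sup]

lemma ι_mem_scalarCenteredSpan {J : Set I} (b : B) :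
    D.ι b ∈ scalarCenteredSpan D 𝒜 J :=
  AddSubgroup.mem_sup_left ⟨b, rfl⟩

lemma prod_mem_scalarCenteredSpan {J : Set I} {L : List (I × A)} (hL : IsCenteredWord D 𝒜 L)
    (hJ : ∀ p ∈ L, p.1 ∈ J) : (L.map Prod.snd).prod ∈ scalarCenteredSpan D 𝒜 J := by
  rcases eq_or_ne L [] with rfl | hne
  · simpa using ι_mem_scalarCenteredSpan (D := D) (𝒜 := 𝒜) (J := J) 1
  · exact AddSubgroup.mem_sup_right (AddSubgroup.subset_closure ⟨L, hne, hL, hJ, rfl⟩)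

/-- Split a factor into its expectation and its centered part and put it in front of a centered word
which starts with another index. -/
lemma mul_prod_mem_aux (h𝒜 : ∀ i b, D.ι b ∈ 𝒜 i) {J : Set I} {j : I} (hj : j ∈ J) {x : A}
    (hx : x ∈ 𝒜 j) {L : List (I × A)} (hL : IsCenteredWord D 𝒜 L) (hJ : ∀ p ∈ L, p.1 ∈ J)
    (hhead : ∀ i ∈ (L.map Prod.fst).head?, j ≠ i) :
    x * (L.map Prod.snd).prod ∈ scalarCenteredSpan D 𝒜 J := by
  have h1 : (x - D.ι (D.E x)) * (L.map Prod.snd).prod ∈ scalarCenteredSpan D 𝒜 J := by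
    have := prod_mem_scalarCenteredSpan (D := D) (𝒜 := 𝒜) (J := J)
      (L := (j, x - D.ι (D.E x)) :: L) ⟨?_, ?_⟩ ?_
    · simpa using this
    · rw [List.map_cons, List.isChain_cons]
      exact ⟨hhead, hL.1⟩
    · intro p hp
      rcases List.mem_cons.1 hp with rfl | hp
      · exact ⟨(𝒜 j).sub_mem hx (h𝒜 _ _), by simp [D.E_ι]⟩
      · exact hL.2 p hp
    · intro p hp
      rcases List.mem_cons.1 hp with rfl | hp
      exacts [hj, hJ p hp]
  have h2 : D.ι (D.E x) * (L.map Prod.snd).prod ∈ scalarCenteredSpan D 𝒜 J := by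
    cases L with
    | nil => simpa using ι_mem_scalarCenteredSpan (D := D) (𝒜 := 𝒜) (J := J) (D.E x)
    | cons p L =>
      have := prod_mem_scalarCenteredSpan (D := D) (𝒜 := 𝒜) (J := J)
        (L := (p.1, D.ι (D.E x) * p.2) :: L) ⟨?_, ?_⟩ ?_
      · simpa [mul_assoc] using this
      · simpa using hL.1
      · intro q hq
        rcases List.mem_cons.1 hq with rfl | hq
        · have := hL.2 p (by simp)
          exact ⟨(𝒜 p.1).mul_mem (h𝒜 _ _) this.1, by simp [D.E_left, this.2]⟩
        · exact hL.2 q (by simp [hq])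
      · intro q hq
        rcases List.mem_cons.1 hq with rfl | hq
        exacts [hJ p (by simp), hJ q (by simp [hq])]
  simpa [sub_mul] using add_mem h1 h2

lemma mul_mem_scalarCenteredSpan (h𝒜 : ∀ i b, D.ι b ∈ 𝒜 i) {J : Set I} {j : I} (hj : j ∈ J)
    {x y : A} (hx : x ∈ 𝒜 j) (hy : y ∈ scalarCenteredSpan D 𝒜 J) :
    x * y ∈ scalarCenteredSpan D 𝒜 J := by
  obtain ⟨b, y, hy', rfl⟩ := mem_scalarCenteredSpan.1 hy
  rw [mul_add]
  refine add_mem ?_ ?_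
  · have := mul_prod_mem_aux (D := D) h𝒜 hj ((𝒜 j).mul_mem hx (h𝒜 j b)) (L := [])
      ⟨.nil, by simp⟩ (by simp) (by simp)
    rwa [List.map_nil, List.prod_nil, mul_one] at this
  · clear hy
    induction hy' using AddSubgroup.closure_induction with
    | zero => rw [mul_zero]; exact zero_mem _
    | add u v _ _ hu hv => rw [mul_add]; exact add_mem hu hv
    | neg u _ hu => rw [mul_neg]; exact neg_mem hu
    | mem u hu =>
      obtain ⟨L, hne, hL, hJ, rfl⟩ := hu
      cases L with
      | nil => exact absurd rfl hne
      | cons p L =>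
        by_cases hjp : j = p.1
        · -- the factor merges with the first letter of the word
          have hc := hL.1
          rw [List.map_cons, List.isChain_cons] at hc
          rw [List.map_cons, List.prod_cons, ← mul_assoc]
          have hp := (hL.2 p (by simp)).1
          rw [← hjp] at hp
          exact mul_prod_mem_aux h𝒜 hj ((𝒜 j).mul_mem hx hp)
            ⟨hc.2, fun q hq => hL.2 q (by simp [hq])⟩ (fun q hq => hJ q (by simp [hq]))
            (by rw [hjp]; exact hc.1)
        · exact mul_prod_mem_aux h𝒜 hj hx hL hJ (by simpa using hjp)

lemma wordProd_mem_scalarCenteredSpan (h𝒜 : ∀ i b, D.ι b ∈ 𝒜 i) {a : I → A}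
    (ha : ∀ i, a i ∈ 𝒜 i) {J : Set I} {w : List (I × B)} (hw : ∀ p ∈ w, p.1 ∈ J) :
    wordProd D.ι a w ∈ scalarCenteredSpan D 𝒜 J := by
  induction w with
  | nil => simpa using ι_mem_scalarCenteredSpan (D := D) (𝒜 := 𝒜) (J := J) 1
  | cons p w ih =>
    rw [wordProd_cons]
    exact mul_mem_scalarCenteredSpan h𝒜 (hw p (by simp)) ((𝒜 _).mul_mem (ha _) (h𝒜 _ _))
      (ih fun q hq => hw q (by simp [hq]))

/-- A factor `u` with indices in `J` between factors with indices outside `J` may be replaced by its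
expectation: the centered part of `u` is a sum of alternating centered products, which
remain alternating when the neighbours are expanded in the same way. -/
lemma IsFree.E_mul_mul (h : IsFree D 𝒜) {J : Set I} {x u y : A}
    (hx : x ∈ scalarCenteredSpan D 𝒜 Jᶜ) (hu : u ∈ scalarCenteredSpan D 𝒜 J)
    (hy : y ∈ scalarCenteredSpan D 𝒜 Jᶜ) :
    D.E (x * u * y) = D.E (x * D.ι (D.E u) * y) := by
  have key : ∀ u ∈ centeredSpan D 𝒜 J, D.E u = 0 ∧ D.E (x * u * y) = 0 := by
    intro u hu
    induction hu using AddSubgroup.closure_induction with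
    | zero => simp
    | add u v _ _ hu hv => simp [mul_add, add_mul, hu.1, hu.2, hv.1, hv.2]
    | neg u _ hu => simp [hu.1, hu.2]
    | mem u hu =>
      obtain ⟨L, hne, hL, hJ, rfl⟩ := hu
      refine ⟨h.2 L hne hL, ?_⟩
      -- first treat a left factor that is a centered word, possibly empty
      have aux : ∀ M : List (I × A), IsCenteredWord D 𝒜 M → (∀ p ∈ M, p.1 ∈ Jᶜ) →
          D.E ((M.map Prod.snd).prod * (L.map Prod.snd).prod * y) = 0 := by
        intro M hM hMJ
        have hML := hM.append hL fun p hp q hq he =>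
          hMJ p (List.mem_of_mem_getLast? hp) (he ▸ hJ q (List.mem_of_mem_head? hq))
        obtain ⟨c, y', hy', rfl⟩ := mem_scalarCenteredSpan.1 hy
        rw [mul_add, map_add, D.E_right, ← List.prod_append, ← List.map_append,
          h.2 _ (by simp [hne]) hML, zero_mul, zero_add]
        clear hy
        induction hy' using AddSubgroup.closure_induction with
        | zero => simp
        | add u v _ _ hu hv => rw [mul_add, map_add, hu, hv, add_zero]
        | neg u _ hu => rw [mul_neg, map_neg, hu, neg_zero]
        | mem v hv =>
          obtain ⟨N, -, hN, hNJ, rfl⟩ := hv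
          have := hML.append hN (by
            intro p hp q hq he
            rw [List.getLast?_append_of_ne_nil _ hne] at hp
            exact hNJ q (List.mem_of_mem_head? hq) (he ▸ hJ p (List.mem_of_mem_getLast? hp)))
          rw [← List.prod_append, ← List.map_append]
          exact h.2 _ (by simp [hne]) this
      obtain ⟨b, x', hx', rfl⟩ := mem_scalarCenteredSpan.1 hx
      have h0 := aux [] ⟨by simp, by simp⟩ (by simp)
      simp only [List.map_nil, List.prod_nil, one_mul] at h0
      rw [add_mul, add_mul, map_add, mul_assoc, D.E_left, h0, mul_zero, zero_add]
      clear hx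
      induction hx' using AddSubgroup.closure_induction with
      | zero => simp
      | add u v _ _ hu hv => simp [add_mul, hu, hv]
      | neg u _ hu => simp [hu]
      | mem v hv =>
        obtain ⟨M, -, hM, hMJ, rfl⟩ := hv
        exact aux M hM hMJ
  obtain ⟨b, u, hu', rfl⟩ := mem_scalarCenteredSpan.1 hu
  obtain ⟨h1, h2⟩ := key u hu'
  simp [mul_add, add_mul, D.E_ι, h1, h2]

end Free

/-! ### Words in which an index is adjacent to itself -/

section Lists

variable {I : Type*}

lemma not_sublist_of_adjacent {u v : List I} {i q : I} (hu : i ∉ u) (hv : i ∉ v) (hq : q ≠ i) :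
    ¬ [i, q, i].Sublist (u ++ i :: i :: v) := by
  intro h
  obtain ⟨l₁, l₂, he, h₁, h₂⟩ := List.sublist_append_iff.1 h
  cases l₁ with
  | cons x l₁ =>
    simp only [List.cons_append, List.cons.injEq] at he
    exact hu (h₁.subset (by simp [he.1]))
  | nil =>
    rw [List.nil_append] at he
    subst he
    have h3 : [q, i].Sublist (i :: v) := by simpa using h₂
    have h4 : [q, i].Sublist v := by
      cases h3 with
      | cons _ h => exact h
      | cons_cons h => exact absurd rfl hq
    exact hv (h4.subset (by simp))

lemma sublist_of_adjacent {s u v : List I} {i : I} (hs : i ∉ s)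
    (h : s.Sublist (u ++ i :: i :: v)) : s.Sublist (u ++ v) := by
  classical
  have h1 := h.filter (fun x => x ≠ i)
  rw [List.filter_eq_self.2 (by
    intro x hx
    have : x ≠ i := by
      rintro rfl
      exact hs hx
    simpa using this)] at h1
  refine h1.trans ?_
  simp only [List.filter_append, ne_eq, decide_not, decide_true, Bool.not_true, Bool.false_eq_true,
    not_false_eq_true, List.filter_cons_of_neg]
  exact (List.filter_sublist).append (List.filter_sublist)

variable {B : Type*} [DecidableEq I]

/-- Split a word at the only occurrence of an index. -/
lemma exists_split_of_count_eq_one {w : List (I × B)} {p : I}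
    (h : (w.map Prod.fst).count p = 1) :
    ∃ u b v, w = u ++ (p, b) :: v ∧ (∀ q ∈ u, q.1 ≠ p) ∧ ∀ q ∈ v, q.1 ≠ p := by
  have hp : p ∈ w.map Prod.fst := List.count_pos_iff.1 (by omega)
  obtain ⟨⟨p', b⟩, hb, he⟩ := List.mem_map.1 hp
  obtain rfl : p' = p := he
  obtain ⟨u, v, rfl⟩ := List.append_of_mem hb
  simp only [List.map_append, List.map_cons, List.count_append, List.count_cons_self] at h
  refine ⟨u, b, v, rfl, fun q hq he => ?_, fun q hq he => ?_⟩
  · have := List.count_pos_iff.2 (List.mem_map.2 ⟨q, hq, he⟩)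
    omega
  · have := List.count_pos_iff.2 (List.mem_map.2 ⟨q, hq, he⟩)
    omega

lemma forall_ne_of_count_le_two {u v : List (I × B)} {i : I} {b c : B}
    (h : ((u ++ (i, b) :: (i, c) :: v).map Prod.fst).count i ≤ 2) :
    i ∉ u.map Prod.fst ∧ i ∉ v.map Prod.fst := by
  simp only [List.map_append, List.map_cons, List.count_append, List.count_cons_self] at h
  rw [← List.count_eq_zero, ← List.count_eq_zero]
  omega

lemma count_remove_le {u r v u' : List (I × B)} (hu : u'.map Prod.fst = u.map Prod.fst)
    {n : ℕ} (p : I) (h : ((u ++ r ++ v).map Prod.fst).count p ≤ n) :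
    ((u' ++ v).map Prod.fst).count p ≤ n := by
  simp only [List.map_append, List.count_append] at h ⊢
  rw [hu]
  omega

end Lists

/-! ### Moments of free families -/

section FreeWords

variable {A B I : Type*} [Ring A] [Ring B] {D : CondExp A B} {𝒜 : I → Subring A} {a : I → A}

lemma IsFree.E_wordProd_eq_zero_of_count_eq_one [DecidableEq I] (h : IsFree D 𝒜)
    (ha : ∀ i, a i ∈ 𝒜 i) (hE : ∀ i, D.E (a i) = 0) {w : List (I × B)} {p : I}
    (hp : (w.map Prod.fst).count p = 1) : D.E (wordProd D.ι a w) = 0 := by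
  obtain ⟨u, b, v, rfl, hu, hv⟩ := exists_split_of_count_eq_one hp
  have := h.E_mul_mul (J := {p})
    (wordProd_mem_scalarCenteredSpan h.1 ha (w := u) (by simpa using hu))
    (wordProd_mem_scalarCenteredSpan h.1 ha (w := [(p, b)]) (by simp))
    (wordProd_mem_scalarCenteredSpan h.1 ha (w := v) (by simpa using hv))
  simpa [D.E_right, hE, mul_assoc] using this

/-- A block `{i, i}` of a word of a free family such that no index occurs both between the letters
`a_i` and after them. -/
lemma IsFree.E_wordProd_block (h : IsFree D 𝒜) (ha : ∀ i, a i ∈ 𝒜 i) {i : I} {b c : B}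
    {u v : List (I × B)} (hu : ∀ p ∈ u, p.1 ≠ i) (hv : ∀ p ∈ v, p.1 ≠ i)
    (huv : ∀ p ∈ u, ∀ q ∈ v, p.1 ≠ q.1) :
    D.E (wordProd D.ι a ((i, b) :: u ++ (i, c) :: v)) =
      D.E (a i * D.ι (b * D.E (wordProd D.ι a u)) * a i) * c * D.E (wordProd D.ι a v) := by
  have h1 := h.E_mul_mul (J := {j | ∃ p ∈ u, p.1 = j})
    (wordProd_mem_scalarCenteredSpan h.1 ha (w := [(i, b)]) (by
      rintro p hp ⟨q, hq, he⟩
      rw [List.mem_singleton.1 hp] at he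
      exact hu q hq he))
    (wordProd_mem_scalarCenteredSpan h.1 ha (w := u) (fun p hp => ⟨p, hp, rfl⟩))
    (wordProd_mem_scalarCenteredSpan h.1 ha (w := (i, c) :: v) (by
      rintro p hp ⟨q, hq, he⟩
      rcases List.mem_cons.1 hp with rfl | hp
      exacts [hu q hq he, huv q hq p hp he]))
  have h2 := h.E_mul_mul (J := {i}) (x := 1)
    (by simpa using ι_mem_scalarCenteredSpan (D := D) (𝒜 := 𝒜) (J := {i}ᶜ) 1)
    (wordProd_mem_scalarCenteredSpan h.1 ha
      (w := [(i, b * D.E (wordProd D.ι a u)), (i, c)]) (by simp))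
    (wordProd_mem_scalarCenteredSpan h.1 ha (w := v) (by simpa using hv))
  simp only [wordProd_cons, wordProd_nil, mul_one, one_mul, map_mul, mul_assoc,
    List.cons_append, wordProd_append] at h1 h2 ⊢
  rw [h1, h2]
  simp only [← map_mul, D.E_left, ← mul_assoc, D.E_right]

/-- Words with a crossing vanish: removing blocks of two adjacent letters one arrives at an
alternating word. -/
lemma IsFree.E_wordProd_eq_zero_of_crossing [DecidableEq I] (h : IsFree D 𝒜)
    (ha : ∀ i, a i ∈ 𝒜 i) (hE : ∀ i, D.E (a i) = 0) {p q : I} (hpq : p ≠ q) {w : List (I × B)}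
    (hw : ∀ i, (w.map Prod.fst).count i ≤ 2) (hs : [p, q, p, q].Sublist (w.map Prod.fst)) :
    D.E (wordProd D.ι a w) = 0 := by
  induction hn : w.length using Nat.strong_induction_on generalizing w with
  | _ n ih =>
  by_cases hc : w.IsChain fun x y => x.1 ≠ y.1
  · have := h.2 (w.map fun x => (x.1, a x.1 * D.ι x.2)) ?_ ⟨?_, ?_⟩
    · simpa [wordProd, Function.comp_def] using this
    · rintro h0
      rw [List.map_eq_nil_iff] at h0
      subst h0
      simp at hs
    · rw [List.map_map, List.isChain_map]
      exact hc
    · intro x hx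
      obtain ⟨y, -, rfl⟩ := List.mem_map.1 hx
      exact ⟨(𝒜 _).mul_mem (ha _) (h.1 _ _), by simp [D.E_right, hE]⟩
  · rw [List.isChain_iff_forall_rel_of_append_cons_cons] at hc
    push Not at hc
    obtain ⟨⟨i, b⟩, ⟨j, c⟩, u, v, rfl, hij⟩ := hc
    obtain rfl : i = j := hij
    obtain ⟨hu, hv⟩ := forall_ne_of_count_le_two (hw i)
    have h1 := h.E_mul_mul (J := {i})
      (wordProd_mem_scalarCenteredSpan h.1 ha (w := u)
        (by simpa using fun p hp he => hu (List.mem_map.2 ⟨p, hp, he⟩)))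
      (wordProd_mem_scalarCenteredSpan h.1 ha (w := [(i, b), (i, c)]) (by simp))
      (wordProd_mem_scalarCenteredSpan h.1 ha (w := v)
        (by simpa using fun p hp he => hv (List.mem_map.2 ⟨p, hp, he⟩)))
    obtain ⟨d, u', hu', hd⟩ := exists_absorb D.ι u (D.E (wordProd D.ι a [(i, b), (i, c)]))
    rw [hd a, mul_assoc (D.ι d), D.E_left, ← wordProd_append, ← wordProd_append,
      ← wordProd_append] at h1
    have hs' := hs
    simp only [List.map_append, List.map_cons] at hs'
    have hpi : i ≠ p := by
      rintro rfl
      exact not_sublist_of_adjacent hu hv hpq.symm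
        (List.Sublist.trans (by simp) hs')
    have hqi : i ≠ q := by
      rintro rfl
      exact not_sublist_of_adjacent hu hv hpq (List.Sublist.trans (by simp) hs')
    have h2 : D.E (wordProd D.ι a (u' ++ v)) = 0 := by
      refine ih _ ?_ (fun j => ?_) ?_ rfl
      · have := congrArg List.length hu'
        simp only [List.length_map] at this
        rw [← hn]
        simp [this]
      · exact count_remove_le (r := [(i, b), (i, c)]) hu' j (by simpa using hw j)
      · rw [List.map_append, hu']
        exact sublist_of_adjacent (by simp [hpi, hqi]) hs'
    rw [h2, mul_zero] at h1
    simpa using h1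

/-- The diagonal embedding of the scalars into `A × A`, with the expectation of the first
component. -/
def CondExp.diag (D : CondExp A B) : CondExp (A × A) B where
  ι := D.ι.prod D.ι
  E := D.E.comp (AddMonoidHom.fst A A)
  E_ι b := by simp [D.E_ι]
  E_bimodule b b' x := by simp [D.E_bimodule]

lemma wordProd_diag (D : CondExp A B) (a a' : I → A) (w : List (I × B)) :
    wordProd D.diag.ι (fun i => (a i, a' i)) w = (wordProd D.ι a w, wordProd D.ι a' w) := by
  induction w with
  | nil => rfl
  | cons p w ih =>
    rw [wordProd_cons, ih]
    simp [CondExp.diag]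

/-- Pairs of elements of the algebras generated by the scalars and `a`, respectively `a'`, that are
given by the same formula. -/
def pairAlg (D : CondExp A B) (a a' : A) : Subring (A × A) :=
  Subring.closure (insert (a, a') (Set.range D.diag.ι))

lemma E_eq_of_mem_pairAlg {a a' : I → A} (h : SameMarginals D a a') {i : I} {x : A × A}
    (hx : x ∈ pairAlg D (a i) (a' i)) : D.E x.1 = D.E x.2 := by
  rw [pairAlg, Subring.mem_closure_iff] at hx
  induction hx using AddSubgroup.closure_induction with
  | zero => simp
  | add x y _ _ hx hy => simp [hx, hy]
  | neg x _ hx => simp [hx]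
  | mem x hx =>
    -- a product of generators is a scalar times a word in one letter
    have key : ∃ (d : B) (w : List (I × B)), (∀ p ∈ w, p.1 = i) ∧
        x = D.diag.ι d * wordProd D.diag.ι (fun i => (a i, a' i)) w := by
      induction hx using Submonoid.closure_induction_left with
      | one => exact ⟨1, [], by simp, by simp⟩
      | mul_left x hx y _ ih =>
        obtain ⟨d, w, hw, rfl⟩ := ih
        rcases hx with rfl | ⟨c, rfl⟩
        · exact ⟨1, (i, d) :: w, by simpa using hw, by simp [mul_assoc]⟩
        · exact ⟨c * d, w, hw, by simp [mul_assoc]⟩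
    obtain ⟨d, w, hw, rfl⟩ := key
    rw [wordProd_diag]
    simp [CondExp.diag, D.E_left, h.wordProd hw]

/-- Freeness and the one-letter moments determine all moments: in `A × A` the pair of words is a
scalar plus a sum of products that are alternating and centered in both components. -/
lemma IsFree.E_wordProd_congr {𝒜' : I → Subring A} {a' : I → A} (h : IsFree D 𝒜)
    (h' : IsFree D 𝒜') (ha : ∀ i, a i ∈ 𝒜 i) (ha' : ∀ i, a' i ∈ 𝒜' i) (hd : SameMarginals D a a')
    (w : List (I × B)) : D.E (wordProd D.ι a w) = D.E (wordProd D.ι a' w) := by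
  have hw := wordProd_mem_scalarCenteredSpan (D := D.diag)
    (𝒜 := fun i => pairAlg D (a i) (a' i)) (a := fun i => (a i, a' i)) (J := Set.univ) (w := w)
    (fun i b => Subring.subset_closure (Or.inr ⟨b, rfl⟩))
    (fun i => Subring.subset_closure (Or.inl rfl)) (by simp)
  have hfst : ∀ i, ∀ x ∈ pairAlg D (a i) (a' i), x.1 ∈ 𝒜 i ∧ x.2 ∈ 𝒜' i := by
    intro i x hx
    have : pairAlg D (a i) (a' i) ≤ (𝒜 i).prod (𝒜' i) := by
      rw [pairAlg, Subring.closure_le]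
      rintro y (rfl | ⟨b, rfl⟩)
      exacts [⟨ha i, ha' i⟩, ⟨h.1 i b, h'.1 i b⟩]
    exact this hx
  rw [wordProd_diag] at hw
  obtain ⟨b, y, hy, he⟩ := mem_scalarCenteredSpan.1 hw
  have key : D.E y.1 = 0 ∧ D.E y.2 = 0 := by
    clear he
    induction hy using AddSubgroup.closure_induction with
    | zero => simp
    | add x y _ _ hx hy => simp [hx.1, hx.2, hy.1, hy.2]
    | neg x _ hx => simp [hx.1, hx.2]
    | mem x hx =>
      obtain ⟨L, hne, hL, -, rfl⟩ := hx
      constructor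
      · have := h.2 (L.map fun p => (p.1, p.2.1)) (by simpa using hne) ⟨?_, ?_⟩
        · rw [← RingHom.coe_fst, map_list_prod]
          simpa [Function.comp_def] using this
        · simpa [Function.comp_def] using hL.1
        · intro p hp
          obtain ⟨q, hq, rfl⟩ := List.mem_map.1 hp
          exact ⟨(hfst _ _ (hL.2 q hq).1).1, (hL.2 q hq).2⟩
      · have := h'.2 (L.map fun p => (p.1, p.2.2)) (by simpa using hne) ⟨?_, ?_⟩
        · rw [← RingHom.coe_snd, map_list_prod]
          simpa [Function.comp_def] using this
        · simpa [Function.comp_def] using hL.1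
        · intro p hp
          obtain ⟨q, hq, rfl⟩ := List.mem_map.1 hp
          exact ⟨(hfst _ _ (hL.2 q hq).1).2,
            (E_eq_of_mem_pairAlg hd (hL.2 q hq).1).symm.trans (hL.2 q hq).2⟩
  have h1 := congrArg Prod.fst he
  have h2 := congrArg Prod.snd he
  simp only [CondExp.diag, RingHom.prod_apply, Prod.fst_add, Prod.snd_add] at h1 h2
  rw [← h1, ← h2]
  simp [D.E_ι, key.1, key.2]

end FreeWords

/-! ### Moments of Boolean independent families -/

/-- Split off the first run of equal indices. -/
lemma exists_first_run {I B : Type*} {w : List (I × B)} (hw : w ≠ []) :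
    ∃ i r v, w = r ++ v ∧ r ≠ [] ∧ (∀ p ∈ r, p.1 = i) ∧ ∀ p ∈ v.head?, p.1 ≠ i := by
  induction w with
  | nil => exact absurd rfl hw
  | cons p w ih =>
    rcases eq_or_ne w [] with rfl | h
    · exact ⟨p.1, [p], [], by simp⟩
    · obtain ⟨i, r, v, rfl, hr, hri, hv⟩ := ih h
      by_cases hp : p.1 = i
      · exact ⟨i, p :: r, v, rfl, by simp, by simpa [hp] using hri, hv⟩
      · refine ⟨p.1, [p], r ++ v, rfl, by simp, by simp, fun q hq => ?_⟩
        rw [List.head?_append_of_ne_nil _ hr] at hq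
        rw [hri q (List.mem_of_mem_head? hq)]
        exact fun h => hp h.symm

lemma count_of_forall_eq {I B : Type*} [DecidableEq I] {p : I} {r : List (I × B)}
    (hr : ∀ q ∈ r, q.1 = p) :
    (r.map Prod.fst).count p = r.length := by
  rw [List.count_eq_length.2, List.length_map]
  intro x hx
  obtain ⟨q, hq, rfl⟩ := List.mem_map.1 hx
  exact (hr q hq).symm

lemma count_of_forall_ne {I B : Type*} [DecidableEq I] {p : I} {r : List (I × B)}
    (hr : ∀ q ∈ r, q.1 ≠ p) :
    (r.map Prod.fst).count p = 0 := by
  rw [List.count_eq_zero]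
  intro hx
  obtain ⟨q, hq, rfl⟩ := List.mem_map.1 hx
  exact hr q hq rfl

section Boolean

variable {A B I : Type*} [Ring A] [Ring B]

/-- Boolean independence over `B` of a family of nonunital subrings which are stable under
multiplication by scalars. -/
def IsBoolean (D : CondExp A B) (C : I → NonUnitalSubring A) : Prop :=
  (∀ i b, ∀ x ∈ C i, D.ι b * x ∈ C i ∧ x * D.ι b ∈ C i) ∧
    ∀ L : List (I × A), (L.map Prod.fst).IsChain (· ≠ ·) → (∀ p ∈ L, p.2 ∈ C p.1) →
      D.E (L.map Prod.snd).prod = (L.map fun p => D.E p.2).prod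

variable {D : CondExp A B} {C : I → NonUnitalSubring A} {a : I → A}

lemma IsBoolean.comp {J : Type*} (h : IsBoolean D C) {φ : J → I} (hφ : Function.Injective φ) :
    IsBoolean D fun j => C (φ j) := by
  refine ⟨fun j => h.1 _, fun L hL hc => ?_⟩
  have := h.2 (L.map fun p => (φ p.1, p.2)) ?_ ?_
  · simpa [Function.comp_def] using this
  · rw [List.isChain_map] at hL
    rw [List.map_map, List.isChain_map]
    exact hL.imp fun _ _ hpq he => hpq (hφ he)
  · intro p hp
    obtain ⟨q, hq, rfl⟩ := List.mem_map.1 hp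
    exact hc q hq

/-- Grouping the runs of a word gives an alternating word of elements of the algebras. -/
lemma exists_alternating (hC : ∀ i b, ∀ x ∈ C i, x * D.ι b ∈ C i)
    (ha : ∀ i, a i ∈ C i) (w : List (I × B)) :
    ∃ L : List (I × A), (L.map Prod.fst).IsChain (· ≠ ·) ∧ (∀ p ∈ L, p.2 ∈ C p.1) ∧
      (L.map Prod.snd).prod = wordProd D.ι a w ∧
      (L.map Prod.fst).head? = (w.map Prod.fst).head? := by
  induction hn : w.length using Nat.strong_induction_on generalizing w with
  | _ n ih =>
  rcases eq_or_ne w [] with rfl | hw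
  · exact ⟨[], by simp⟩
  obtain ⟨i, r, v, rfl, hr, hri, hv⟩ := exists_first_run hw
  have hlen : 0 < r.length := List.length_pos_iff.2 hr
  obtain ⟨L, h1, h2, h3, h4⟩ := ih v.length (by simp at hn; omega) v rfl
  refine ⟨(i, wordProd D.ι a r) :: L, ?_, ?_, ?_, ?_⟩
  · rw [List.map_cons, List.isChain_cons]
    refine ⟨?_, h1⟩
    rw [h4, List.head?_map]
    intro y hy
    obtain ⟨p, hp, rfl⟩ := Option.mem_map.1 hy
    exact (hv p hp).symm
  · intro p hp
    rcases List.mem_cons.1 hp with rfl | hp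
    exacts [wordProd_mem _ _ (hC i) (ha i) hr hri, h2 p hp]
  · simp [h3]
  · rw [List.map_append, List.head?_append_of_ne_nil _ (by simpa using hr)]
    cases r with
    | nil => exact absurd rfl hr
    | cons p r => simp [hri p (by simp)]

lemma IsBoolean.E_wordProd_append (h : IsBoolean D C) (ha : ∀ i, a i ∈ C i) {i : I}
    {r v : List (I × B)} (hr : r ≠ []) (hri : ∀ p ∈ r, p.1 = i) (hv : ∀ p ∈ v.head?, p.1 ≠ i) :
    D.E (wordProd D.ι a (r ++ v)) = D.E (wordProd D.ι a r) * D.E (wordProd D.ι a v) := by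
  obtain ⟨L, h1, h2, h3, h4⟩ := exists_alternating (D := D) (fun i b x hx => (h.1 i b x hx).2) ha v
  have := h.2 ((i, wordProd D.ι a r) :: L) ?_ ?_
  · rw [List.map_cons, List.prod_cons, h3, List.map_cons, List.prod_cons, ← h.2 L h1 h2, h3] at this
    rw [wordProd_append]
    exact this
  · rw [List.map_cons, List.isChain_cons]
    refine ⟨?_, h1⟩
    rw [h4, List.head?_map]
    intro y hy
    obtain ⟨p, hp, rfl⟩ := Option.mem_map.1 hy
    exact (hv p hp).symm
  · intro p hp
    rcases List.mem_cons.1 hp with rfl | hp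
    exacts [wordProd_mem _ _ (fun b x hx => (h.1 i b x hx).2) (ha i) hr hri, h2 p hp]

lemma IsBoolean.E_wordProd_congr {C' : I → NonUnitalSubring A} {a' : I → A} (h : IsBoolean D C)
    (h' : IsBoolean D C') (ha : ∀ i, a i ∈ C i) (ha' : ∀ i, a' i ∈ C' i)
    (hd : SameMarginals D a a') (w : List (I × B)) :
    D.E (wordProd D.ι a w) = D.E (wordProd D.ι a' w) := by
  induction hn : w.length using Nat.strong_induction_on generalizing w with
  | _ n ih =>
  rcases eq_or_ne w [] with rfl | hw
  · rfl
  obtain ⟨i, r, v, rfl, hr, hri, hv⟩ := exists_first_run hw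
  have hlen : 0 < r.length := List.length_pos_iff.2 hr
  rw [h.E_wordProd_append ha hr hri hv, h'.E_wordProd_append ha' hr hri hv, hd.wordProd hri,
    ih v.length (by simp at hn; omega) v rfl]

lemma E_wordProd_singleton (hE : ∀ i, D.E (a i) = 0) {r : List (I × B)}
    (hr : r.length = 1) : D.E (wordProd D.ι a r) = 0 := by
  obtain ⟨q, rfl⟩ := List.length_eq_one_iff.1 hr
  simp [D.E_right, hE]

lemma IsBoolean.E_wordProd_eq_zero_of_count_eq_one [DecidableEq I] (h : IsBoolean D C)
    (ha : ∀ i, a i ∈ C i) (hE : ∀ i, D.E (a i) = 0) {w : List (I × B)} {p : I}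
    (hp : (w.map Prod.fst).count p = 1) : D.E (wordProd D.ι a w) = 0 := by
  induction hn : w.length using Nat.strong_induction_on generalizing w with
  | _ n ih =>
  obtain ⟨i, r, v, rfl, hr, hri, hv⟩ := exists_first_run (w := w) (by rintro rfl; simp at hp)
  have hlen : 0 < r.length := List.length_pos_iff.2 hr
  rw [h.E_wordProd_append ha hr hri hv]
  rw [List.map_append, List.count_append] at hp
  by_cases hi : i = p
  · subst hi
    rw [count_of_forall_eq hri] at hp
    rw [E_wordProd_singleton hE (by omega), zero_mul]
  · rw [count_of_forall_ne (fun q hq => by rw [hri q hq]; exact hi), zero_add] at hp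
    rw [ih v.length (by simp at hn; omega) hp rfl, mul_zero]

/-- After replacing a run by its expectation and absorbing this scalar, a word without the run
remains. The new word does not depend on the family. -/
lemma exists_wordProd_remove (D : CondExp A B) (u v : List (I × B)) (c : B) :
    ∃ (d : B) (u' : List (I × B)), u'.map Prod.fst = u.map Prod.fst ∧ u'.length = u.length ∧
      ∀ a : I → A, wordProd D.ι a u * D.ι c = D.ι d * wordProd D.ι a u' ∧
        D.E (wordProd D.ι a u * D.ι c * wordProd D.ι a v) = d * D.E (wordProd D.ι a (u' ++ v)) := by
  obtain ⟨d, u', hu', hd⟩ := exists_absorb D.ι u c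
  refine ⟨d, u', hu', by simpa using congrArg List.length hu', fun a => ⟨hd a, ?_⟩⟩
  rw [hd a, mul_assoc, D.E_left, wordProd_append]

end Boolean

/-! ### Moments of monotone independent families -/

/-- Split a word at the first run of its largest index. -/
lemma exists_max_run {I B : Type*} [LinearOrder I] {w : List (I × B)} (hw : w ≠ []) :
    ∃ i u r v, w = u ++ r ++ v ∧ r ≠ [] ∧ (∀ p ∈ r, p.1 = i) ∧ (∀ p ∈ u, p.1 < i) ∧
      (∀ p ∈ v, p.1 ≤ i) ∧ ∀ p ∈ v.head?, p.1 < i := by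
  induction w with
  | nil => exact absurd rfl hw
  | cons p w ih =>
    rcases eq_or_ne w [] with rfl | h
    · exact ⟨p.1, [], [p], [], by simp⟩
    · obtain ⟨i, u, r, v, rfl, hr, hri, hu, hv, hv'⟩ := ih h
      rcases lt_trichotomy p.1 i with hp | hp | hp
      · refine ⟨i, p :: u, r, v, by simp, hr, hri, ?_, hv, hv'⟩
        intro q hq
        rcases List.mem_cons.1 hq with rfl | hq
        exacts [hp, hu q hq]
      · cases u with
        | nil =>
          refine ⟨i, [], p :: r, v, by simp, by simp, ?_, by simp, hv, hv'⟩
          intro q hq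
          rcases List.mem_cons.1 hq with rfl | hq
          exacts [hp, hri q hq]
        | cons q u =>
          refine ⟨i, [], [p], q :: u ++ r ++ v, by simp, by simp, by simpa using hp, by simp,
            ?_, ?_⟩
          · intro x hx
            simp only [List.mem_append] at hx
            rcases hx with (hx | hx) | hx
            exacts [(hu x hx).le, (hri x hx).le, hv x hx]
          · simpa using hu q (by simp)
      · refine ⟨p.1, [], [p], u ++ r ++ v, by simp, by simp, by simp, by simp, ?_, ?_⟩
        all_goals
          have key : ∀ x ∈ u ++ r ++ v, x.1 < p.1 := by
            intro x hx
            simp only [List.mem_append] at hx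
            rcases hx with (hx | hx) | hx
            exacts [(hu x hx).trans hp, (hri x hx).trans_lt hp, (hv x hx).trans_lt hp]
        · exact fun x hx => (key x hx).le
        · exact fun x hx => key x (List.mem_of_mem_head? hx)

section Monotone

variable {A B I : Type*} [Ring A] [Ring B] [LinearOrder I]

/-- Monotone independence over `B` of a family of nonunital subrings which are stable under
multiplication by scalars. -/
def IsMonotone (D : CondExp A B) (C : I → NonUnitalSubring A) : Prop :=
  (∀ i b, ∀ x ∈ C i, D.ι b * x ∈ C i ∧ x * D.ι b ∈ C i) ∧
    ∀ (U V : List (I × A)) (i : I) (x : A), (∀ p ∈ U, p.2 ∈ C p.1) → (∀ p ∈ V, p.2 ∈ C p.1) →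
      x ∈ C i → (∀ p ∈ U.getLast?, p.1 < i) → (∀ p ∈ V.head?, p.1 < i) →
      D.E ((U.map Prod.snd).prod * x * (V.map Prod.snd).prod) =
        D.E ((U.map Prod.snd).prod * D.ι (D.E x) * (V.map Prod.snd).prod)

variable {D : CondExp A B} {C : I → NonUnitalSubring A} {a : I → A}

lemma IsMonotone.comp {J : Type*} [LinearOrder J] (h : IsMonotone D C) {φ : J → I}
    (hφ : StrictMono φ) : IsMonotone D fun j => C (φ j) := by
  refine ⟨fun j => h.1 _, fun U V i x hU hV hx hUl hVh => ?_⟩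
  have := h.2 (U.map fun p => (φ p.1, p.2)) (V.map fun p => (φ p.1, p.2)) (φ i) x ?_ ?_ hx ?_ ?_
  · simpa [Function.comp_def] using this
  · intro p hp
    obtain ⟨q, hq, rfl⟩ := List.mem_map.1 hp
    exact hU q hq
  · intro p hp
    obtain ⟨q, hq, rfl⟩ := List.mem_map.1 hp
    exact hV q hq
  · rw [List.getLast?_map]
    intro p hp
    obtain ⟨q, hq, rfl⟩ := Option.mem_map.1 hp
    exact hφ (hUl q hq)
  · rw [List.head?_map]
    intro p hp
    obtain ⟨q, hq, rfl⟩ := Option.mem_map.1 hp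
    exact hφ (hVh q hq)

lemma IsMonotone.E_wordProd_run (h : IsMonotone D C) (ha : ∀ i, a i ∈ C i) {i : I}
    {u r v : List (I × B)} (hr : r ≠ []) (hri : ∀ p ∈ r, p.1 = i)
    (hu : ∀ p ∈ u.getLast?, p.1 < i) (hv : ∀ p ∈ v.head?, p.1 < i) :
    D.E (wordProd D.ι a (u ++ r ++ v)) =
      D.E (wordProd D.ι a u * D.ι (D.E (wordProd D.ι a r)) * wordProd D.ι a v) := by
  have hmem : ∀ w : List (I × B), ∀ p ∈ w.map fun q => (q.1, a q.1 * D.ι q.2), p.2 ∈ C p.1 := by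
    intro w p hp
    obtain ⟨q, hq, rfl⟩ := List.mem_map.1 hp
    exact (h.1 _ _ _ (ha _)).2
  have := h.2 (u.map fun q => (q.1, a q.1 * D.ι q.2)) (v.map fun q => (q.1, a q.1 * D.ι q.2)) i
    (wordProd D.ι a r) (hmem u) (hmem v)
    (wordProd_mem _ _ (fun b x hx => (h.1 i b x hx).2) (ha i) hr hri) ?_ ?_
  · simpa [wordProd, Function.comp_def, mul_assoc] using this
  · rw [List.getLast?_map]
    intro p hp
    obtain ⟨q, hq, rfl⟩ := Option.mem_map.1 hp
    exact hu q hq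
  · rw [List.head?_map]
    intro p hp
    obtain ⟨q, hq, rfl⟩ := Option.mem_map.1 hp
    exact hv q hq

lemma IsMonotone.E_wordProd_congr {C' : I → NonUnitalSubring A} {a' : I → A} (h : IsMonotone D C)
    (h' : IsMonotone D C') (ha : ∀ i, a i ∈ C i) (ha' : ∀ i, a' i ∈ C' i)
    (hd : SameMarginals D a a') (w : List (I × B)) :
    D.E (wordProd D.ι a w) = D.E (wordProd D.ι a' w) := by
  induction hn : w.length using Nat.strong_induction_on generalizing w with
  | _ n ih =>
  rcases eq_or_ne w [] with rfl | hw
  · rfl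
  obtain ⟨i, u, r, v, rfl, hr, hri, hu, hv, hv'⟩ := exists_max_run hw
  have hlen : 0 < r.length := List.length_pos_iff.2 hr
  rw [h.E_wordProd_run ha hr hri (fun p hp => hu p (List.mem_of_mem_getLast? hp)) hv',
    h'.E_wordProd_run ha' hr hri (fun p hp => hu p (List.mem_of_mem_getLast? hp)) hv',
    hd.wordProd hri]
  obtain ⟨d, u', -, hlen', hd'⟩ := exists_wordProd_remove D u v (D.E (wordProd D.ι a' r))
  rw [(hd' a).2, (hd' a').2, ih _ ?_ (u' ++ v) rfl]
  simp at hn ⊢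
  omega

lemma IsMonotone.E_wordProd_eq_zero_of_count_eq_one (h : IsMonotone D C)
    (ha : ∀ i, a i ∈ C i) (hE : ∀ i, D.E (a i) = 0) {w : List (I × B)} {p : I}
    (hp : (w.map Prod.fst).count p = 1) : D.E (wordProd D.ι a w) = 0 := by
  induction hn : w.length using Nat.strong_induction_on generalizing w with
  | _ n ih =>
  obtain ⟨i, u, r, v, rfl, hr, hri, hu, hv, hv'⟩ :=
    exists_max_run (w := w) (by rintro rfl; simp at hp)
  have hlen : 0 < r.length := List.length_pos_iff.2 hr
  rw [h.E_wordProd_run ha hr hri (fun p hp => hu p (List.mem_of_mem_getLast? hp)) hv']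
  simp only [List.map_append, List.count_append] at hp
  by_cases hi : i = p
  · subst hi
    rw [count_of_forall_eq hri] at hp
    rw [E_wordProd_singleton hE (by omega)]
    simp
  · rw [count_of_forall_ne (r := r) (fun q hq => by rw [hri q hq]; exact hi), add_zero] at hp
    obtain ⟨d, u', hu', hlen', hd'⟩ := exists_wordProd_remove D u v (D.E (wordProd D.ι a r))
    rw [(hd' a).2, ih _ ?_ (w := u' ++ v) ?_ rfl, mul_zero]
    · simp at hn ⊢
      omega
    · rw [List.map_append, List.count_append, hu']
      exact hp

/-- A word vanishes if a letter lies between two letters with the same, larger index: the letters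
with the largest index are removed until the larger index of such a triple is reached,
which then is not a run of two letters. -/
lemma IsMonotone.E_wordProd_eq_zero_of_lt (h : IsMonotone D C)
    (ha : ∀ i, a i ∈ C i) (hE : ∀ i, D.E (a i) = 0) {p q : I} (hpq : q < p) {w : List (I × B)}
    (hw : ∀ i, (w.map Prod.fst).count i ≤ 2) (hs : [p, q, p].Sublist (w.map Prod.fst)) :
    D.E (wordProd D.ι a w) = 0 := by
  induction hn : w.length using Nat.strong_induction_on generalizing w with
  | _ n ih =>
  obtain ⟨i, u, r, v, rfl, hr, hri, hu, hv, hv'⟩ :=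
    exists_max_run (w := w) (by rintro rfl; simp at hs)
  have hlen : 0 < r.length := List.length_pos_iff.2 hr
  rw [h.E_wordProd_run ha hr hri (fun p hp => hu p (List.mem_of_mem_getLast? hp)) hv']
  have hcount := hw i
  simp only [List.map_append, List.count_append, count_of_forall_eq hri] at hcount
  by_cases h1 : r.length = 1
  · rw [E_wordProd_singleton hE h1]
    simp
  obtain ⟨x, y, rfl⟩ := List.length_eq_two.1 (show r.length = 2 by omega)
  have hx : x.1 = i := hri x (by simp)
  have hy : y.1 = i := hri y (by simp)
  have hiu : i ∉ u.map Prod.fst := by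
    rw [← List.count_eq_zero]
    simp at hcount
    omega
  have hiv : i ∉ v.map Prod.fst := by
    rw [← List.count_eq_zero]
    simp at hcount
    omega
  have hs' : [p, q, p].Sublist (u.map Prod.fst ++ i :: i :: v.map Prod.fst) := by
    simpa [hx, hy] using hs
  have hpi : i ≠ p := by
    rintro rfl
    exact not_sublist_of_adjacent hiu hiv hpq.ne hs'
  have hqi : i ≠ q := by
    rintro rfl
    have hp : p ∈ (u ++ [x, y] ++ v).map Prod.fst := hs.subset (by simp)
    obtain ⟨z, hz, rfl⟩ := List.mem_map.1 hp
    simp only [List.mem_append] at hz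
    rcases hz with (hz | hz) | hz
    exacts [hpq.not_gt (hu z hz), hpi (hri z hz).symm, hpq.not_ge (hv z hz)]
  obtain ⟨d, u', hu', hlen', hd'⟩ := exists_wordProd_remove D u v (D.E (wordProd D.ι a [x, y]))
  rw [(hd' a).2, ih _ ?_ (w := u' ++ v) (fun j => count_remove_le hu' j (hw j)) ?_ rfl, mul_zero]
  · simp at hn ⊢
    omega
  · rw [List.map_append, hu']
    exact sublist_of_adjacent (by simp [hqi, hpi]) hs'

/-- The expectation of two words without common indices factorizes. -/
lemma IsMonotone.E_wordProd_append (h : IsMonotone D C) (ha : ∀ i, a i ∈ C i)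
    {w₁ w₂ : List (I × B)} (hw : (w₁.map Prod.fst).Disjoint (w₂.map Prod.fst)) :
    D.E (wordProd D.ι a (w₁ ++ w₂)) = D.E (wordProd D.ι a w₁) * D.E (wordProd D.ι a w₂) := by
  induction hn : w₁.length + w₂.length using Nat.strong_induction_on generalizing w₁ w₂ with
  | _ n ih =>
  rcases eq_or_ne w₁ [] with rfl | h₁
  · simp [D.E_one]
  rcases eq_or_ne w₂ [] with rfl | h₂
  · simp [D.E_one]
  obtain ⟨i₁, u₁, r₁, v₁, rfl, hr₁, hri₁, hu₁, hv₁, hv₁'⟩ := exists_max_run h₁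
  obtain ⟨i₂, u₂, r₂, v₂, rfl, hr₂, hri₂, hu₂, hv₂, hv₂'⟩ := exists_max_run h₂
  have hlen₁ : 0 < r₁.length := List.length_pos_iff.2 hr₁
  have hlen₂ : 0 < r₂.length := List.length_pos_iff.2 hr₂
  have hmem₁ : ∀ p ∈ u₁ ++ r₁ ++ v₁, p.1 ≤ i₁ := by
    intro x hx
    simp only [List.mem_append] at hx
    rcases hx with (hx | hx) | hx
    exacts [(hu₁ x hx).le, (hri₁ x hx).le, hv₁ x hx]
  have hmem₂ : ∀ p ∈ u₂ ++ r₂ ++ v₂, p.1 ≤ i₂ := by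
    intro x hx
    simp only [List.mem_append] at hx
    rcases hx with (hx | hx) | hx
    exacts [(hu₂ x hx).le, (hri₂ x hx).le, hv₂ x hx]
  have hne : i₁ ≠ i₂ := by
    obtain ⟨x, hx⟩ := List.exists_mem_of_ne_nil _ hr₁
    obtain ⟨y, hy⟩ := List.exists_mem_of_ne_nil _ hr₂
    rw [← hri₁ x hx, ← hri₂ y hy]
    exact fun he => hw (a := x.1) (List.mem_map_of_mem (by simp [hx]))
      (he ▸ List.mem_map_of_mem (by simp [hy]))
  rcases hne.lt_or_gt with hlt | hlt
  · -- the largest index belongs to the second word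
    have e₁ := h.E_wordProd_run ha (u := u₁ ++ r₁ ++ v₁ ++ u₂) (v := v₂) hr₂ hri₂ ?_ hv₂'
    · have e₂ := h.E_wordProd_run ha (u := u₂) (v := v₂) hr₂ hri₂
        (fun p hp => hu₂ p (List.mem_of_mem_getLast? hp)) hv₂'
      obtain ⟨d, u', hu', hlen', hd'⟩ := exists_wordProd_remove D u₂ v₂ (D.E (wordProd D.ι a r₂))
      obtain ⟨e, w', hw', hlenw', he'⟩ := exists_wordProd_remove D (u₁ ++ r₁ ++ v₁) (u' ++ v₂) d
      rw [(hd' a).2] at e₂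
      have key : D.E (wordProd D.ι a (u₁ ++ r₁ ++ v₁)) * d = e * D.E (wordProd D.ι a w') := by
        rw [← D.E_right, (he' a).1, D.E_left]
      rw [wordProd_append (u := u₁ ++ r₁ ++ v₁), mul_assoc (wordProd D.ι a (u₁ ++ r₁ ++ v₁)),
        (hd' a).1, ← mul_assoc, mul_assoc, ← wordProd_append, (he' a).2,
        ih _ ?_ (w₁ := w') (w₂ := u' ++ v₂) ?_ rfl, ← mul_assoc, ← key, mul_assoc, ← e₂] at e₁
      · simpa only [List.append_assoc] using e₁
      · simp at hn hlenw' ⊢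
        omega
      · rw [hw']
        refine List.disjoint_of_subset_right ?_ hw
        rw [List.map_append, hu', ← List.map_append]
        exact List.map_subset _ (by simp)
    · intro p hp
      have hp := List.mem_of_mem_getLast? hp
      rcases List.mem_append.1 hp with hp | hp
      exacts [(hmem₁ p hp).trans_lt hlt, hu₂ p hp]
  · have e₁ := h.E_wordProd_run ha (u := u₁) (v := v₁ ++ (u₂ ++ r₂ ++ v₂)) hr₁ hri₁
      (fun p hp => hu₁ p (List.mem_of_mem_getLast? hp)) ?_
    · have e₂ := h.E_wordProd_run ha (u := u₁) (v := v₁) hr₁ hri₁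
        (fun p hp => hu₁ p (List.mem_of_mem_getLast? hp)) hv₁'
      obtain ⟨d, u', hu', hlen', hd'⟩ := exists_wordProd_remove D u₁ v₁ (D.E (wordProd D.ι a r₁))
      rw [(hd' a).2] at e₂
      rw [(hd' a).1, mul_assoc, D.E_left, ← wordProd_append, ← List.append_assoc u',
        ih _ ?_ (w₁ := u' ++ v₁) (w₂ := u₂ ++ r₂ ++ v₂) ?_ rfl, ← mul_assoc, ← e₂] at e₁
      · simpa only [List.append_assoc] using e₁
      · simp at hn ⊢
        omega
      · refine List.disjoint_of_subset_left ?_ hw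
        rw [List.map_append, hu', ← List.map_append]
        exact List.map_subset _ (by simp)
    · cases v₁ with
      | nil => exact fun p hp => (hmem₂ p (List.mem_of_mem_head? hp)).trans_lt hlt
      | cons p v => simpa using hv₁'

/-- A word in larger indices between two letters `a_i` may be replaced by its expectation. -/
lemma IsMonotone.E_wordProd_nested (h : IsMonotone D C) (ha : ∀ i, a i ∈ C i) {i : I} (b c : B)
    {w : List (I × B)} (hw : ∀ p ∈ w, i < p.1) :
    D.E (wordProd D.ι a ((i, b) :: w ++ [(i, c)])) =
      D.E (a i * D.ι (b * D.E (wordProd D.ι a w)) * a i) * c := by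
  induction hn : w.length using Nat.strong_induction_on generalizing w b with
  | _ n ih =>
  rcases eq_or_ne w [] with rfl | hne
  · simp [D.E_one, ← mul_assoc, D.E_right]
  obtain ⟨j, u, r, v, rfl, hr, hrj, hu, hv, hv'⟩ := exists_max_run hne
  have hlen : 0 < r.length := List.length_pos_iff.2 hr
  have hij : i < j := by
    obtain ⟨x, hx⟩ := List.exists_mem_of_ne_nil _ hr
    exact hrj x hx ▸ hw x (by simp [hx])
  have e₁ := h.E_wordProd_run ha (u := (i, b) :: u) (v := v ++ [(i, c)]) hr hrj ?_ ?_
  · have e₂ := h.E_wordProd_run ha (u := u) (v := v) hr hrj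
      (fun p hp => hu p (List.mem_of_mem_getLast? hp)) hv'
    obtain ⟨d, u', hu', hlen', hd'⟩ := exists_wordProd_remove D u v (D.E (wordProd D.ι a r))
    have e₃ := ih _ ?_ (b * d) (w := u' ++ v) ?_ rfl
    · rw [(hd' a).2] at e₂
      rw [mul_assoc b d, ← e₂] at e₃
      rw [← e₃]
      have e₄ : wordProd D.ι a ((i, b) :: u) * D.ι (D.E (wordProd D.ι a r)) =
          a i * D.ι (b * d) * wordProd D.ι a u' := by
        rw [wordProd_cons, mul_assoc, (hd' a).1]
        simp [mul_assoc]
      rw [e₄] at e₁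
      simpa [mul_assoc] using e₁
    · simp at hn ⊢
      omega
    · intro p hp
      have hsub : (u' ++ v).map Prod.fst ⊆ (u ++ r ++ v).map Prod.fst := by
        rw [List.map_append, hu', ← List.map_append]
        exact List.map_subset _ (by simp)
      obtain ⟨q, hq, he⟩ := List.mem_map.1 (hsub (List.mem_map_of_mem hp))
      exact he ▸ hw q hq
  · intro p hp
    rcases List.mem_cons.1 (List.mem_of_mem_getLast? hp) with rfl | hp
    exacts [hij, hu p hp]
  · cases v with
    | nil => simpa using hij
    | cons p v => simpa using hv'

end Monotone

/-! ### Sums over index words -/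

section Counting

/-- The maps with image `S` are the surjections onto `Fin S.card` followed by the order embedding of
`S`. -/
lemma sum_image_eq {M : Type*} [AddCommMonoid M] {k N : ℕ} (Φ : (Fin k → ℕ) → M)
    (hinv : ∀ (m : ℕ) (σ : Fin k → Fin m) (φ : Fin m → ℕ), StrictMono φ →
      Φ (fun p => φ (σ p)) = Φ fun p => σ p) (S : Finset (Fin N)) :
    ∑ i : Fin k → Fin N with Finset.univ.image i = S, Φ (fun p => i p) =
      ∑ σ : Fin k → Fin S.card with Function.Surjective σ, Φ fun p => σ p := by
  symm
  refine Finset.sum_bij (fun σ _ p => S.orderEmbOfFin rfl (σ p)) ?_ ?_ ?_ ?_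
  · intro σ hσ
    simp only [Finset.mem_filter, Finset.mem_univ, true_and] at hσ ⊢
    ext x
    have hx : x ∈ S ↔ x ∈ Set.range (S.orderEmbOfFin rfl) := by simp
    rw [hx]
    simp only [Finset.mem_image, Finset.mem_univ, true_and, Set.mem_range]
    exact ⟨fun ⟨p, hp⟩ => ⟨_, hp⟩, fun ⟨t, ht⟩ => (hσ t).imp fun p hp => by rw [hp, ht]⟩
  · intro σ _ σ' _ h
    funext p
    exact (S.orderEmbOfFin rfl).injective (congrFun h p)
  · intro i hi
    simp only [Finset.mem_filter, Finset.mem_univ, true_and] at hi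
    have h1 : ∀ p, ∃ t, S.orderEmbOfFin rfl t = i p := by
      intro p
      have : i p ∈ Set.range (S.orderEmbOfFin rfl) := by
        rw [Finset.range_orderEmbOfFin, Finset.mem_coe]
        rw [← hi]
        simp
      exact this
    choose σ hσ using h1
    refine ⟨σ, ?_, funext hσ⟩
    simp only [Finset.mem_filter, Finset.mem_univ, true_and]
    intro t
    have : S.orderEmbOfFin rfl t ∈ Finset.univ.image i := by
      rw [hi]
      simp
    obtain ⟨p, -, hp⟩ := Finset.mem_image.1 this
    exact ⟨p, (S.orderEmbOfFin rfl).injective (by rw [hσ, hp])⟩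
  · intro σ _
    exact (hinv _ σ (fun t => (S.orderEmbOfFin rfl t : ℕ)) fun s t hst =>
      (S.orderEmbOfFin rfl).strictMono hst).symm

/-- A sum over all index words is grouped by the number of distinct indices and the order type. -/
lemma sum_words_eq {M : Type*} [AddCommMonoid M] {k : ℕ} (Φ : (Fin k → ℕ) → M)
    (hinv : ∀ (m : ℕ) (σ : Fin k → Fin m) (φ : Fin m → ℕ), StrictMono φ →
      Φ (fun p => φ (σ p)) = Φ fun p => σ p) (N : ℕ) :
    ∑ i : Fin k → Fin N, Φ (fun p => i p) = ∑ m ∈ Finset.range (N + 1),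
      N.choose m • ∑ σ : Fin k → Fin m with Function.Surjective σ, Φ fun p => σ p := by
  have := Finset.sum_powerset_apply_card (x := (Finset.univ : Finset (Fin N)))
    fun m => ∑ σ : Fin k → Fin m with Function.Surjective σ, Φ fun p => σ p
  rw [Finset.card_univ, Fintype.card_fin] at this
  rw [← this, ← Finset.sum_fiberwise_of_maps_to (g := fun i : Fin k → Fin N => Finset.univ.image i)
    (t := Finset.univ.powerset) (by simp)]
  exact Finset.sum_congr rfl fun S _ => sum_image_eq Φ hinv S

/-- More than `k / 2` distinct indices force an index that occurs only once. -/
lemma exists_unique_fiber {k m : ℕ} (hkm : k < 2 * m) {σ : Fin k → Fin m}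
    (hσ : Function.Surjective σ) : ∃ p, ∀ q, σ q = σ p → q = p := by
  obtain ⟨t, ht⟩ := Fintype.exists_card_fiber_lt_of_card_lt_mul (f := σ) (n := 2)
    (by simpa [mul_comm] using hkm)
  obtain ⟨p, rfl⟩ := hσ t
  refine ⟨p, fun q hq => ?_⟩
  exact Finset.card_le_one.1 (Nat.lt_succ_iff.1 ht) q (by simpa using hq) p (by simp)

lemma tendsto_choose_div (m : ℕ) :
    Tendsto (fun N : ℕ => (N.choose m : ℝ) / (N : ℝ) ^ m) atTop (𝓝 (m.factorial : ℝ)⁻¹) := by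
  have h := isEquivalent_choose m
  have h2 : Tendsto (fun N : ℕ => (N.choose m : ℝ) / ((N : ℝ) ^ m / (m.factorial : ℝ))) atTop
      (𝓝 1) := by
    refine (Asymptotics.isEquivalent_iff_tendsto_one ?_).1 h
    filter_upwards [eventually_gt_atTop 0] with N hN
    positivity
  have h3 := h2.mul_const (m.factorial : ℝ)⁻¹
  rw [one_mul] at h3
  refine h3.congr fun N => ?_
  have : (m.factorial : ℝ) ≠ 0 := by positivity
  rw [div_div_eq_mul_div]
  field_simp

lemma tendsto_coeff {k m : ℕ} (hm : 2 * m ≤ k) :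
    Tendsto (fun N : ℕ => ((Real.sqrt N : ℂ)⁻¹) ^ k * (N.choose m : ℂ)) atTop
      (𝓝 (if 2 * m = k then (m.factorial : ℂ)⁻¹ else 0)) := by
  have key : Tendsto (fun N : ℕ => ((Real.sqrt N)⁻¹) ^ k * (N.choose m : ℝ)) atTop
      (𝓝 (if 2 * m = k then (m.factorial : ℝ)⁻¹ else 0)) := by
    have h1 : Tendsto (fun N : ℕ => (Real.sqrt N)⁻¹ ^ (k - 2 * m)) atTop
        (𝓝 (if 2 * m = k then 1 else 0)) := by
      split_ifs with h
      · simp [h]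
      · have h0 : Tendsto (fun N : ℕ => (Real.sqrt N)⁻¹) atTop (𝓝 0) :=
          tendsto_inv_atTop_zero.comp (Real.tendsto_sqrt_atTop.comp tendsto_natCast_atTop_atTop)
        have := h0.pow (k - 2 * m)
        rwa [zero_pow (by omega)] at this
    have h2 := h1.mul (tendsto_choose_div m)
    rw [ite_mul, one_mul, zero_mul] at h2
    refine h2.congr fun N => ?_
    have h3 : (N : ℝ) ^ m = Real.sqrt N ^ (2 * m) := by
      rw [pow_mul, Real.sq_sqrt (Nat.cast_nonneg N)]
    rw [h3, div_eq_mul_inv, ← inv_pow, mul_comm (N.choose m : ℝ), ← mul_assoc, ← pow_add,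
      Nat.sub_add_cancel hm]
  have := (Complex.continuous_ofReal.tendsto _).comp key
  convert this using 1
  · funext N
    simp
  · split_ifs <;> simp

/-- The combinatorial limit theorem: if the summand depends only on the order type of the index word
and vanishes when an index occurs only once, then only the words with `k / 2` distinct indices
contribute. -/
theorem tendsto_sum_words {M : Type*} [AddCommGroup M] [Module ℂ M] [TopologicalSpace M]
    [ContinuousAdd M] [ContinuousSMul ℂ M] {k : ℕ} (Φ : (Fin k → ℕ) → M)
    (hinv : ∀ (m : ℕ) (σ : Fin k → Fin m) (φ : Fin m → ℕ), StrictMono φ →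
      Φ (fun p => φ (σ p)) = Φ fun p => σ p)
    (hsing : ∀ i : Fin k → ℕ, (∃ p, ∀ q, i q = i p → q = p) → Φ i = 0) :
    Tendsto (fun N : ℕ => ((Real.sqrt N : ℂ)⁻¹) ^ k • ∑ i : Fin k → Fin N, Φ fun p => i p) atTop
      (𝓝 (if Even k then (((k / 2).factorial : ℂ)⁻¹) •
        ∑ σ : Fin k → Fin (k / 2) with Function.Surjective σ, Φ fun p => σ p else 0)) := by
  set c : ℕ → M := fun m => ∑ σ : Fin k → Fin m with Function.Surjective σ, Φ fun p => σ p
    with hc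
  have hc0 : ∀ m, k < 2 * m → c m = 0 := by
    intro m hm
    refine Finset.sum_eq_zero fun σ hσ => hsing _ ?_
    simp only [Finset.mem_filter, Finset.mem_univ, true_and] at hσ
    obtain ⟨p, hp⟩ := exists_unique_fiber hm hσ
    exact ⟨p, fun q hq => hp q (Fin.ext hq)⟩
  have hlim : Tendsto (fun N : ℕ => ∑ m ∈ Finset.range (k / 2 + 1),
      (((Real.sqrt N : ℂ)⁻¹) ^ k * (N.choose m : ℂ)) • c m) atTop
      (𝓝 (∑ m ∈ Finset.range (k / 2 + 1),
        (if 2 * m = k then (m.factorial : ℂ)⁻¹ else 0) • c m)) := by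
    refine tendsto_finsetSum _ fun m hm => ?_
    rw [Finset.mem_range] at hm
    exact (tendsto_coeff (by omega)).smul_const _
  have hval : ∑ m ∈ Finset.range (k / 2 + 1),
      (if 2 * m = k then (m.factorial : ℂ)⁻¹ else 0) • c m =
      if Even k then (((k / 2).factorial : ℂ)⁻¹) • c (k / 2) else 0 := by
    split_ifs with hk
    · have hk2 : 2 * (k / 2) = k := Nat.two_mul_div_two_of_even hk
      rw [Finset.sum_eq_single (k / 2)]
      · rw [if_pos hk2]
      · intro m _ hm
        rw [if_neg (by omega), zero_smul]
      · simp
    · refine Finset.sum_eq_zero fun m _ => ?_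
      rw [if_neg, zero_smul]
      rintro rfl
      exact hk (even_two_mul m)
  rw [hval] at hlim
  refine hlim.congr' ?_
  filter_upwards [eventually_ge_atTop k] with N hN
  rw [sum_words_eq Φ hinv N, Finset.smul_sum]
  rw [Finset.sum_subset (Finset.range_subset_range.2 (show k / 2 + 1 ≤ N + 1 by omega))]
  · refine Finset.sum_congr rfl fun m _ => ?_
    rw [mul_smul, Nat.cast_smul_eq_nsmul]
  · intro m _ hm
    rw [Finset.mem_range] at hm
    rw [hc0 m (by omega), smul_zero]

end Counting

/-! ### Linear extensions of forests -/

section Hook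

variable {α : Type*}

open Classical in
/-- The hook length: the number of elements of `S` above `v`. -/
def hookLength (r : α → α → Prop) (S : Finset α) (v : α) : ℕ := (S.filter (r v)).card

open Classical in
/-- The minimal elements of `S`. -/
def minimals (r : α → α → Prop) (S : Finset α) : Finset α :=
  S.filter fun v => ∀ u ∈ S, r u v → u = v

lemma mem_minimals {r : α → α → Prop} {S : Finset α} {v : α} :
    v ∈ minimals r S ↔ v ∈ S ∧ ∀ u ∈ S, r u v → u = v := by
  simp [minimals]

/-- A forest: a partial order on `S` in which the elements below a given one form a chain. -/
structure IsForest (r : α → α → Prop) (S : Finset α) : Prop where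
  refl : ∀ v ∈ S, r v v
  trans : ∀ u ∈ S, ∀ v ∈ S, ∀ w ∈ S, r u v → r v w → r u w
  antisymm : ∀ u ∈ S, ∀ v ∈ S, r u v → r v u → u = v
  chain : ∀ u ∈ S, ∀ v ∈ S, ∀ w ∈ S, r u w → r v w → r u v ∨ r v u

lemma IsForest.mono {r : α → α → Prop} {S T : Finset α} (h : IsForest r S) (hT : T ⊆ S) :
    IsForest r T :=
  ⟨fun v hv => h.refl v (hT hv), fun u hu v hv w hw => h.trans u (hT hu) v (hT hv) w (hT hw),
    fun u hu v hv => h.antisymm u (hT hu) v (hT hv),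
    fun u hu v hv w hw => h.chain u (hT hu) v (hT hv) w (hT hw)⟩

lemma IsForest.exists_minimal {r : α → α → Prop} {S : Finset α} (h : IsForest r S) {w : α}
    (hw : w ∈ S) : ∃ v ∈ minimals r S, r v w := by
  classical
  obtain ⟨v, hv, hmax⟩ := (S.filter fun v => r v w).exists_max_image (hookLength r S)
    ⟨w, by simp [hw, h.refl w hw]⟩
  rw [Finset.mem_filter] at hv
  refine ⟨v, mem_minimals.2 ⟨hv.1, fun u hu huv => ?_⟩, hv.2⟩
  by_contra hne
  have h1 := hmax u (Finset.mem_filter.2 ⟨hu, h.trans u hu v hv.1 w hw huv hv.2⟩)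
  refine h1.not_gt (Finset.card_lt_card ⟨fun x hx => ?_, fun hsub => ?_⟩)
  · rw [Finset.mem_filter] at hx ⊢
    exact ⟨hx.1, h.trans u hu v hv.1 x hx.1 huv hx.2⟩
  · have := hsub (Finset.mem_filter.2 ⟨hu, h.refl u hu⟩)
    rw [Finset.mem_filter] at this
    exact hne (h.antisymm u hu v hv.1 huv this.2)

/-- In a forest every element lies above exactly one minimal element. -/
lemma IsForest.sum_hookLength_minimals {r : α → α → Prop} {S : Finset α} (h : IsForest r S) :
    ∑ v ∈ minimals r S, hookLength r S v = S.card := by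
  classical
  have hS : S = (minimals r S).biUnion fun v => S.filter (r v) := by
    ext w
    simp only [Finset.mem_biUnion, Finset.mem_filter]
    refine ⟨fun hw => ?_, fun ⟨v, _, hw, _⟩ => hw⟩
    obtain ⟨v, hv, hvw⟩ := h.exists_minimal hw
    exact ⟨v, hv, hw, hvw⟩
  conv_rhs => rw [hS]
  rw [Finset.card_biUnion]
  · rfl
  · intro u hu v hv huv
    rw [Function.onFun, Finset.disjoint_left]
    intro w hwu hwv
    rw [Finset.mem_filter] at hwu hwv
    rw [Finset.mem_coe, mem_minimals] at hu hv
    rcases h.chain u hu.1 v hv.1 w hwu.1 hwu.2 hwv.2 with h1 | h1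
    · exact huv (hv.2 u hu.1 h1)
    · exact huv (hu.2 v hv.1 h1).symm

/-- The discrete order, for which every enumeration is a linear extension. -/
lemma isForest_eq (S : Finset α) : IsForest (fun u v : α => u = v) S :=
  ⟨fun _ _ => rfl, fun _ _ _ _ _ _ h h' => h.trans h', fun _ _ _ _ h _ => h,
    fun _ _ _ _ _ _ h h' => Or.inl (h.trans h'.symm)⟩

variable [Fintype α] [DecidableEq α]

open Classical in
/-- The enumerations `f 0, …, f (n - 1)` of elements of `S` in which no element comes after a
different element that is larger with respect to `r`. -/
def linearExtensions (r : α → α → Prop) (S : Finset α) (n : ℕ) : Finset (Fin n → α) :=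
  Finset.univ.filter fun f => (∀ t, f t ∈ S) ∧ Function.Injective f ∧
    ∀ s t, s < t → ¬ r (f t) (f s)

lemma card_linearExtensions_succ {r : α → α → Prop} {S : Finset α} {n : ℕ}
    (hS : S.card = n + 1) : (linearExtensions r S (n + 1)).card =
      ∑ v ∈ minimals r S, (linearExtensions r (S.erase v) n).card := by
  classical
  rw [Finset.card_eq_sum_card_fiberwise (f := fun f => f 0) (t := minimals r S)]
  · refine Finset.sum_congr rfl fun v hv => ?_
    rw [mem_minimals] at hv
    refine Finset.card_bij' (fun f _ => Fin.tail f) (fun g _ => Fin.cons v g) ?_ ?_ ?_ ?_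
    · intro f hf
      simp only [linearExtensions, Finset.mem_filter, Finset.mem_univ, true_and] at hf ⊢
      obtain ⟨⟨h1, h2, h3⟩, rfl⟩ := hf
      refine ⟨fun t => Finset.mem_erase.2 ⟨fun he => ?_, h1 _⟩, fun s t hst => ?_,
        fun s t hst => ?_⟩
      · exact Fin.succ_ne_zero t (h2 he)
      · exact Fin.succ_injective _ (h2 hst)
      · exact h3 _ _ (Fin.succ_lt_succ_iff.2 hst)
    · intro g hg
      simp only [linearExtensions, Finset.mem_filter, Finset.mem_univ, true_and, Fin.cons_zero,
        and_true] at hg ⊢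
      obtain ⟨h1, h2, h3⟩ := hg
      refine ⟨fun t => ?_, ?_, fun s t hst => ?_⟩
      · refine Fin.cases ?_ (fun t => ?_) t
        · simpa using hv.1
        · simpa using Finset.mem_of_mem_erase (h1 t)
      · rw [Fin.cons_injective_iff]
        refine ⟨?_, h2⟩
        rintro ⟨t, ht⟩
        exact Finset.ne_of_mem_erase (h1 t) ht
      · induction t using Fin.cases with
        | zero => exact absurd hst (Fin.not_lt_zero s)
        | succ t =>
          induction s using Fin.cases with
          | zero =>
            simp only [Fin.cons_succ, Fin.cons_zero]
            intro hr
            exact Finset.ne_of_mem_erase (h1 t) (hv.2 _ (Finset.mem_of_mem_erase (h1 t)) hr)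
          | succ s =>
            simp only [Fin.cons_succ]
            exact h3 _ _ (Fin.succ_lt_succ_iff.1 hst)
    · intro f hf
      rw [Finset.mem_filter] at hf
      rw [← hf.2]
      exact Fin.cons_self_tail f
    · intro g _
      exact Fin.tail_cons _ _
  · intro f hf
    rw [Finset.mem_coe, linearExtensions, Finset.mem_filter] at hf
    obtain ⟨-, h1, h2, h3⟩ := hf
    rw [Finset.mem_coe, mem_minimals]
    refine ⟨h1 0, fun u hu hr => ?_⟩
    -- the enumeration exhausts `S`
    have himg : Finset.univ.image f = S :=
      Finset.eq_of_subset_of_card_le (fun x hx => by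
        obtain ⟨t, -, rfl⟩ := Finset.mem_image.1 hx
        exact h1 t) (by rw [Finset.card_image_of_injective _ h2]; simp [hS])
    rw [← himg] at hu
    obtain ⟨t, -, rfl⟩ := Finset.mem_image.1 hu
    by_contra hne
    have ht : 0 < t := Fin.pos_iff_ne_zero.2 fun h => hne (by rw [h])
    exact h3 0 t ht hr

/-- The hook length formula for forests. A linear extension starts with a minimal element `v`;
deleting it does not change the hook lengths of the other elements, and the hook lengths of the
minimal elements add up to the number of all elements. -/
theorem card_linearExtensions_mul_prod_hookLength {r : α → α → Prop} {S : Finset α}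
    (h : IsForest r S) {n : ℕ} (hS : S.card = n) :
    (linearExtensions r S n).card * ∏ v ∈ S, hookLength r S v = n.factorial := by
  classical
  induction n generalizing S with
  | zero =>
    obtain rfl := Finset.card_eq_zero.1 hS
    simp [linearExtensions, Function.injective_of_subsingleton]
  | succ n ih =>
    rw [card_linearExtensions_succ hS, Finset.sum_mul]
    have : ∀ v ∈ minimals r S, (linearExtensions r (S.erase v) n).card *
        ∏ w ∈ S, hookLength r S w = hookLength r S v * n.factorial := by
      intro v hv
      rw [mem_minimals] at hv
      rw [← ih (h.mono (S.erase_subset v)) (by rw [Finset.card_erase_of_mem hv.1, hS]; rfl),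
        ← Finset.mul_prod_erase _ _ hv.1]
      have : ∏ w ∈ S.erase v, hookLength r S w = ∏ w ∈ S.erase v, hookLength r (S.erase v) w := by
        refine Finset.prod_congr rfl fun w hw => ?_
        rw [Finset.mem_erase] at hw
        unfold hookLength
        congr 1
        ext x
        simp only [Finset.mem_filter, Finset.mem_erase]
        refine ⟨fun hx => ⟨⟨?_, hx.1⟩, hx.2⟩, fun hx => ⟨hx.1.2, hx.2⟩⟩
        rintro rfl
        exact hw.1 (hv.2 w hw.2 hx.2)
      rw [this]
      ring
    rw [Finset.sum_congr rfl this, ← Finset.sum_mul, h.sum_hookLength_minimals, hS,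
      Nat.factorial_succ]

lemma card_linearExtensions_eq {S : Finset α} {n : ℕ} (hS : S.card = n) :
    (linearExtensions (fun u v : α => u = v) S n).card = n.factorial := by
  classical
  rw [← card_linearExtensions_mul_prod_hookLength (isForest_eq S) hS]
  rw [Finset.prod_eq_one, mul_one]
  intro v hv
  rw [hookLength, Finset.card_eq_one]
  refine ⟨v, ?_⟩
  ext x
  simp only [Finset.mem_filter, Finset.mem_singleton]
  exact ⟨fun h => h.2.symm, fun h => ⟨h ▸ hv, h.symm⟩⟩

end Hook

/-! ### Index words and partitions -/

section KerPart

variable {k m : ℕ}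

open Classical in
/-- The partition of the positions of an index word into the sets of positions with equal index. -/
def kerPart {I : Type*} (σ : Fin k → I) : Part k := Finpartition.ofSetoid (Setoid.ker σ)

lemma mem_part_kerPart {I : Type*} {σ : Fin k → I} {p q : Fin k} :
    q ∈ (kerPart σ).part p ↔ σ q = σ p := by
  classical
  rw [kerPart, Finpartition.mem_part_ofSetoid_iff_rel, Setoid.ker_def]
  exact eq_comm

lemma kerPart_part (σ : Fin k → Fin m) (p : Fin k) :
    (kerPart σ).part p = Finset.univ.filter fun q => σ q = σ p := by
  ext q
  simp [mem_part_kerPart]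

lemma mem_parts_iff {π : Part k} {V : Finset (Fin k)} : V ∈ π.parts ↔ ∃ p, π.part p = V := by
  constructor
  · intro hV
    obtain ⟨p, hp⟩ := π.nonempty_of_mem_parts hV
    exact ⟨p, π.part_eq_of_mem hV hp⟩
  · rintro ⟨p, rfl⟩
    exact π.part_mem.2 (Finset.mem_univ p)

lemma eq_of_part_eq {π π' : Part k} (h : ∀ p, π.part p = π'.part p) : π = π' := by
  apply Finpartition.ext
  ext V
  simp [mem_parts_iff, h]

/-- Index words with a given kernel are enumerations of its blocks; if the blocks may not decrease
with respect to `r` as the index grows, these enumerations are the linear extensions. -/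
lemma card_kerPart_eq (r : Finset (Fin k) → Finset (Fin k) → Prop) {π : Part k}
    (hπ : π.parts.card = m) [DecidablePred fun σ : Fin k → Fin m => Function.Surjective σ ∧
      kerPart σ = π ∧ ∀ s t : Fin m, s < t → ¬ r (Finset.univ.filter fun p => σ p = t)
        (Finset.univ.filter fun p => σ p = s)] :
    (Finset.univ.filter fun σ : Fin k → Fin m => Function.Surjective σ ∧ kerPart σ = π ∧
      ∀ s t : Fin m, s < t → ¬ r (Finset.univ.filter fun p => σ p = t)
        (Finset.univ.filter fun p => σ p = s)).card =
      (linearExtensions r π.parts m).card := by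
  classical
  refine Finset.card_bij (fun σ _ t => Finset.univ.filter fun p => σ p = t) ?_ ?_ ?_
  · intro σ hσ
    simp only [linearExtensions, Finset.mem_filter, Finset.mem_univ, true_and] at hσ ⊢
    obtain ⟨h1, rfl, h3⟩ := hσ
    refine ⟨fun t => ?_, fun s t hst => ?_, h3⟩
    · obtain ⟨p, rfl⟩ := h1 t
      exact mem_parts_iff.2 ⟨p, kerPart_part σ p⟩
    · obtain ⟨p, rfl⟩ := h1 s
      have : p ∈ Finset.univ.filter fun q => σ q = t := by
        rw [← show _ = Finset.univ.filter fun q => σ q = t from hst]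
        simp
      simpa using this
  · intro σ _ σ' _ h
    funext p
    have : p ∈ Finset.univ.filter fun q => σ' q = σ p := by
      rw [← show _ = Finset.univ.filter fun q => σ' q = σ p from congrFun h (σ p)]
      simp
    exact (Finset.mem_filter.1 this).2.symm
  · intro f hf
    simp only [linearExtensions, Finset.mem_filter, Finset.mem_univ, true_and] at hf
    obtain ⟨h1, h2, h3⟩ := hf
    have himg : Finset.univ.image f = π.parts :=
      Finset.eq_of_subset_of_card_le (fun x hx => by
        obtain ⟨t, -, rfl⟩ := Finset.mem_image.1 hx
        exact h1 t) (by rw [Finset.card_image_of_injective _ h2]; simp [hπ])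
    have h4 : ∀ p, ∃ t, f t = π.part p := by
      intro p
      have : π.part p ∈ Finset.univ.image f := himg ▸ mem_parts_iff.2 ⟨p, rfl⟩
      obtain ⟨t, -, ht⟩ := Finset.mem_image.1 this
      exact ⟨t, ht⟩
    choose σ hσ using h4
    have h5 : ∀ t, (Finset.univ.filter fun p => σ p = t) = f t := by
      intro t
      ext p
      simp only [Finset.mem_filter, Finset.mem_univ, true_and]
      constructor
      · rintro rfl
        rw [hσ]
        exact π.mem_part (Finset.mem_univ p)
      · intro hp
        exact h2 ((hσ p).trans (π.part_eq_of_mem (h1 t) hp))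
    refine ⟨σ, Finset.mem_filter.2 ⟨Finset.mem_univ _, fun t => ?_, eq_of_part_eq fun p => ?_,
      fun s t hst => ?_⟩, funext h5⟩
    · obtain ⟨p, hp⟩ := π.nonempty_of_mem_parts (h1 t)
      exact ⟨p, h2 ((hσ p).trans (π.part_eq_of_mem (h1 t) hp))⟩
    · rw [kerPart_part, h5, hσ]
    · rw [h5, h5]
      exact h3 s t hst

lemma mem_NC2 {π : Part k} : π ∈ NC2 k ↔ NonCrossing π ∧ ∀ V ∈ π.parts, V.card = 2 := by
  simp [NC2]

lemma two_mul_card_parts {π : Part k} (hπ : π ∈ NC2 k) : 2 * π.parts.card = k := by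
  have h := π.sum_card_parts
  rw [Finset.sum_congr rfl (mem_NC2.1 hπ).2] at h
  simp only [Finset.sum_const, smul_eq_mul, Finset.card_univ, Fintype.card_fin] at h
  omega

/-- Group a sum over surjective index words by their kernels. The summand vanishes off the
non-crossing kernels, and on words whose enumeration of the blocks violates the order `r`. -/
lemma sum_surjective_eq {M : Type*} [AddCommMonoid M]
    (r : Finset (Fin k) → Finset (Fin k) → Prop) (Φ : (Fin k → Fin (k / 2)) → M) (g : Part k → M)
    (h0 : ∀ σ, Function.Surjective σ → kerPart σ ∉ NC2 k → Φ σ = 0)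
    (h1 : ∀ σ s t, Function.Surjective σ → kerPart σ ∈ NC2 k → s < t →
      r (Finset.univ.filter fun p => σ p = t) (Finset.univ.filter fun p => σ p = s) → Φ σ = 0)
    (h2 : ∀ σ, Function.Surjective σ → kerPart σ ∈ NC2 k →
      (∀ s t : Fin (k / 2), s < t → ¬ r (Finset.univ.filter fun p => σ p = t)
        (Finset.univ.filter fun p => σ p = s)) → Φ σ = g (kerPart σ)) :
    ∑ σ with Function.Surjective σ, Φ σ =
      ∑ π ∈ NC2 k, (linearExtensions r π.parts (k / 2)).card • g π := by
  classical
  have e1 : ∀ π ∈ NC2 k, (linearExtensions r π.parts (k / 2)).card • g π =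
      ∑ σ : Fin k → Fin (k / 2) with Function.Surjective σ ∧ kerPart σ = π ∧
        ∀ s t : Fin (k / 2), s < t → ¬ r (Finset.univ.filter fun p => σ p = t)
          (Finset.univ.filter fun p => σ p = s), Φ σ := by
    intro π hπ
    have := two_mul_card_parts hπ
    rw [← card_kerPart_eq r (show π.parts.card = k / 2 by omega), ← Finset.sum_const]
    refine Finset.sum_congr rfl fun σ hσ => ?_
    simp only [Finset.mem_filter, Finset.mem_univ, true_and] at hσ
    obtain ⟨hs, rfl, hr⟩ := hσ
    exact (h2 σ hs hπ hr).symm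
  rw [Finset.sum_congr rfl e1]
  have e2 : ∑ σ with Function.Surjective σ, Φ σ =
      ∑ σ with Function.Surjective σ ∧ kerPart σ ∈ NC2 k ∧
        ∀ s t : Fin (k / 2), s < t → ¬ r (Finset.univ.filter fun p => σ p = t)
          (Finset.univ.filter fun p => σ p = s), Φ σ := by
    symm
    refine Finset.sum_subset (fun σ hσ => ?_) (fun σ hσ hσ' => ?_)
    · rw [Finset.mem_filter] at hσ ⊢
      exact ⟨hσ.1, hσ.2.1⟩
    · simp only [Finset.mem_filter, Finset.mem_univ, true_and] at hσ hσ'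
      by_cases hπ : kerPart σ ∈ NC2 k
      · have : ¬ ∀ s t : Fin (k / 2), s < t → ¬ r (Finset.univ.filter fun p => σ p = t)
            (Finset.univ.filter fun p => σ p = s) := fun h => hσ' ⟨hσ, hπ, h⟩
        push Not at this
        obtain ⟨s, t, hst, hr⟩ := this
        exact h1 σ s t hσ hπ hst hr
      · exact h0 σ hσ hπ
  rw [e2, ← Finset.sum_fiberwise_of_maps_to (g := kerPart) (t := NC2 k)]
  · refine Finset.sum_congr rfl fun π hπ => ?_
    rw [Finset.filter_filter]
    refine Finset.sum_congr (Finset.filter_congr fun σ _ => ?_) fun _ _ => rfl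
    constructor
    · rintro ⟨⟨a1, -, a3⟩, a4⟩
      exact ⟨a1, a4, a3⟩
    · rintro ⟨a1, rfl, a3⟩
      exact ⟨⟨a1, hπ, a3⟩, rfl⟩
  · intro σ hσ
    exact (Finset.mem_filter.1 hσ).2.2.1

end KerPart

/-! ### Nested evaluation along non-crossing pair partitions -/

section Nested

variable {k : ℕ}

/-- The positions in `[l, r)` form a union of blocks. -/
def IsBlockUnion (π : Part k) (l r : ℕ) : Prop :=
  ∀ p q : Fin k, q ∈ π.part p → l ≤ p → (p : ℕ) < r → l ≤ q ∧ (q : ℕ) < r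

lemma isBlockUnion_univ (π : Part k) : IsBlockUnion π 0 k :=
  fun _ q _ _ _ => ⟨Nat.zero_le _, q.2⟩

lemma part_eq_part_of_mem {π : Part k} {p q : Fin k} (h : q ∈ π.part p) : π.part q = π.part p :=
  π.part_eq_of_mem (π.part_mem.2 (Finset.mem_univ p)) h

lemma mem_part_comm {π : Part k} {p q : Fin k} (h : q ∈ π.part p) : p ∈ π.part q :=
  part_eq_part_of_mem h ▸ π.mem_part (Finset.mem_univ p)

/-- The data of the block of the first position `l` of an interval that is a union of blocks. -/
structure IsFirstBlock (π : Part k) (l m r : ℕ) : Prop where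
  left_lt : l < m
  lt_right : m < r
  right_le : r ≤ k
  part_eq : π.part ⟨l, by omega⟩ = {⟨l, by omega⟩, ⟨m, by omega⟩}
  inner : IsBlockUnion π (l + 1) m
  outer : IsBlockUnion π (m + 1) r

lemma exists_isFirstBlock {π : Part k} (hπ : π ∈ NC2 k) {l r : ℕ} (hl : l < r) (hr : r ≤ k)
    (hc : IsBlockUnion π l r) : ∃ m, IsFirstBlock π l m r := by
  obtain ⟨hnc, hcard⟩ := mem_NC2.1 hπ
  set lf : Fin k := ⟨l, by omega⟩ with hlf
  have hlf' : (lf : ℕ) = l := rfl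
  have hmem : lf ∈ π.part lf := π.mem_part (Finset.mem_univ lf)
  have hparts : ∀ p, π.part p ∈ π.parts := fun p => π.part_mem.2 (Finset.mem_univ p)
  obtain ⟨mf, hne, hpart⟩ : ∃ mf, mf ≠ lf ∧ π.part lf = {lf, mf} := by
    obtain ⟨x, y, hxy, he⟩ := Finset.card_eq_two.1 (hcard _ (hparts lf))
    rw [he, Finset.mem_insert, Finset.mem_singleton] at hmem
    rcases hmem with h | h
    · exact ⟨y, by rw [h]; exact hxy.symm, by rw [he, h]⟩
    · exact ⟨x, by rw [h]; exact hxy, by rw [he, h, Finset.pair_comm]⟩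
  have hmf : mf ∈ π.part lf := by simp [hpart]
  obtain ⟨h1, h2⟩ := hc lf mf hmf le_rfl hl
  have hlm : l < mf := lt_of_le_of_ne h1 fun h => hne (Fin.ext h.symm)
  -- positions of other blocks do not lie on different sides of `m`
  have key : ∀ p q : Fin k, q ∈ π.part p → l < p → (p : ℕ) < mf → (mf : ℕ) < q → False := by
    intro p q hq hp hpm hqm
    refine hnc (π.part lf) (hparts _) (π.part p) (hparts _) (fun he => ?_)
      ⟨lf, hmem, p, π.mem_part (Finset.mem_univ p), mf, hmf, q, hq, hp, hpm, hqm⟩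
    have : p ∈ π.part lf := he ▸ π.mem_part (Finset.mem_univ p)
    rw [hpart, Finset.mem_insert, Finset.mem_singleton] at this
    rcases this with rfl | rfl <;> exact lt_irrefl _ ‹_›
  have hout : ∀ p q : Fin k, q ∈ π.part p → p ≠ lf → p ≠ mf → q ≠ lf ∧ q ≠ mf := by
    intro p q hq hp1 hp2
    have h3 : q = lf ∨ q = mf → p ∈ π.part lf := by
      rintro (rfl | rfl)
      · exact mem_part_comm hq
      · rw [← part_eq_part_of_mem hmf]
        exact mem_part_comm hq
    rw [hpart, Finset.mem_insert, Finset.mem_singleton] at h3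
    constructor <;> intro h
    · rcases h3 (Or.inl h) with h | h <;> contradiction
    · rcases h3 (Or.inr h) with h | h <;> contradiction
  refine ⟨mf, hlm, h2, hr, hpart, ?_, ?_⟩
  · intro p q hq hp hpm
    obtain ⟨hq1, hq2⟩ := hc p q hq (by omega) (by omega)
    obtain ⟨hq3, hq4⟩ := hout p q hq (fun h => by rw [h] at hp; simp [hlf] at hp)
      (fun h => by rw [h] at hpm; omega)
    have hq3' : (q : ℕ) ≠ l := fun h => hq3 (Fin.ext h)
    have hq4' : (q : ℕ) ≠ mf := fun h => hq4 (Fin.ext h)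
    have hq5 : ¬ (mf : ℕ) < q := fun h => key p q hq (by omega) hpm h
    clear_value lf
    omega
  · intro p q hq hp hpr
    obtain ⟨hq1, hq2⟩ := hc p q hq (by omega) (by omega)
    obtain ⟨hq3, hq4⟩ := hout p q hq (fun h => by rw [h] at hp; simp [hlf] at hp; omega)
      (fun h => by rw [h] at hp; omega)
    have hq3' : (q : ℕ) ≠ l := fun h => hq3 (Fin.ext h)
    have hq4' : (q : ℕ) ≠ mf := fun h => hq4 (Fin.ext h)
    have hq5 : ¬ (q : ℕ) < mf := fun h => key q p (mem_part_comm hq) (by omega) h (by omega)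
    clear_value lf
    omega

variable {R : Type*} [Ring R]

lemma nestedEval_self (π : Part k) (f : Finset (Fin k) → R → R) (b : ℕ → R) (l : ℕ) :
    nestedEval π f b l l = b l := by
  rw [nestedEval, dif_neg (by omega)]

lemma IsFirstBlock.nestedEval_eq {π : Part k} {l m r : ℕ} (h : IsFirstBlock π l m r)
    (f : Finset (Fin k) → R → R) (b : ℕ → R) :
    nestedEval π f b l r = b l * f (π.part ⟨l, by have := h.1; have := h.2; have := h.3; omega⟩)
      (nestedEval π f b (l + 1) m) * nestedEval π f b (m + 1) r := by
  obtain ⟨h1, h2, h3, h4, -, -⟩ := h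
  have hp : partner π ⟨l, by omega⟩ = m := by
    rw [partner, h4]
    simp [h1.le]
  rw [nestedEval, dif_pos (by omega), hp, if_pos (by omega)]

/-- A function of intervals that satisfies the recursion of the nested evaluation computes it. -/
lemma nestedEval_eq_of_recursion {π : Part k} (hπ : π ∈ NC2 k) (η : R → R) (b : ℕ → R)
    (Ψ : ℕ → ℕ → R) (h0 : ∀ l, Ψ l l = 1)
    (hstep : ∀ l m r, IsFirstBlock π l m r →
      Ψ l r = η (b (l + 1) * Ψ (l + 1) m) * b (m + 1) * Ψ (m + 1) r)
    (l r : ℕ) (hlr : l ≤ r) (hr : r ≤ k) (hc : IsBlockUnion π l r) :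
    nestedEval π (fun _ => η) b l r = b l * Ψ l r := by
  induction hn : r - l using Nat.strong_induction_on generalizing l r with
  | _ n ih =>
  rcases hlr.eq_or_lt with rfl | hlt
  · rw [nestedEval_self, h0, mul_one]
  obtain ⟨m, hm⟩ := exists_isFirstBlock hπ hlt hr hc
  have h1 := hm.left_lt
  have h2 := hm.lt_right
  rw [hm.nestedEval_eq, hstep l m r hm, ih _ (by omega) (l + 1) m h1 (by omega) hm.inner rfl,
    ih _ (by omega) (m + 1) r h2 hr hm.outer rfl]
  simp only [mul_assoc]

lemma nestedEval_congr {π : Part k} (hπ : π ∈ NC2 k) {f f' : Finset (Fin k) → R → R} (b : ℕ → R)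
    (l r : ℕ) (hlr : l ≤ r) (hr : r ≤ k) (hc : IsBlockUnion π l r)
    (hf : ∀ p : Fin k, l ≤ p → (p : ℕ) < r → f (π.part p) = f' (π.part p)) :
    nestedEval π f b l r = nestedEval π f' b l r := by
  induction hn : r - l using Nat.strong_induction_on generalizing l r with
  | _ n ih =>
  rcases hlr.eq_or_lt with rfl | hlt
  · simp only [nestedEval_self]
  obtain ⟨m, hm⟩ := exists_isFirstBlock hπ hlt hr hc
  have h1 := hm.left_lt
  have h2 := hm.lt_right
  rw [hm.nestedEval_eq, hm.nestedEval_eq, hf _ le_rfl hlt,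
    ih _ (by omega) (l + 1) m h1 (by omega) hm.inner
      (fun p hp hp' => hf p (by omega) (by omega)) rfl,
    ih _ (by omega) (m + 1) r h2 hr hm.outer (fun p hp hp' => hf p (by omega) (by omega)) rfl]

open Classical in
/-- The blocks of `π` that are contained in `[l, r)`. -/
def blocksIn (π : Part k) (l r : ℕ) : Finset (Finset (Fin k)) :=
  π.parts.filter fun V => ∀ p ∈ V, l ≤ (p : ℕ) ∧ (p : ℕ) < r

lemma mem_blocksIn {π : Part k} {l r : ℕ} {V : Finset (Fin k)} :
    V ∈ blocksIn π l r ↔ V ∈ π.parts ∧ ∀ p ∈ V, l ≤ (p : ℕ) ∧ (p : ℕ) < r := by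
  simp [blocksIn]

lemma blocksIn_univ (π : Part k) : blocksIn π 0 k = π.parts := by
  ext V
  simp [mem_blocksIn]

lemma sum_blocksIn {π : Part k} {l m r : ℕ} (hc : IsBlockUnion π l r) (h : IsFirstBlock π l m r)
    {M : Type*} [AddCommMonoid M] (g : Finset (Fin k) → M) :
    ∑ V ∈ blocksIn π l r, g V =
      g (π.part ⟨l, by have := h.1; have := h.2; have := h.3; omega⟩) +
        (∑ V ∈ blocksIn π (l + 1) m, g V + ∑ V ∈ blocksIn π (m + 1) r, g V) := by
  classical
  obtain ⟨h1, h2, h3, h4, h5, h6⟩ := h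
  have hd : Disjoint (blocksIn π (l + 1) m) (blocksIn π (m + 1) r) := by
    rw [Finset.disjoint_left]
    intro V hV hV'
    rw [mem_blocksIn] at hV hV'
    obtain ⟨p, hp⟩ := π.nonempty_of_mem_parts hV.1
    have := hV.2 p hp
    have := hV'.2 p hp
    omega
  have hmem : (⟨l, by omega⟩ : Fin k) ∈ π.part ⟨l, by omega⟩ := π.mem_part (Finset.mem_univ _)
  have hnot : π.part ⟨l, by omega⟩ ∉ blocksIn π (l + 1) m ∪ blocksIn π (m + 1) r := by
    rw [Finset.mem_union, mem_blocksIn, mem_blocksIn]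
    rintro (hV | hV)
    · have := hV.2 _ hmem
      simp at this
    · have := hV.2 _ hmem
      simp at this
      omega
  rw [← Finset.sum_union hd, ← Finset.sum_insert hnot]
  refine Finset.sum_congr ?_ fun _ _ => rfl
  ext V
  rw [Finset.mem_insert, Finset.mem_union, mem_blocksIn, mem_blocksIn, mem_blocksIn]
  constructor
  · rintro ⟨hV, hlr⟩
    obtain ⟨p, hp⟩ := π.nonempty_of_mem_parts hV
    have hpart := π.part_eq_of_mem hV hp
    by_cases hp1 : p ∈ π.part ⟨l, by omega⟩
    · left
      rw [← hpart, part_eq_part_of_mem hp1]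
    · right
      have hp1' := hp1
      rw [h4, Finset.mem_insert, Finset.mem_singleton, Fin.ext_iff, Fin.ext_iff] at hp1'
      have := hlr p hp
      rcases Nat.lt_or_ge p m with hpm | hpm
      · left
        refine ⟨hV, fun q hq => h5 p q (hpart ▸ hq) ?_ hpm⟩
        simp at hp1'
        omega
      · right
        refine ⟨hV, fun q hq => h6 p q (hpart ▸ hq) ?_ this.2⟩
        simp at hp1'
        omega
  · rintro (rfl | hV | hV)
    · exact ⟨π.part_mem.2 (Finset.mem_univ _), fun p hp => hc _ p hp le_rfl (by simp; omega)⟩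
    · refine ⟨hV.1, fun p hp => ?_⟩
      have := hV.2 p hp
      omega
    · refine ⟨hV.1, fun p hp => ?_⟩
      have := hV.2 p hp
      omega

/-- The map of the dual numbers with value `η x` and derivative `η' x + η x'` at `x + ε x'`. -/
def dualMap (η η' : R → R) (x : TrivSqZeroExt R R) : TrivSqZeroExt R R :=
  TrivSqZeroExt.inl (η x.fst) + TrivSqZeroExt.inr (η' x.fst + η x.snd)

/-- The dual number part of the nested evaluation differentiates one block at a time. -/
lemma nestedEval_dualMap {π : Part k} (hπ : π ∈ NC2 k) (η : R →+ R) (η' : R → R) (b : ℕ → R)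
    (l r : ℕ) (hlr : l ≤ r) (hr : r ≤ k) (hc : IsBlockUnion π l r) :
    nestedEval π (fun _ => dualMap η η') (fun n => TrivSqZeroExt.inl (b n)) l r =
      TrivSqZeroExt.inl (nestedEval π (fun _ => η) b l r) +
      TrivSqZeroExt.inr (∑ V ∈ blocksIn π l r,
        nestedEval π (Function.update (fun _ => ⇑η) V η') b l r) := by
  induction hn : r - l using Nat.strong_induction_on generalizing l r with
  | _ n ih =>
  rcases hlr.eq_or_lt with rfl | hlt
  · have : blocksIn π l l = ∅ := by
      rw [Finset.eq_empty_iff_forall_notMem]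
      intro V hV
      rw [mem_blocksIn] at hV
      obtain ⟨p, hp⟩ := π.nonempty_of_mem_parts hV.1
      have := hV.2 p hp
      omega
    simp [nestedEval_self, this]
  obtain ⟨m, hm⟩ := exists_isFirstBlock hπ hlt hr hc
  have h1 := hm.left_lt
  have h2 := hm.lt_right
  have e0 : ∀ V : Finset (Fin k), ∀ l' r', l' ≤ r' → r' ≤ k → IsBlockUnion π l' r' →
      (∃ p ∈ V, ¬ (l' ≤ (p : ℕ) ∧ (p : ℕ) < r')) →
      nestedEval π (Function.update (fun _ => ⇑η) V η') b l' r' =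
        nestedEval π (fun _ => ⇑η) b l' r' := by
    intro V l' r' hl' hr' hc' ⟨p, hp, hnot⟩
    refine nestedEval_congr hπ b l' r' hl' hr' hc' fun q hq hq' => ?_
    rw [Function.update_of_ne]
    rintro rfl
    exact hnot (hc' q p hp hq hq')
  have hmem : (⟨l, by omega⟩ : Fin k) ∈ π.part ⟨l, by omega⟩ := π.mem_part (Finset.mem_univ _)
  have e1 : ∀ V ∈ blocksIn π (l + 1) m,
      nestedEval π (Function.update (fun _ => ⇑η) V η') b l r =
        b l * η (nestedEval π (Function.update (fun _ => ⇑η) V η') b (l + 1) m) *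
          nestedEval π (fun _ => ⇑η) b (m + 1) r := by
    intro V hV
    rw [mem_blocksIn] at hV
    obtain ⟨p, hp⟩ := π.nonempty_of_mem_parts hV.1
    have h3 := hV.2 p hp
    rw [hm.nestedEval_eq, Function.update_of_ne,
      e0 V (m + 1) r h2 hr hm.outer ⟨p, hp, by omega⟩]
    rintro rfl
    have := hV.2 _ hmem
    simp at this
  have e2 : ∀ V ∈ blocksIn π (m + 1) r,
      nestedEval π (Function.update (fun _ => ⇑η) V η') b l r =
        b l * η (nestedEval π (fun _ => ⇑η) b (l + 1) m) *
          nestedEval π (Function.update (fun _ => ⇑η) V η') b (m + 1) r := by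
    intro V hV
    rw [mem_blocksIn] at hV
    obtain ⟨p, hp⟩ := π.nonempty_of_mem_parts hV.1
    have h3 := hV.2 p hp
    rw [hm.nestedEval_eq, Function.update_of_ne,
      e0 V (l + 1) m h1 (by omega) hm.inner ⟨p, hp, by omega⟩]
    rintro rfl
    have := hV.2 _ hmem
    simp at this
    omega
  rw [sum_blocksIn hc hm, Finset.sum_congr rfl e1, Finset.sum_congr rfl e2, ← Finset.sum_mul,
    ← Finset.mul_sum, ← Finset.mul_sum, ← map_sum, hm.nestedEval_eq, hm.nestedEval_eq,
    hm.nestedEval_eq, Function.update_self,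
    e0 _ (l + 1) m h1 (by omega) hm.inner ⟨_, hmem, by simp⟩,
    e0 _ (m + 1) r h2 hr hm.outer ⟨_, hmem, by simp; omega⟩,
    ih _ (by omega) (l + 1) m h1 (by omega) hm.inner rfl,
    ih _ (by omega) (m + 1) r h2 hr hm.outer rfl]
  ext
  · simp [dualMap]
  · simp [dualMap, mul_add, add_mul, mul_assoc]
    abel

lemma etaPart_dualMap {π : Part k} (hπ : π ∈ NC2 k) (η : R →+ R) (η' : R → R) (b : ℕ → R) :
    etaPart (dualMap η η') π (fun n => TrivSqZeroExt.inl (b n)) =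
      TrivSqZeroExt.inl (etaPart η π b) + TrivSqZeroExt.inr (dEtaPart η η' π b) := by
  rw [etaPart, nestedEval_dualMap hπ η η' b 0 k (Nat.zero_le k) le_rfl (isBlockUnion_univ π),
    blocksIn_univ]
  rfl

/-- The same product rule for alternating products. -/
lemma altProd_dualMap (η : R →+ R) (η' : R → R) (b : ℕ → R) (m : ℕ) :
    altProd (fun _ => dualMap η η') (fun n => TrivSqZeroExt.inl (b n)) m =
      TrivSqZeroExt.inl (altProd (fun _ => ⇑η) b m) +
      TrivSqZeroExt.inr
        (∑ j ∈ Finset.range m, altProd (Function.update (fun _ => ⇑η) j η') b m) := by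
  have hsucc : ∀ {S : Type _} [Ring S] (f : ℕ → S → S) (b : ℕ → S) (m : ℕ),
      altProd f b (m + 1) = altProd f b m * (f m (b (2 * m + 1)) * b (2 * m + 2)) := by
    intro S _ f b m
    simp [altProd, List.range_succ, mul_assoc]
  have hcongr : ∀ m, altProd (Function.update (fun _ => ⇑η) m η') b m =
      altProd (fun _ => ⇑η) b m := by
    intro m
    simp only [altProd]
    congr 2
    refine List.map_congr_left fun i hi => ?_
    rw [Function.update_of_ne (List.mem_range.1 hi).ne]
  induction m with
  | zero => simp [altProd]
  | succ m ih =>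
    have e1 : ∀ j ∈ Finset.range m,
        altProd (Function.update (fun _ => ⇑η) j η') b (m + 1) =
          altProd (Function.update (fun _ => ⇑η) j η') b m *
            (η (b (2 * m + 1)) * b (2 * m + 2)) := by
      intro j hj
      rw [hsucc, Function.update_of_ne (Finset.mem_range.1 hj).ne']
    rw [hsucc, ih, hsucc, Finset.sum_range_succ, Finset.sum_congr rfl e1, ← Finset.sum_mul, hsucc,
      Function.update_self, hcongr]
    ext
    · simp [dualMap]
    · simp [dualMap]
      abel

end Nested

/-! ### Words of positions -/

section PosWord

variable {A B I : Type*} {k : ℕ}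

/-- The word with indices `i 0, …, i (k - 1)` and scalars `b 1, …, b k`. -/
def posWord (i : Fin k → I) (b : ℕ → B) : List (I × B) :=
  List.ofFn fun p => (i p, b (p + 1))

/-- The part of such a word at the positions in `[l, r)`. -/
def segment (i : ℕ → I) (b : ℕ → B) (l r : ℕ) : List (I × B) :=
  (List.Ico l r).map fun p => (i p, b (p + 1))

lemma map_fst_posWord (i : Fin k → I) (b : ℕ → B) : (posWord i b).map Prod.fst = List.ofFn i := by
  rw [posWord, List.map_ofFn]
  rfl

lemma segment_univ (i : ℕ → I) (b : ℕ → B) (k : ℕ) :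
    segment i b 0 k = posWord (fun p : Fin k => i p) b := by
  rw [segment, posWord, List.Ico.zero_bot, List.ofFn_eq_map, ← List.map_coe_finRange_eq_range,
    List.map_map]
  rfl

@[simp] lemma segment_self (i : ℕ → I) (b : ℕ → B) (l : ℕ) : segment i b l l = [] := by
  simp [segment]

lemma segment_cons (i : ℕ → I) (b : ℕ → B) {l r : ℕ} (h : l < r) :
    segment i b l r = (i l, b (l + 1)) :: segment i b (l + 1) r := by
  rw [segment, List.Ico.eq_cons h]
  rfl

lemma segment_split (i : ℕ → I) (b : ℕ → B) {l m r : ℕ} (h : l < m) (h' : m < r) :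
    segment i b l r = (i l, b (l + 1)) :: segment i b (l + 1) m ++
      (i m, b (m + 1)) :: segment i b (m + 1) r := by
  rw [← segment_cons i b h, ← segment_cons i b h', segment, segment, segment, ← List.map_append,
    List.Ico.append_consecutive h.le h'.le]

lemma mem_segment {i : ℕ → I} {b : ℕ → B} {l r : ℕ} {x : I × B} (hx : x ∈ segment i b l r) :
    ∃ p, l ≤ p ∧ p < r ∧ x.1 = i p := by
  obtain ⟨p, hp, rfl⟩ := List.mem_map.1 hx
  rw [List.Ico.mem] at hp
  exact ⟨p, hp.1, hp.2, rfl⟩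

lemma count_ofFn [DecidableEq I] (i : Fin k → I) (t : I) :
    (List.ofFn i).count t = (Finset.univ.filter fun p => i p = t).card := by
  have := Fin.card_filter_univ_eq_vector_get_eq_count t (List.Vector.ofFn i)
  simpa using this.symm

lemma count_posWord_le_two {m : ℕ} {σ : Fin k → Fin m} (b : ℕ → B)
    (h : ∀ t, (Finset.univ.filter fun p => σ p = t).card ≤ 2) (t : ℕ) :
    ((posWord (fun p => (σ p : ℕ)) b).map Prod.fst).count t ≤ 2 := by
  rw [map_fst_posWord, count_ofFn]
  by_cases ht : t < m
  · convert h ⟨t, ht⟩ using 4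
    rw [Fin.ext_iff]
  · rw [Finset.filter_eq_empty_iff.2]
    · simp
    · intro p _ he
      exact ht (he ▸ (σ p).2)

/-- The letters at increasing positions form a subword. -/
lemma map_sublist_ofFn (i : Fin k → I) {l : List (Fin k)} (hl : l.Pairwise (· < ·)) :
    (l.map i).Sublist (List.ofFn i) := by
  rw [List.ofFn_eq_map]
  refine List.Sublist.map _ (List.sublist_of_subperm_of_pairwise (r := (· ≤ ·)) ?_ ?_ ?_)
  · exact List.subperm_of_subset (hl.imp fun h => h.ne) fun x _ => List.mem_finRange x
  · exact hl.imp fun h => h.le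
  · exact (List.pairwise_lt_finRange k).imp fun h => h.le

variable [Ring A] [Ring B]

/-- The contribution of an index word to the moment of the sum of the `a i`. -/
def wordMoment (D : CondExp A B) (a : I → A) (b : ℕ → B) (i : Fin k → I) : B :=
  b 0 * D.E (wordProd D.ι a (posWord i b))

lemma E_word_sum (D : CondExp A B) (a : ℕ → A) (b : ℕ → B) (k N : ℕ) :
    D.E (D.ι (b 0) * ((List.range k).map fun l =>
      (∑ i ∈ Finset.range N, a i) * D.ι (b (l + 1))).prod) =
      ∑ i : Fin k → Fin N, wordMoment D a b fun p => (i p : ℕ) := by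
  have h := (MultilinearMap.mkPiAlgebraFin ℤ k A).map_sum
    fun (p : Fin k) (i : Fin N) => a i * D.ι (b (p + 1))
  simp only [MultilinearMap.mkPiAlgebraFin_apply] at h
  have h2 : ((List.range k).map fun l =>
      (∑ i ∈ Finset.range N, a i) * D.ι (b (l + 1))).prod =
      (List.ofFn fun p : Fin k => ∑ i : Fin N, a i * D.ι (b (p + 1))).prod := by
    rw [List.ofFn_eq_map, ← List.map_coe_finRange_eq_range, List.map_map]
    congr 1
    refine List.map_congr_left fun p _ => ?_
    simp only [Function.comp_apply]
    rw [← Finset.sum_mul, Finset.sum_range]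
  rw [D.E_left, h2, h, map_sum, Finset.mul_sum]
  refine Finset.sum_congr rfl fun i _ => ?_
  rw [wordMoment, wordProd, posWord, List.map_ofFn]
  rfl

end PosWord

/-! ### Limits of moments -/

/-- Identical distribution. -/
def IsIdentical {A B I : Type*} [Ring A] [Ring B] (D : CondExp A B) (a : I → A) : Prop :=
  ∀ (i j : I) (l : List B),
    D.E (a i * (l.map fun b => D.ι b * a i).prod) = D.E (a j * (l.map fun b => D.ι b * a j).prod)

section Limit

variable {A B : Type*} [Ring A] [Ring B] {D : CondExp A B} {a : ℕ → A}

/-- The limit of the moments of the normalized sum, as a sum over index words with `k / 2` distinct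
indices. -/
lemma tendsto_moment [Module ℂ B] [TopologicalSpace B] [ContinuousAdd B] [ContinuousSMul ℂ B]
    (hcongr : ∀ (m : ℕ) (φ : Fin m → ℕ), StrictMono φ → ∀ w : List (Fin m × B),
      D.E (wordProd D.ι (a ∘ φ) w) = D.E (wordProd D.ι (a ∘ fun t : Fin m => (t : ℕ)) w))
    (hsing : ∀ (w : List (ℕ × B)) (p : ℕ), (w.map Prod.fst).count p = 1 →
      D.E (wordProd D.ι a w) = 0) (k : ℕ) (b : ℕ → B) :
    Tendsto (fun N : ℕ => ((Real.sqrt N : ℂ)⁻¹) ^ k • D.E (D.ι (b 0) *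
      ((List.range k).map fun l => (∑ i ∈ Finset.range N, a i) * D.ι (b (l + 1))).prod)) atTop
      (𝓝 (if Even k then (((k / 2).factorial : ℂ)⁻¹) •
        ∑ σ : Fin k → Fin (k / 2) with Function.Surjective σ,
          wordMoment D a b (fun p => (σ p : ℕ)) else 0)) := by
  simp only [E_word_sum]
  refine tendsto_sum_words (wordMoment D a b) ?_ ?_
  · intro m σ φ hφ
    have key : ∀ ψ : Fin m → ℕ, wordProd D.ι a (posWord (fun p => ψ (σ p)) b) =
        wordProd D.ι (a ∘ ψ) (posWord σ b) := by
      intro ψ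
      rw [← wordProd_reindex, posWord, posWord, List.map_ofFn]
      rfl
    rw [wordMoment, wordMoment, key φ, hcongr m φ hφ, key fun t => (t : ℕ)]
  · rintro i ⟨p, hp⟩
    rw [wordMoment, hsing _ (i p), mul_zero]
    rw [map_fst_posWord, count_ofFn, Finset.card_eq_one]
    refine ⟨p, ?_⟩
    ext q
    simp only [Finset.mem_filter, Finset.mem_univ, true_and, Finset.mem_singleton]
    exact ⟨hp q, fun h => by rw [h]⟩

/-- A surjective index word without singletons onto `k / 2` indices uses every index twice. -/
lemma card_fiber_eq_two {k : ℕ} (hk : Even k) {σ : Fin k → Fin (k / 2)}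
    (hs : Function.Surjective σ) (hσ : ¬ ∃ p, ∀ q, σ q = σ p → q = p) (t : Fin (k / 2)) :
    (Finset.univ.filter fun p => σ p = t).card = 2 := by
  have h2 : ∀ t ∈ Finset.univ, 2 ≤ (Finset.univ.filter fun p => σ p = t).card := by
    intro t _
    by_contra hlt
    obtain ⟨p, rfl⟩ := hs t
    refine hσ ⟨p, fun q hq => ?_⟩
    exact Finset.card_le_one.1 (Nat.lt_succ_iff.1 (not_le.1 hlt)) q (by simpa using hq) p (by simp)
  have h3 : ∑ t : Fin (k / 2), 2 = ∑ t, (Finset.univ.filter fun p => σ p = t).card := by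
    rw [← Finset.card_eq_sum_card_fiberwise (f := σ) (t := Finset.univ)
      (fun _ _ => Finset.mem_univ _)]
    have := Nat.div_two_mul_two_of_even hk
    simpa using this
  exact ((Finset.sum_eq_sum_iff_of_le h2).1 h3 t (Finset.mem_univ t)).symm

/-- If words with a singleton vanish, then only index words with all fibers of size two matter. -/
lemma wordMoment_eq_zero_or {k : ℕ} (hk : Even k)
    (hsing : ∀ (w : List (ℕ × B)) (p : ℕ), (w.map Prod.fst).count p = 1 →
      D.E (wordProd D.ι a w) = 0) (b : ℕ → B) {σ : Fin k → Fin (k / 2)}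
    (hs : Function.Surjective σ) :
    D.E (wordProd D.ι a (posWord (fun p => (σ p : ℕ)) b)) = 0 ∨
      ∀ t, (Finset.univ.filter fun p => σ p = t).card = 2 := by
  by_cases h : ∃ p, ∀ q, σ q = σ p → q = p
  · left
    obtain ⟨p, hp⟩ := h
    refine hsing _ (σ p) ?_
    rw [map_fst_posWord, count_ofFn, Finset.card_eq_one]
    refine ⟨p, ?_⟩
    ext q
    simp only [Finset.mem_filter, Finset.mem_univ, true_and, Finset.mem_singleton]
    exact ⟨fun h => hp q (Fin.ext h), fun h => by rw [h]⟩
  · exact Or.inr fun t => card_fiber_eq_two hk hs h t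

lemma card_part_kerPart {k m : ℕ} {σ : Fin k → Fin m}
    (h : ∀ t, (Finset.univ.filter fun p => σ p = t).card = 2) :
    ∀ V ∈ (kerPart σ).parts, V.card = 2 := by
  intro V hV
  obtain ⟨p, rfl⟩ := mem_parts_iff.1 hV
  rw [kerPart_part, h]

/-- If the kernel has a crossing, then the index word has a subword `s t s t`. -/
lemma exists_crossing_sublist {k m : ℕ} {σ : Fin k → Fin m} (h : ¬ NonCrossing (kerPart σ)) :
    ∃ s t : ℕ, s ≠ t ∧ [s, t, s, t].Sublist (List.ofFn fun p => (σ p : ℕ)) := by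
  unfold NonCrossing at h
  push Not at h
  obtain ⟨V, hV, W, hW, hne, p, hp, q, hq, r, hr, s, hs, h1, h2, h3⟩ := h
  have hV' : ∀ x ∈ V, σ x = σ p := by
    intro x hx
    rw [← (kerPart σ).part_eq_of_mem hV hp] at hx
    exact mem_part_kerPart.1 hx
  have hW' : ∀ x ∈ W, σ x = σ q := by
    intro x hx
    rw [← (kerPart σ).part_eq_of_mem hW hq] at hx
    exact mem_part_kerPart.1 hx
  refine ⟨σ p, σ q, fun he => hne ?_, ?_⟩
  · have : p ∈ (kerPart σ).part q := mem_part_kerPart.2 (Fin.ext he)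
    rw [(kerPart σ).part_eq_of_mem hW hq] at this
    exact (kerPart σ).eq_of_mem_parts hV hW hp this
  · have := map_sublist_ofFn (fun p => (σ p : ℕ)) (l := [p, q, r, s])
      (by simp [h1, h2, h3, h1.trans h2, h2.trans h3, (h1.trans h2).trans h3])
    simpa [hV' r hr, hW' s hs] using this

lemma exists_nat_extension {k : ℕ} (i : Fin k → ℕ) : ∃ i' : ℕ → ℕ, ∀ p : Fin k, i' p = i p :=
  ⟨fun p => if h : p < k then i ⟨p, h⟩ else 0, fun p => by simp⟩

/-- The relation between the letters of a word and those in a block and its two sides, for the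
first block of an interval. -/
lemma IsFirstBlock.index_ne {k : ℕ} {i : ℕ → ℕ} {l m r : ℕ}
    (h : IsFirstBlock (kerPart fun p : Fin k => i p) l m r) :
    i m = i l ∧ (∀ p, l < p → p < m → i p ≠ i l) ∧ (∀ p, m < p → p < r → i p ≠ i l) ∧
      ∀ p q, l < p → p < m → m < q → q < r → i p ≠ i q := by
  obtain ⟨h1, h2, h3, h4, h5, h6⟩ := h
  have hmem : ∀ p (hp : p < k), i p = i l → p = l ∨ p = m := by
    intro p hp he
    have : (⟨p, hp⟩ : Fin k) ∈ (kerPart fun p : Fin k => i p).part ⟨l, by omega⟩ :=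
      mem_part_kerPart.2 he
    rw [h4] at this
    simpa [Fin.ext_iff] using this
  refine ⟨?_, fun p hp hp' he => ?_, fun p hp hp' he => ?_, fun p q hp hp' hq hq' he => ?_⟩
  · have : (⟨m, by omega⟩ : Fin k) ∈ (kerPart fun p : Fin k => i p).part ⟨l, by omega⟩ := by
      rw [h4]
      simp
    exact mem_part_kerPart.1 this
  · rcases hmem p (by omega) he with h | h <;> omega
  · rcases hmem p (by omega) he with h | h <;> omega
  · have := h5 ⟨p, by omega⟩ ⟨q, by omega⟩ (mem_part_kerPart.2 he.symm) hp hp'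
    have := this.2
    simp at this
    omega

/-- The moment of an index word with non-crossing kernel, if the moments of intervals satisfy the
recursion of the nested evaluation. -/
lemma wordMoment_eq_etaPart {k m : ℕ} {σ : Fin k → Fin m} (hπ : kerPart σ ∈ NC2 k) {η : B → B}
    (b : ℕ → B)
    (hstep : ∀ i : ℕ → ℕ, (∀ p : Fin k, i p = σ p) → ∀ l m r,
      IsFirstBlock (kerPart fun p : Fin k => i p) l m r →
      D.E (wordProd D.ι a (segment i b l r)) =
        η (b (l + 1) * D.E (wordProd D.ι a (segment i b (l + 1) m))) * b (m + 1) *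
          D.E (wordProd D.ι a (segment i b (m + 1) r))) :
    wordMoment D a b (fun p => (σ p : ℕ)) = etaPart η (kerPart σ) b := by
  obtain ⟨i, hi⟩ := exists_nat_extension fun p => (σ p : ℕ)
  have hker : (kerPart fun p : Fin k => i p) = kerPart σ :=
    eq_of_part_eq fun p => by
      ext q
      rw [mem_part_kerPart, mem_part_kerPart, hi, hi, Fin.ext_iff]
  rw [etaPart, nestedEval_eq_of_recursion hπ η b
    (fun l r => D.E (wordProd D.ι a (segment i b l r))) (by simp [D.E_one]) (by
      rw [← hker]
      exact hstep i hi) 0 k (Nat.zero_le k) le_rfl (isBlockUnion_univ _)]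
  rw [segment_univ, wordMoment]
  simp only [hi]

end Limit

/-! ### The forest of a non-crossing partition -/

section Nesting

variable {k : ℕ}

/-- The block `W` is contained in the interval from `min V` to `max V`. -/
def Nested (V W : Finset (Fin k)) : Prop :=
  ∀ w ∈ W, (∃ v ∈ V, v ≤ w) ∧ ∃ v ∈ V, w ≤ v

lemma Nested.trans {U V W : Finset (Fin k)} (h : Nested U V) (h' : Nested V W) : Nested U W := by
  intro w hw
  obtain ⟨⟨v, hv, hvw⟩, v', hv', hvw'⟩ := h' w hw
  obtain ⟨⟨u, hu, huv⟩, -⟩ := h v hv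
  obtain ⟨-, u', hu', huv'⟩ := h v' hv'
  exact ⟨⟨u, hu, huv.trans hvw⟩, u', hu', hvw'.trans huv'⟩

lemma Nested.min_le {V W : Finset (Fin k)} (h : Nested V W) (hV : V.Nonempty) (hW : W.Nonempty) :
    V.min' hV ≤ W.min' hW := by
  obtain ⟨v, hv, hvw⟩ := (h _ (W.min'_mem hW)).1
  exact (V.min'_le v hv).trans hvw

lemma nested_of_min_le {V W : Finset (Fin k)} (hV : V.Nonempty) (hW : W.Nonempty)
    (h₁ : V.min' hV ≤ W.min' hW) (h₂ : W.max' hW ≤ V.max' hV) : Nested V W := fun w hw =>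
  ⟨⟨_, V.min'_mem hV, h₁.trans (W.min'_le w hw)⟩, _, V.max'_mem hV, (W.le_max' w hw).trans h₂⟩

/-- The blocks of a non-crossing partition form a forest under nesting. -/
lemma NonCrossing.isForest {π : Part k} (hπ : NonCrossing π) : IsForest Nested π.parts := by
  refine ⟨fun V _ w hw => ⟨⟨w, hw, le_rfl⟩, w, hw, le_rfl⟩, fun _ _ _ _ _ _ h h' => h.trans h',
    ?_, ?_⟩
  · intro U hU V hV h h'
    have hU' := π.nonempty_of_mem_parts hU
    have hV' := π.nonempty_of_mem_parts hV
    have he := le_antisymm (h.min_le hU' hV') (h'.min_le hV' hU')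
    exact π.eq_of_mem_parts hU hV (U.min'_mem hU') (he ▸ V.min'_mem hV')
  · intro U hU V hV W hW h h'
    by_cases hUV : U = V
    · subst hUV
      exact Or.inl fun w hw => ⟨⟨w, hw, le_rfl⟩, w, hw, le_rfl⟩
    have hU' := π.nonempty_of_mem_parts hU
    have hV' := π.nonempty_of_mem_parts hV
    obtain ⟨w, hw⟩ := π.nonempty_of_mem_parts hW
    have hne : ∀ u ∈ U, ∀ v ∈ V, u ≠ v := fun u hu v hv he =>
      hUV (π.eq_of_mem_parts hU hV hu (he ▸ hv))
    have hminU : U.min' hU' ≤ w := by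
      obtain ⟨u, hu, huw⟩ := (h w hw).1
      exact (U.min'_le u hu).trans huw
    have hmaxU : w ≤ U.max' hU' := by
      obtain ⟨u, hu, huw⟩ := (h w hw).2
      exact huw.trans (U.le_max' u hu)
    have hminV : V.min' hV' ≤ w := by
      obtain ⟨v, hv, hvw⟩ := (h' w hw).1
      exact (V.min'_le v hv).trans hvw
    have hmaxV : w ≤ V.max' hV' := by
      obtain ⟨v, hv, hvw⟩ := (h' w hw).2
      exact hvw.trans (V.le_max' v hv)
    rcases (hne _ (U.min'_mem hU') _ (V.min'_mem hV')).lt_or_gt with hlt | hlt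
    · left
      refine nested_of_min_le hU' hV' hlt.le (le_of_not_gt fun hgt => ?_)
      exact hπ U hU V hV hUV ⟨_, U.min'_mem hU', _, V.min'_mem hV', _, U.max'_mem hU', _,
        V.max'_mem hV', hlt, lt_of_le_of_ne (hminV.trans hmaxU)
          (hne _ (U.max'_mem hU') _ (V.min'_mem hV')).symm, hgt⟩
    · right
      refine nested_of_min_le hV' hU' hlt.le (le_of_not_gt fun hgt => ?_)
      exact hπ V hV U hU (Ne.symm hUV) ⟨_, V.min'_mem hV', _, U.min'_mem hU', _, V.max'_mem hV', _,
        U.max'_mem hU', hlt, lt_of_le_of_ne (hminU.trans hmaxV)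
          (hne _ (U.min'_mem hU') _ (V.max'_mem hV')), hgt⟩

lemma treeFactorial_eq (π : Part k) :
    treeFactorial π = ∏ V ∈ π.parts, hookLength Nested π.parts V := by
  unfold treeFactorial hookLength Nested
  refine Finset.prod_congr rfl fun V _ => ?_
  congr!

/-- The proportion of the orderings of the blocks in which nested blocks come later. -/
lemma card_linearExtensions_nested {π : Part k} (hπ : π ∈ NC2 k) :
    (((k / 2).factorial : ℂ)⁻¹) * ((linearExtensions Nested π.parts (k / 2)).card : ℂ) =
      (treeFactorial π : ℂ)⁻¹ := by
  have h1 := two_mul_card_parts hπ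
  have h2 := card_linearExtensions_mul_prod_hookLength (mem_NC2.1 hπ).1.isForest
    (show π.parts.card = k / 2 by omega)
  rw [← treeFactorial_eq] at h2
  have h3 : ((k / 2).factorial : ℂ) ≠ 0 := Nat.cast_ne_zero.2 (Nat.factorial_ne_zero _)
  have h4 : (treeFactorial π : ℂ) ≠ 0 := by
    rw [← h2] at h3
    intro h
    rw [Nat.cast_mul, h, mul_zero] at h3
    exact h3 rfl
  rw [← h2, Nat.cast_mul] at h3 ⊢
  have h5 := left_ne_zero_of_mul h3
  field_simp

end Nesting

section LimitTheorems

variable {A B : Type*} [Ring A] [Ring B] {D : CondExp A B} {a : ℕ → A} {η : B → B}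

lemma IsIdentical.sameMarginals (h : IsIdentical D a) {m : ℕ} (φ ψ : Fin m → ℕ) :
    SameMarginals D (a ∘ φ) (a ∘ ψ) :=
  fun i l => h (φ i) (ψ i) l

/-- A word in which no index occurs three times has a nonzero expectation only if the letters
are paired with their neighbours. -/
lemma IsBoolean.E_wordProd_segment {C : ℕ → NonUnitalSubring A} (h : IsBoolean D C)
    (ha : ∀ i, a i ∈ C i) (hE : ∀ i, D.E (a i) = 0) (hη : ∀ i d, η d = D.E (a i * D.ι d * a i))
    {i : ℕ → ℕ} {k : ℕ} (b : ℕ → B) (hi : ∀ p, p + 2 < k → i p = i (p + 1) → i (p + 2) ≠ i p)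
    (n l : ℕ) (hn : l + 2 * n = k) :
    ((∀ j < n, i (l + 2 * j) = i (l + 2 * j + 1)) → D.E (wordProd D.ι a (segment i b l k)) =
      ((List.range n).map fun j => η (b (l + 2 * j + 1)) * b (l + 2 * j + 2)).prod) ∧
    ((¬ ∀ j < n, i (l + 2 * j) = i (l + 2 * j + 1)) →
      D.E (wordProd D.ι a (segment i b l k)) = 0) := by
  induction n generalizing l with
  | zero =>
    obtain rfl : l = k := by omega
    simp [D.E_one]
  | succ n ih =>
    by_cases hl : i l = i (l + 1)
    · have e1 : D.E (wordProd D.ι a (segment i b l k)) =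
          η (b (l + 1)) * b (l + 2) * D.E (wordProd D.ι a (segment i b (l + 2) k)) := by
        have e := h.E_wordProd_append ha (i := i l)
          (r := [(i l, b (l + 1)), (i (l + 1), b (l + 2))]) (v := segment i b (l + 2) k) (by simp)
          (by simp [hl]) ?_
        · rw [segment_cons i b (by omega), segment_cons i b (by omega)]
          refine e.trans ?_
          congr 1
          rw [hη (i l)]
          simp [← hl, ← mul_assoc, D.E_right]
        · rcases (show l + 2 ≤ k by omega).eq_or_lt with he | hlt
          · simp [he]
          · rw [segment_cons i b hlt]
            simpa using hi l hlt hl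
      obtain ⟨ih1, ih2⟩ := ih (l + 2) (by omega)
      have hshift : ∀ j, l + 2 * (j + 1) = l + 2 + 2 * j := fun j => by ring
      have hiff : (∀ j < n + 1, i (l + 2 * j) = i (l + 2 * j + 1)) ↔
          ∀ j < n, i (l + 2 + 2 * j) = i (l + 2 + 2 * j + 1) := by
        constructor
        · intro hj j hjn
          have := hj (j + 1) (by omega)
          rwa [hshift] at this
        · intro hj j hjn
          cases j with
          | zero => simpa using hl
          | succ j =>
            rw [hshift]
            exact hj j (by omega)
      rw [hiff, e1]
      refine ⟨fun hj => ?_, fun hj => ?_⟩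
      · rw [ih1 hj, List.range_succ_eq_map, List.map_cons, List.prod_cons, List.map_map]
        simp only [Function.comp_def, Nat.succ_eq_add_one, hshift]
      · rw [ih2 hj, mul_zero]
    · refine ⟨fun hj => absurd (by simpa using hj 0 (by omega)) hl, fun _ => ?_⟩
      rw [segment_cons i b (by omega), ← List.singleton_append,
        h.E_wordProd_append ha (i := i l) (by simp) (by simp), E_wordProd_singleton hE (by simp),
        zero_mul]
      rw [segment_cons i b (by omega)]
      simpa using fun he => hl he.symm

variable [Algebra ℂ B] [TopologicalSpace B] [ContinuousAdd B] [ContinuousSMul ℂ B]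

/-! ### The free central limit theorem -/

/-- The central limit theorem for free elements. -/
theorem IsFree.tendsto_semicircle {𝒜 : ℕ → Subring A} (h : IsFree D 𝒜) (ha : ∀ i, a i ∈ 𝒜 i)
    (hE : ∀ i, D.E (a i) = 0) (hid : IsIdentical D a)
    (hη : ∀ i d, η d = D.E (a i * D.ι d * a i)) (k : ℕ) (b : ℕ → B) :
    Tendsto (fun N : ℕ => ((Real.sqrt N : ℂ)⁻¹) ^ k • D.E (D.ι (b 0) *
      ((List.range k).map fun l => (∑ i ∈ Finset.range N, a i) * D.ι (b (l + 1))).prod)) atTop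
      (𝓝 (semicircle η k b)) := by
  have hsing : ∀ (w : List (ℕ × B)) (p : ℕ), (w.map Prod.fst).count p = 1 →
      D.E (wordProd D.ι a w) = 0 := fun w p hp => h.E_wordProd_eq_zero_of_count_eq_one ha hE hp
  have := tendsto_moment (D := D) (a := a) (fun m φ hφ w =>
    (h.comp hφ.injective).E_wordProd_congr (h.comp (Fin.val_injective)) (fun i => ha _)
      (fun i => ha _) (hid.sameMarginals φ _) w) hsing k b
  convert this using 2
  rw [semicircle]
  by_cases hk : Even k
  swap
  · rw [if_neg hk, if_neg hk]
  rw [if_pos hk, if_pos hk]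
  -- there is no restriction on the enumeration of the blocks, so the relation is equality
  rw [sum_surjective_eq (fun U V => U = V) (fun σ => wordMoment D a b fun p => (σ p : ℕ))
    (fun π => etaPart η π b)]
  · rw [Finset.smul_sum]
    refine Finset.sum_congr rfl fun π hπ => ?_
    have h1 := two_mul_card_parts hπ
    rw [card_linearExtensions_eq (show π.parts.card = k / 2 by omega),
      ← Nat.cast_smul_eq_nsmul ℂ, smul_smul,
      inv_mul_cancel₀ (Nat.cast_ne_zero.2 (Nat.factorial_ne_zero _)), one_smul]
  · intro σ hs hπ
    rw [wordMoment]
    rcases wordMoment_eq_zero_or hk hsing b hs with h0 | h2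
    · rw [h0, mul_zero]
    have hnc : ¬ NonCrossing (kerPart σ) := fun hnc => hπ (mem_NC2.2 ⟨hnc, card_part_kerPart h2⟩)
    obtain ⟨s, t, hst, hsub⟩ := exists_crossing_sublist hnc
    rw [h.E_wordProd_eq_zero_of_crossing ha hE hst
      (count_posWord_le_two b fun t => (h2 t).le) (by rwa [map_fst_posWord]), mul_zero]
  · intro σ s t hs _ hst he
    obtain ⟨p, rfl⟩ := hs s
    have : p ∈ Finset.univ.filter fun q => σ q = t := by
      rw [he]
      simp
    exact absurd (by simpa using this) hst.ne
  · intro σ _ hπ _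
    refine wordMoment_eq_etaPart hπ b fun i hi l m r hb => ?_
    obtain ⟨e1, e2, e3, e4⟩ := hb.index_ne
    rw [segment_split i b hb.left_lt hb.lt_right, e1, h.E_wordProd_block ha, ← hη]
    · intro x hx
      obtain ⟨p, hp, hp', he⟩ := mem_segment hx
      exact he ▸ e2 p (by omega) hp'
    · intro x hx
      obtain ⟨p, hp, hp', he⟩ := mem_segment hx
      exact he ▸ e3 p (by omega) hp'
    · intro x hx y hy
      obtain ⟨p, hp, hp', he⟩ := mem_segment hx
      obtain ⟨q, hq, hq', he'⟩ := mem_segment hy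
      rw [he, he']
      exact e4 p q (by omega) hp' (by omega) hq'

/-! ### The monotone central limit theorem -/

/-- The central limit theorem for monotone independent elements. The moment of an index word on a
non-crossing pair partition does not vanish only if the index increases from a block
to the blocks nested inside it. -/
theorem IsMonotone.tendsto_arcsine {C : ℕ → NonUnitalSubring A} (h : IsMonotone D C)
    (ha : ∀ i, a i ∈ C i) (hE : ∀ i, D.E (a i) = 0) (hid : IsIdentical D a)
    (hη : ∀ i d, η d = D.E (a i * D.ι d * a i)) (k : ℕ) (b : ℕ → B) :
    Tendsto (fun N : ℕ => ((Real.sqrt N : ℂ)⁻¹) ^ k • D.E (D.ι (b 0) *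
      ((List.range k).map fun l => (∑ i ∈ Finset.range N, a i) * D.ι (b (l + 1))).prod)) atTop
      (𝓝 (arcsine η k b)) := by
  have hsing : ∀ (w : List (ℕ × B)) (p : ℕ), (w.map Prod.fst).count p = 1 →
      D.E (wordProd D.ι a w) = 0 := fun w p hp => h.E_wordProd_eq_zero_of_count_eq_one ha hE hp
  have := tendsto_moment (D := D) (a := a) (fun m φ hφ w =>
    (h.comp hφ).E_wordProd_congr (h.comp (Fin.val_strictMono)) (fun i => ha _)
      (fun i => ha _) (hid.sameMarginals φ _) w) hsing k b
  convert this using 2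
  rw [arcsine]
  by_cases hk : Even k
  swap
  · rw [if_neg hk, if_neg hk]
  rw [if_pos hk, if_pos hk]
  rw [sum_surjective_eq Nested (fun σ => wordMoment D a b fun p => (σ p : ℕ))
    (fun π => etaPart η π b)]
  · rw [Finset.smul_sum]
    refine Finset.sum_congr rfl fun π hπ => ?_
    rw [← card_linearExtensions_nested hπ, ← Nat.cast_smul_eq_nsmul ℂ, smul_smul]
  · intro σ hs hπ
    rw [wordMoment]
    rcases wordMoment_eq_zero_or hk hsing b hs with h0 | h2
    · rw [h0, mul_zero]
    have hnc : ¬ NonCrossing (kerPart σ) := fun hnc => hπ (mem_NC2.2 ⟨hnc, card_part_kerPart h2⟩)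
    obtain ⟨s, t, hst, hsub⟩ := exists_crossing_sublist hnc
    have hle := count_posWord_le_two b fun t => (h2 t).le
    -- one of the two subwords `s t s` and `t s t` has its smaller index in the middle
    rcases hst.lt_or_gt with hlt | hlt
    · rw [h.E_wordProd_eq_zero_of_lt ha hE hlt hle, mul_zero]
      rw [map_fst_posWord]
      exact List.Sublist.trans (by simp) hsub
    · rw [h.E_wordProd_eq_zero_of_lt ha hE hlt hle, mul_zero]
      rw [map_fst_posWord]
      exact List.Sublist.trans (by simp) hsub
  · intro σ s t hs _ hst hn
    rw [wordMoment]
    rcases wordMoment_eq_zero_or hk hsing b hs with h0 | h2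
    · rw [h0, mul_zero]
    have hle := count_posWord_le_two b fun t => (h2 t).le
    obtain ⟨y, rfl⟩ := hs s
    obtain ⟨⟨x, hx, hxy⟩, z, hz, hyz⟩ := hn y (by simp)
    simp only [Finset.mem_filter, Finset.mem_univ, true_and] at hx hz
    have hxy' : x < y := lt_of_le_of_ne hxy (by rintro rfl; exact hst.ne hx)
    have hyz' : y < z := lt_of_le_of_ne hyz (by rintro rfl; exact hst.ne hz)
    rw [h.E_wordProd_eq_zero_of_lt ha hE (p := t) (q := σ y) hst hle, mul_zero]
    rw [map_fst_posWord]
    have := map_sublist_ofFn (fun p => (σ p : ℕ)) (l := [x, y, z])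
      (by simp [hxy', hyz', hxy'.trans hyz'])
    simpa [hx, hz] using this
  · intro σ _ hπ hn
    have hnc := (mem_NC2.1 hπ).1
    -- a smaller index between two equal ones would belong to a block nested inside theirs
    have hcompat : ∀ x y z : Fin k, x < y → y < z → σ x = σ z → ¬ σ y < σ x := by
      intro x y z hxy hyz hxz hlt
      have hparts : ∀ p, (kerPart σ).part p ∈ (kerPart σ).parts :=
        fun p => (kerPart σ).part_mem.2 (Finset.mem_univ p)
      have hself : ∀ p, p ∈ (kerPart σ).part p := fun p => mem_part_kerPart.2 rfl
      have hz : z ∈ (kerPart σ).part x := mem_part_kerPart.2 hxz.symm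
      have hne : (kerPart σ).part x ≠ (kerPart σ).part y := by
        intro he
        exact hlt.ne' (mem_part_kerPart.1 (he ▸ hself x))
      refine hn (σ y) (σ x) hlt ?_
      rw [← kerPart_part, ← kerPart_part]
      intro w hw
      refine ⟨⟨x, hself x, le_of_not_gt fun hwx => ?_⟩, z, hz, le_of_not_gt fun hzw => ?_⟩
      · exact hnc _ (hparts y) _ (hparts x) hne.symm
          ⟨w, hw, x, hself x, y, hself y, z, hz, hwx, hxy, hyz⟩
      · exact hnc _ (hparts x) _ (hparts y) hne
          ⟨x, hself x, y, hself y, z, hz, w, hw, hxy, hyz, hzw⟩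
    refine wordMoment_eq_etaPart hπ b fun i hi l m r hb => ?_
    obtain ⟨e1, e2, e3, e4⟩ := hb.index_ne
    have h1 := hb.left_lt
    have h2 := hb.lt_right
    have h3 := hb.right_le
    rw [segment_split i b h1 h2, e1]
    have hsplit : ((i l, b (l + 1)) :: segment i b (l + 1) m ++
        (i l, b (m + 1)) :: segment i b (m + 1) r) =
        ((i l, b (l + 1)) :: segment i b (l + 1) m ++ [(i l, b (m + 1))]) ++
          segment i b (m + 1) r := by simp
    rw [hsplit, h.E_wordProd_append ha, h.E_wordProd_nested ha, ← hη]
    · intro x hx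
      obtain ⟨p, hp, hp', he⟩ := mem_segment hx
      rw [he]
      have := hcompat ⟨l, by omega⟩ ⟨p, by omega⟩ ⟨m, by omega⟩ (Fin.mk_lt_mk.2 (by omega))
        (Fin.mk_lt_mk.2 (by omega)) (Fin.ext (by rw [← hi, ← hi]; exact e1.symm))
      rw [Fin.lt_def, ← hi, ← hi] at this
      exact lt_of_le_of_ne (not_lt.1 this) (e2 p (by omega) hp').symm
    · intro j hj hj'
      obtain ⟨x, hx, rfl⟩ := List.mem_map.1 hj
      obtain ⟨y, hy, hxy⟩ := List.mem_map.1 hj'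
      obtain ⟨q, hq, hq', he'⟩ := mem_segment hy
      rw [he'] at hxy
      simp only [List.mem_append, List.mem_cons, List.not_mem_nil, or_false] at hx
      rcases hx with (rfl | hx) | rfl
      · exact e3 q (by omega) hq' hxy
      · obtain ⟨p, hp, hp', he⟩ := mem_segment hx
        rw [he] at hxy
        exact e4 p q (by omega) hp' (by omega) hq' hxy.symm
      · exact e3 q (by omega) hq' hxy

/-! ### The Boolean central limit theorem -/

/-- Index words whose letters are paired with their neighbours are the enumerations of the pairs. -/
lemma card_paired_words {k m : ℕ} (hk : k = 2 * m)
    [DecidablePred fun σ : Fin k → Fin m => Function.Surjective σ ∧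
      ∀ p q : Fin k, (p : ℕ) / 2 = q / 2 → σ p = σ q] :
    (Finset.univ.filter fun σ : Fin k → Fin m => Function.Surjective σ ∧
      ∀ p q : Fin k, (p : ℕ) / 2 = q / 2 → σ p = σ q).card = m.factorial := by
  classical
  have hcard : (Finset.univ : Finset (Equiv.Perm (Fin m))).card = m.factorial := by
    rw [Finset.card_univ, Fintype.card_perm, Fintype.card_fin]
  rw [← hcard]
  symm
  refine Finset.card_bij (fun τ _ p => τ ⟨p / 2, by omega⟩) ?_ ?_ ?_
  · intro τ _
    simp only [Finset.mem_filter, Finset.mem_univ, true_and]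
    refine ⟨fun t => ⟨⟨2 * (τ.symm t), by omega⟩, ?_⟩, fun p q hpq => ?_⟩
    · simp
    · simp only [hpq]
  · intro τ _ τ' _ he
    ext t
    have := congrFun he ⟨2 * t, by omega⟩
    simpa using congrArg Fin.val this
  · intro σ hσ
    simp only [Finset.mem_filter, Finset.mem_univ, true_and] at hσ
    obtain ⟨hs, hp⟩ := hσ
    have hsurj : Function.Surjective fun t : Fin m => σ ⟨2 * t, by omega⟩ := by
      intro t
      obtain ⟨p, rfl⟩ := hs t
      exact ⟨⟨p / 2, by omega⟩, hp _ _ (by simp)⟩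
    refine ⟨Equiv.ofBijective _ (Finite.surjective_iff_bijective.1 hsurj), Finset.mem_univ _, ?_⟩
    funext p
    exact hp _ _ (by simp)

/-- The central limit theorem for Boolean independent elements. -/
theorem IsBoolean.tendsto_bernoulli {C : ℕ → NonUnitalSubring A} (h : IsBoolean D C)
    (ha : ∀ i, a i ∈ C i) (hE : ∀ i, D.E (a i) = 0) (hid : IsIdentical D a)
    (hη : ∀ i d, η d = D.E (a i * D.ι d * a i)) (k : ℕ) (b : ℕ → B) :
    Tendsto (fun N : ℕ => ((Real.sqrt N : ℂ)⁻¹) ^ k • D.E (D.ι (b 0) *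
      ((List.range k).map fun l => (∑ i ∈ Finset.range N, a i) * D.ι (b (l + 1))).prod)) atTop
      (𝓝 (bernoulli η k b)) := by
  classical
  have hsing : ∀ (w : List (ℕ × B)) (p : ℕ), (w.map Prod.fst).count p = 1 →
      D.E (wordProd D.ι a w) = 0 := fun w p hp => h.E_wordProd_eq_zero_of_count_eq_one ha hE hp
  have := tendsto_moment (D := D) (a := a) (fun m φ hφ w =>
    (h.comp hφ.injective).E_wordProd_congr (h.comp (Fin.val_injective)) (fun i => ha _)
      (fun i => ha _) (hid.sameMarginals φ _) w) hsing k b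
  convert this using 2
  rw [bernoulli]
  by_cases hk : Even k
  swap
  · rw [if_neg hk, if_neg hk]
  rw [if_pos hk, if_pos hk]
  have hk2 : 2 * (k / 2) = k := Nat.two_mul_div_two_of_even hk
  have key : ∀ σ : Fin k → Fin (k / 2), Function.Surjective σ →
      wordMoment D a b (fun p => (σ p : ℕ)) =
        if ∀ p q : Fin k, (p : ℕ) / 2 = q / 2 → σ p = σ q then
          altProd (fun _ => η) b (k / 2) else 0 := by
    intro σ hs
    by_cases h2 : ∀ t, (Finset.univ.filter fun p => σ p = t).card = 2
    · obtain ⟨i, hi⟩ := exists_nat_extension fun p => (σ p : ℕ)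
      have hval := h.E_wordProd_segment ha hE hη (i := i) (k := k) b (fun p hp he he' => by
        have : ({⟨p, by omega⟩, ⟨p + 1, by omega⟩, ⟨p + 2, by omega⟩} : Finset (Fin k)) ⊆
            Finset.univ.filter fun q => σ q = σ ⟨p, by omega⟩ := by
          intro x hx
          simp only [Finset.mem_insert, Finset.mem_singleton] at hx
          simp only [Finset.mem_filter, Finset.mem_univ, true_and]
          rw [Fin.ext_iff, ← hi, ← hi]
          rcases hx with rfl | rfl | rfl
          exacts [rfl, he.symm, he']
        have := Finset.card_le_card this
        rw [h2, Finset.card_eq_three.2 ⟨_, _, _, by simp, by simp, by simp, rfl⟩] at this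
        omega) (k / 2) 0 (by omega)
      have hiff : (∀ j < k / 2, i (0 + 2 * j) = i (0 + 2 * j + 1)) ↔
          ∀ p q : Fin k, (p : ℕ) / 2 = q / 2 → σ p = σ q := by
        constructor
        · intro hj p q hpq
          rw [Fin.ext_iff, ← hi, ← hi]
          have := hj (p / 2) (by omega)
          rw [zero_add] at this
          have hp : (p : ℕ) = 2 * (p / 2) ∨ (p : ℕ) = 2 * (p / 2) + 1 := by omega
          have hq : (q : ℕ) = 2 * (p / 2) ∨ (q : ℕ) = 2 * (p / 2) + 1 := by omega
          rcases hp with hp | hp <;> rcases hq with hq | hq <;> rw [hp, hq]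
          exacts [by omega, by omega]
        · intro hp j hj
          have := hp ⟨0 + 2 * j, by omega⟩ ⟨0 + 2 * j + 1, by omega⟩ (by simp; omega)
          rw [Fin.ext_iff, ← hi, ← hi] at this
          exact this
      rw [hiff, segment_univ] at hval
      simp only [hi] at hval
      rw [wordMoment]
      split_ifs with hp
      · rw [hval.1 hp, altProd]
        simp only [zero_add]
      · rw [hval.2 hp, mul_zero]
    · rcases wordMoment_eq_zero_or hk hsing b hs with h0 | h0
      swap
      · exact absurd h0 h2
      rw [wordMoment, h0, mul_zero, if_neg]
      intro hp
      refine h2 (card_fiber_eq_two hk hs ?_)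
      -- no position is alone in its pair
      rintro ⟨p, hpu⟩
      have h1 := hpu ⟨if (p : ℕ) % 2 = 0 then p + 1 else p - 1, by split_ifs <;> omega⟩
        (hp _ _ (by simp only; split_ifs <;> omega))
      rw [Fin.ext_iff] at h1
      simp only at h1
      split_ifs at h1 <;> omega
  rw [Finset.sum_congr rfl fun σ hσ => key σ (Finset.mem_filter.1 hσ).2, ← Finset.sum_filter,
    Finset.filter_filter, Finset.sum_const, card_paired_words hk2.symm,
    ← Nat.cast_smul_eq_nsmul ℂ, smul_smul,
    inv_mul_cancel₀ (Nat.cast_ne_zero.2 (Nat.factorial_ne_zero _)), one_smul]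

end LimitTheorems

/-! ### Dual numbers -/

section Dual

open TrivSqZeroExt

section oprod

variable {R : Type*} [Ring R]

lemma oprod_succ {n : ℕ} (x : Fin (n + 1) → R) : oprod x = x 0 * oprod fun j => x j.succ := by
  simp [oprod, List.ofFn_succ]

lemma oprod_update_add {n : ℕ} (x : Fin n → R) (j : Fin n) (u v : R) :
    oprod (Function.update x j (u + v)) =
      oprod (Function.update x j u) + oprod (Function.update x j v) := by
  have := (MultilinearMap.mkPiAlgebraFin ℤ n R).map_update_add x j u v
  simpa only [oprod, MultilinearMap.mkPiAlgebraFin_apply] using this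

lemma fst_oprod {n : ℕ} (x : Fin n → TrivSqZeroExt R R) :
    (oprod x).fst = oprod fun j => (x j).fst := by
  induction n with
  | zero => simp [oprod]
  | succ n ih => rw [oprod_succ, oprod_succ, fst_mul, ih]

/-- The product rule. -/
lemma snd_oprod {n : ℕ} (x : Fin n → TrivSqZeroExt R R) :
    (oprod x).snd = ∑ j, oprod (Function.update (fun l => (x l).fst) j (x j).snd) := by
  induction n with
  | zero => simp [oprod]
  | succ n ih =>
    rw [oprod_succ, snd_mul, ih, fst_oprod, Fin.sum_univ_succ, oprod_succ, add_comm]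
    simp only [Function.update_self, MulOpposite.smul_eq_mul_unop, MulOpposite.unop_op,
      smul_eq_mul, Finset.mul_sum]
    congr 1
    refine Finset.sum_congr rfl fun j _ => ?_
    rw [oprod_succ, Function.update_of_ne (Fin.succ_ne_zero j).symm]
    congr 2
    funext l
    by_cases h : l = j
    · subst h
      simp
    · rw [Function.update_of_ne h, Function.update_of_ne fun h' => h (Fin.succ_injective _ h')]

lemma prod_map_eq_oprod {α : Type*} (L : List α) (f : α → R) :
    (L.map f).prod = oprod fun j : Fin L.length => f (L.get j) := by
  simp [oprod, List.ofFn_getElem_eq_map]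

lemma oprod_update_get {α : Type*} (U V : List α) (x : α) (f : α → R) (y : R)
    (h : U.length < (U ++ x :: V).length) :
    oprod (Function.update (fun j : Fin (U ++ x :: V).length => f ((U ++ x :: V).get j))
      ⟨U.length, h⟩ y) = (U.map f).prod * y * (V.map f).prod := by
  have : List.ofFn (Function.update (fun j : Fin (U ++ x :: V).length => f ((U ++ x :: V).get j))
      ⟨U.length, h⟩ y) = U.map f ++ y :: V.map f := by
    refine List.ext_getElem (by simp [add_assoc]) fun n h₁ h₂ => ?_
    rw [List.getElem_ofFn, Function.update_apply]
    simp only [Fin.mk.injEq, List.get_eq_getElem]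
    split_ifs with hn
    · subst hn
      simp
    · rcases Nat.lt_or_gt_of_ne hn with hn | hn
      · rw [List.getElem_append_left hn, List.getElem_append_left (by simpa using hn)]
        simp
      · rw [List.getElem_append_right hn.le, List.getElem_append_right (by simpa using hn.le)]
        obtain ⟨c, rfl⟩ : ∃ c, n = U.length + (c + 1) := ⟨n - U.length - 1, by omega⟩
        simp
  rw [oprod, this]
  simp [mul_assoc]

end oprod

variable {A : Type*} [Ring A] [Algebra ℂ A] {B : Subalgebra ℂ A}

namespace Space

variable (P : Space A B)

lemma E_left (b : B) (a : A) : P.E (b * a) = b * P.E a := by simpa using P.E_bimodule b 1 a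

lemma E_right (b : B) (a : A) : P.E (a * b) = P.E a * b := by simpa using P.E_bimodule 1 b a

lemma E'_left (b : B) (a : A) : P.E' (b * a) = b * P.E' a := by simpa using P.E'_bimodule b 1 a

lemma E'_right (b : B) (a : A) : P.E' (a * b) = P.E' a * b := by simpa using P.E'_bimodule 1 b a

lemma E'_coe (b : B) : P.E' b = 0 := by simpa [P.E'_one] using P.E'_bimodule b 1 1

/-- The expectation `x + ε x' ↦ E x + ε (E' x + E x')` on the dual numbers over `A`. -/
def dual : CondExp (TrivSqZeroExt A A) (TrivSqZeroExt B B) where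
  ι :=
    { toFun := fun x => inl (x.fst : A) + inr (x.snd : A)
      map_one' := by ext <;> simp
      map_mul' := fun x y => by ext <;> simp
      map_zero' := by ext <;> simp
      map_add' := fun x y => by ext <;> simp }
  E :=
    { toFun := fun x => inl (P.E x.fst) + inr (P.E' x.fst + P.E x.snd)
      map_zero' := by ext <;> simp
      map_add' := fun x y => by
        ext
        · simp
        · simp
          abel }
  E_ι b := by
    ext
    · simp [P.E_coe]
    · simp [P.E_coe, P.E'_coe]
  E_bimodule b b' x := by
    ext
    · simp [P.E_bimodule]
    · simp [P.E_left, P.E_right, P.E'_left, P.E'_right, mul_add, add_mul, mul_assoc]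
      abel

@[simp] lemma fst_dual_ι (x : TrivSqZeroExt B B) : (P.dual.ι x).fst = x.fst := by
  simp [dual]

@[simp] lemma snd_dual_ι (x : TrivSqZeroExt B B) : (P.dual.ι x).snd = x.snd := by
  simp [dual]

@[simp] lemma fst_dual_E (x : TrivSqZeroExt A A) : (P.dual.E x).fst = P.E x.fst := by
  simp [dual]

@[simp] lemma snd_dual_E (x : TrivSqZeroExt A A) :
    (P.dual.E x).snd = P.E' x.fst + P.E x.snd := by
  simp [dual]

end Space

/-- The dual numbers over a subring. -/
def dualSubring (S : Subring A) : Subring (TrivSqZeroExt A A) where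
  carrier := {x | x.fst ∈ S ∧ x.snd ∈ S}
  mul_mem' hx hy := ⟨by simpa using S.mul_mem hx.1 hy.1,
    by simpa using S.add_mem (S.mul_mem hx.1 hy.2) (S.mul_mem hx.2 hy.1)⟩
  one_mem' := ⟨by simp, by simp⟩
  add_mem' hx hy := ⟨by simpa using S.add_mem hx.1 hy.1, by simpa using S.add_mem hx.2 hy.2⟩
  zero_mem' := ⟨by simp, by simp⟩
  neg_mem' hx := ⟨by simpa using S.neg_mem hx.1, by simpa using S.neg_mem hx.2⟩

/-- The dual numbers over a nonunital subring. -/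
def dualNonUnitalSubring (S : NonUnitalSubring A) : NonUnitalSubring (TrivSqZeroExt A A) where
  carrier := {x | x.fst ∈ S ∧ x.snd ∈ S}
  mul_mem' hx hy := ⟨by simpa using S.mul_mem hx.1 hy.1,
    by simpa using S.add_mem (S.mul_mem hx.1 hy.2) (S.mul_mem hx.2 hy.1)⟩
  add_mem' hx hy := ⟨by simpa using S.add_mem hx.1 hy.1, by simpa using S.add_mem hx.2 hy.2⟩
  zero_mem' := ⟨by simp, by simp⟩
  neg_mem' hx := ⟨by simpa using S.neg_mem hx.1, by simpa using S.neg_mem hx.2⟩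

lemma alternating_get {I α : Type*} {L : List (I × α)} (h : (L.map Prod.fst).IsChain (· ≠ ·)) :
    Alternating fun j : Fin L.length => (L.get j).1 := by
  intro j l hjl
  rw [List.isChain_iff_getElem] at h
  have := h j (by have := l.2; simp; omega)
  simpa [hjl] using this

variable {P : Space A B} {I : Type*}

/-- Infinitesimal freeness is freeness over the dual numbers. -/
lemma InfFreeAlgebras.dual {𝒜 : I → Subalgebra ℂ A} (h : InfFreeAlgebras P 𝒜) :
    IsFree P.dual fun i => dualSubring (𝒜 i).toSubring := by
  refine ⟨fun i b => ⟨by simpa using h.1 i b.fst.2, by simpa using h.1 i b.snd.2⟩,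
    fun L hL hc => ?_⟩
  have hlen : 1 ≤ L.length := List.length_pos_iff.2 hL
  have halt := alternating_get hc.1
  have hmem : ∀ j, ((L.get j).2.fst ∈ 𝒜 (L.get j).1 ∧ (L.get j).2.snd ∈ 𝒜 (L.get j).1) ∧
      P.dual.E (L.get j).2 = 0 := fun j => hc.2 _ (L.get_mem j)
  have hE : ∀ j, P.E (L.get j).2.fst = 0 := fun j => by
    simpa using congrArg fst (hmem j).2
  have hE' : ∀ j, P.E' (L.get j).2.fst + P.E (L.get j).2.snd = 0 := fun j => by
    simpa using congrArg snd (hmem j).2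
  obtain ⟨h1, h2⟩ := h.2 _ _ (fun j => (L.get j).2.fst) hlen halt (fun j => (hmem j).1.1) hE
  rw [prod_map_eq_oprod]
  ext
  · rw [Space.fst_dual_E, fst_oprod, h1]
    rfl
  · rw [Space.snd_dual_E, fst_oprod, snd_oprod, h2, map_sum, ← Finset.sum_add_distrib]
    refine congrArg _ (Finset.sum_eq_zero fun j _ => ?_)
    -- the two terms for `x_j + ε x_j'` add up to the word with `E' x_j + x_j'` in place of `x_j`,
    -- and this letter is centered
    rw [← map_add, ← oprod_update_add]
    refine (h.2 _ _ _ hlen halt (fun l => ?_) fun l => ?_).1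
    · by_cases hl : l = j
      · subst hl
        rw [Function.update_self]
        exact (𝒜 _).add_mem (h.1 _ (P.E' _).2) (hmem l).1.2
      · rw [Function.update_of_ne hl]
        exact (hmem l).1.1
    · by_cases hl : l = j
      · subst hl
        rw [Function.update_self, map_add, P.E_coe, hE']
      · rw [Function.update_of_ne hl, hE]

/-- Infinitesimal Boolean independence is Boolean independence over the dual numbers. -/
lemma InfBooleanAlgebras.dual {𝒜 : I → NonUnitalSubalgebra ℂ A} (h : InfBooleanAlgebras P 𝒜) :
    IsBoolean P.dual fun i => dualNonUnitalSubring (𝒜 i).toNonUnitalSubring := by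
  refine ⟨fun i b x hx => ⟨⟨?_, ?_⟩, ⟨?_, ?_⟩⟩, fun L hL hc => ?_⟩
  · simpa using (h.1 i _ b.fst hx.1).1
  · simpa using (𝒜 i).add_mem (h.1 i _ b.fst hx.2).1 (h.1 i _ b.snd hx.1).1
  · simpa using (h.1 i _ b.fst hx.1).2
  · simpa using (𝒜 i).add_mem (h.1 i _ b.snd hx.1).2 (h.1 i _ b.fst hx.2).2
  rcases eq_or_ne L [] with rfl | hne
  · simp [P.dual.E_one]
  have hlen : 1 ≤ L.length := List.length_pos_iff.2 hne
  have halt := alternating_get hL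
  have hmem : ∀ j, (L.get j).2.fst ∈ 𝒜 (L.get j).1 ∧ (L.get j).2.snd ∈ 𝒜 (L.get j).1 :=
    fun j => hc _ (L.get_mem j)
  obtain ⟨h1, h2⟩ := h.2 _ _ (fun j => (L.get j).2.fst) hlen halt (fun j => (hmem j).1)
  rw [prod_map_eq_oprod, prod_map_eq_oprod]
  ext1
  · rw [Space.fst_dual_E, fst_oprod, h1, fst_oprod]
    simp only [Space.fst_dual_E]
  · rw [Space.snd_dual_E, fst_oprod, snd_oprod, h2, map_sum, ← Finset.sum_add_distrib, snd_oprod]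
    refine Finset.sum_congr rfl fun j _ => ?_
    rw [Space.snd_dual_E, oprod_update_add]
    simp only [Space.fst_dual_E]
    congr 1
    rw [(h.2 _ _ _ hlen halt fun l => ?_).1]
    · congr 1
      funext l
      by_cases hl : l = j
      · subst hl
        simp
      · simp [Function.update_of_ne hl]
    · by_cases hl : l = j
      · subst hl
        rw [Function.update_self]
        exact (hmem l).2
      · rw [Function.update_of_ne hl]
        exact (hmem l).1

/-- Infinitesimal monotone independence is monotone independence over the dual numbers. -/
lemma InfMonotoneAlgebras.dual [LinearOrder I] {𝒜 : I → NonUnitalSubalgebra ℂ A}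
    (h : InfMonotoneAlgebras P 𝒜) :
    IsMonotone P.dual fun i => dualNonUnitalSubring (𝒜 i).toNonUnitalSubring := by
  refine ⟨fun i b x hx => ⟨⟨?_, ?_⟩, ⟨?_, ?_⟩⟩, fun U V i x hU hV hx hUl hVh => ?_⟩
  · simpa using (h.1 i _ b.fst hx.1).1
  · simpa using (𝒜 i).add_mem (h.1 i _ b.fst hx.2).1 (h.1 i _ b.snd hx.1).1
  · simpa using (h.1 i _ b.fst hx.1).2
  · simpa using (𝒜 i).add_mem (h.1 i _ b.snd hx.1).2 (h.1 i _ b.fst hx.2).2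
  set L := U ++ (i, x) :: V with hLdef
  have hlt : U.length < L.length := by simp [hLdef]
  set j : Fin L.length := ⟨U.length, hlt⟩ with hj
  have hmem : ∀ l, (L.get l).2.fst ∈ 𝒜 (L.get l).1 ∧ (L.get l).2.snd ∈ 𝒜 (L.get l).1 := by
    intro l
    have hl : L.get l ∈ U ++ (i, x) :: V := L.get_mem l
    rw [List.mem_append, List.mem_cons] at hl
    rcases hl with hl | hl | hl
    · exact hU _ hl
    · have e : L.get l = (i, x) := hl
      rw [e]
      exact hx
    · exact hV _ hl
  have hjx : L.get j = (i, x) := by simp [hLdef, hj]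
  have hpeak : IsPeak (fun l => (L.get l).1) j := by
    intro l hl
    simp only [hjx]
    rcases hl with hl | hl
    · refine hUl (L.get l) ?_
      have hlU : (l : ℕ) < U.length := by simp [hj] at hl; omega
      rw [List.getLast?_eq_getElem?, Option.mem_def, List.getElem?_eq_some_iff]
      refine ⟨by omega, ?_⟩
      have e : U.length - 1 = l := by simp [hj] at hl; omega
      simp [hLdef, e, List.getElem_append_left hlU]
    · refine hVh (L.get l) ?_
      have e : (l : ℕ) = U.length + 1 := by simpa [hj] using hl
      have hl2 := l.2
      simp only [hLdef, List.length_append, List.length_cons] at hl2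
      rw [List.head?_eq_getElem?, Option.mem_def, List.getElem?_eq_some_iff]
      refine ⟨by omega, ?_⟩
      simp [hLdef, e]
  have key : ∀ y : Fin L.length → A, (∀ l, y l ∈ 𝒜 (L.get l).1) →
      P.E (oprod y) = P.E (oprod (Function.update y j (P.E (y j) : A))) :=
    fun y hy => (h.2 _ _ y j hpeak hy).1
  set X : Fin L.length → TrivSqZeroExt A A := fun l => (L.get l).2 with hX
  -- independence applies to each summand of the product rule; in those that differentiate another
  -- letter the peak keeps its place
  have hgoal : P.dual.E (oprod X) =
      P.dual.E (oprod (Function.update X j (P.dual.ι (P.dual.E (X j))))) := by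
    have hfst : (fun l => (Function.update X j (P.dual.ι (P.dual.E (X j))) l).fst) =
        Function.update (fun l => (X l).fst) j (P.E (X j).fst : A) := by
      funext l
      by_cases hl : l = j
      · subst hl
        simp
      · simp [Function.update_of_ne hl]
    ext1
    · rw [Space.fst_dual_E, Space.fst_dual_E, fst_oprod, fst_oprod, hfst]
      exact key _ fun l => (hmem l).1
    · rw [Space.snd_dual_E, Space.snd_dual_E, fst_oprod, fst_oprod, hfst, snd_oprod, snd_oprod,
        hfst, (h.2 _ _ (fun l => (X l).fst) j hpeak fun l => (hmem l).1).2,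
        add_comm (P.E _) (P.E' _), add_assoc, map_sum, map_sum]
      congr 1
      rw [← Finset.add_sum_erase _ _ (Finset.mem_univ j),
        ← Finset.add_sum_erase _ (fun l => P.E (oprod (Function.update
          (Function.update (fun l => (X l).fst) j (P.E (X j).fst : A)) l _)))
          (Finset.mem_univ j), ← add_assoc]
      congr 1
      · rw [Function.update_self, Function.update_idem, Space.snd_dual_ι, Space.snd_dual_E,
          Subalgebra.coe_add, oprod_update_add, map_add]
        congr 1
        rw [key _ fun l => ?_]
        · rw [Function.update_self, Function.update_idem]
        · by_cases hl : l = j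
          · subst hl
            rw [Function.update_self]
            exact (hmem _).2
          · rw [Function.update_of_ne hl]
            exact (hmem l).1
      · refine Finset.sum_congr rfl fun l hl => ?_
        have hlj := Finset.ne_of_mem_erase hl
        rw [Function.update_of_ne hlj, key _ fun t => ?_]
        · rw [Function.update_of_ne hlj.symm, Function.update_comm hlj]
        · by_cases ht : t = l
          · subst ht
            rw [Function.update_self]
            exact (hmem _).2
          · rw [Function.update_of_ne ht]
            exact (hmem t).1
  have e1 : oprod X = (U.map Prod.snd).prod * x * (V.map Prod.snd).prod := by
    have := prod_map_eq_oprod L Prod.snd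
    rw [← this, hLdef]
    simp [mul_assoc]
  have e2 := oprod_update_get U V (i, x) Prod.snd (P.dual.ι (P.dual.E x)) hlt
  rw [← e1, ← e2, hgoal]
  have : X j = x := by rw [hX]; simp only [hjx]
  rw [this]

/-- The `ε`-part of a moment with coefficients `b + ε b'` is, besides the infinitesimal moment, the
sum of the moments in which one `b` is replaced by `b'`. -/
lemma IdentDistributed.dual {a : I → A} (h : IdentDistributed P a) :
    IsIdentical P.dual fun i => (inl (a i) : TrivSqZeroExt A A) := by
  intro i j l
  have key : ∀ i, inl (a i) * (l.map fun b => P.dual.ι b * inl (a i)).prod =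
      (inl (a i * oprod fun t : Fin l.length => ((l.get t).fst : A) * a i) +
        inr (∑ s, a i * oprod fun t : Fin l.length =>
          (Function.update (fun t => (l.get t).fst) s (l.get s).snd t : A) * a i) :
        TrivSqZeroExt A A) := by
    intro i
    rw [prod_map_eq_oprod]
    ext1
    · rw [fst_mul, fst_oprod]
      simp
    · rw [snd_mul, snd_oprod, Finset.smul_sum]
      simp only [fst_inl, snd_inl, smul_zero, add_zero, smul_eq_mul, snd_add, snd_inr, zero_add]
      refine Finset.sum_congr rfl fun s _ => ?_
      congr 2
      funext t
      by_cases ht : t = s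
      · subst ht
        simp
      · simp [Function.update_of_ne ht]
  rw [key, key]
  ext1
  · simpa using (h i j _ fun t => (l.get t).fst).1
  · rw [Space.snd_dual_E, Space.snd_dual_E]
    simp only [fst_add, fst_inl, fst_inr, add_zero, snd_add, snd_inl, snd_inr, zero_add, map_sum]
    rw [(h i j _ fun t => (l.get t).fst).2]
    congr 1
    exact Finset.sum_congr rfl fun s _ => (h i j _ _).1

end Dual

/-! ### The laws over the dual numbers -/

section Laws

open TrivSqZeroExt

variable {R : Type*} [Ring R]

lemma semicircle_dualMap (η : R →+ R) (η' : R → R) (k : ℕ) (b : ℕ → R) :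
    semicircle (dualMap η η') k (fun n => inl (b n)) =
      inl (semicircle η k b) + inr (infSemicircle η η' k b) := by
  unfold semicircle infSemicircle
  split_ifs with hk
  · rw [Finset.sum_congr rfl fun π hπ => etaPart_dualMap hπ η η' b]
    rw [Finset.sum_add_distrib, inl_sum, inr_sum]
  · ext <;> simp

lemma bernoulli_dualMap (η : R →+ R) (η' : R → R) (k : ℕ) (b : ℕ → R) :
    bernoulli (dualMap η η') k (fun n => inl (b n)) =
      inl (bernoulli η k b) + inr (infBernoulli η η' k b) := by
  unfold bernoulli infBernoulli
  split_ifs with hk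
  · rw [altProd_dualMap]
  · ext <;> simp

lemma arcsine_dualMap [Algebra ℂ R] (η : R →+ R) (η' : R → R) (k : ℕ) (b : ℕ → R) :
    arcsine (dualMap η η') k (fun n => inl (b n)) =
      inl (arcsine η k b) + inr (infArcsine η η' k b) := by
  unfold arcsine infArcsine
  split_ifs with hk
  · rw [Finset.sum_congr rfl fun π hπ => by rw [etaPart_dualMap hπ η η' b]]
    simp only [smul_add, Finset.sum_add_distrib, inl_sum, inr_sum, inl_smul, inr_smul]
  · ext <;> simp

end Laws

section Transfer

open TrivSqZeroExt

variable {A : Type*} [Ring A] [Algebra ℂ A] {B : Subalgebra ℂ A} {P : Space A B}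

lemma word_smul (c : ℂ) (s : A) (k : ℕ) (b : ℕ → B) :
    word (c • s) k b = c ^ k • word s k b := by
  have : ((List.range k).map fun l => c • s * (b (l + 1) : A)).prod =
      c ^ k • ((List.range k).map fun l => s * (b (l + 1) : A)).prod := by
    induction k with
    | zero => simp
    | succ k ih =>
      rw [List.range_succ, List.map_append, List.prod_append, ih, List.map_append,
        List.prod_append, pow_succ]
      simp [smul_smul, mul_comm]
  rw [word, this, mul_smul_comm, word]

lemma dual_word (a : ℕ → A) (k N : ℕ) (b : ℕ → B) :
    P.dual.ι (inl (b 0)) * ((List.range k).map fun l =>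
      (∑ i ∈ Finset.range N, (inl (a i) : TrivSqZeroExt A A)) *
        P.dual.ι (inl (b (l + 1)))).prod = inl (word (∑ i ∈ Finset.range N, a i) k b) := by
  have h1 : ∀ c : B, P.dual.ι (inl c) = inl (c : A) := fun c => by ext <;> simp
  have h2 : ∑ i ∈ Finset.range N, (inl (a i) : TrivSqZeroExt A A) =
      inl (∑ i ∈ Finset.range N, a i) := (inl_sum _ _ _).symm
  rw [word, inl_mul, ← inlHom_apply A A ((List.map _ _).prod), map_list_prod, List.map_map]
  simp only [h1, h2, Function.comp_def, inlHom_apply, inl_mul]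


section Letters

variable {a : ℕ → A} {η : B →+ B} {η' : B → B}

lemma dual_E_eq_zero (hE : ∀ i, P.E (a i) = 0) (hE' : ∀ i, P.E' (a i) = 0) (i : ℕ) :
    P.dual.E (inl (a i)) = 0 := by
  ext <;> simp [hE, hE']

lemma dualMap_variance (hη : ∀ i b, η b = P.E (a i * (b : A) * a i))
    (hη' : ∀ i b, η' b = P.E' (a i * (b : A) * a i)) (i : ℕ) (d : TrivSqZeroExt B B) :
    dualMap η η' d = P.dual.E (inl (a i) * P.dual.ι d * inl (a i)) := by
  ext <;> simp [dualMap, hη i, hη' i]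

lemma inl_mem_dualNonUnitalSubring (a : A) : (inl a : TrivSqZeroExt A A) ∈
    dualNonUnitalSubring (nonUnitalAlg B a).toNonUnitalSubring :=
  ⟨NonUnitalAlgebra.subset_adjoin ℂ ⟨1, 1, by simp⟩,
    zero_mem (nonUnitalAlg B a).toNonUnitalSubring⟩

lemma inl_mem_dualSubring (a : A) : (inl a : TrivSqZeroExt A A) ∈
    dualSubring (unitalAlg B a).toSubring :=
  ⟨Algebra.subset_adjoin (Set.mem_insert _ _), zero_mem (unitalAlg B a).toSubring⟩

end Letters

/-- A limit theorem over the dual numbers contains the limits of the moments and of the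
infinitesimal moments. -/
lemma tendsto_of_dual [TopologicalSpace B] {a : ℕ → A} {k : ℕ} {b : ℕ → B} {x y : B}
    (h : Tendsto (fun N : ℕ => ((Real.sqrt N : ℂ)⁻¹) ^ k • P.dual.E (P.dual.ι (inl (b 0)) *
      ((List.range k).map fun l => (∑ i ∈ Finset.range N, (inl (a i) : TrivSqZeroExt A A)) *
        P.dual.ι (inl (b (l + 1)))).prod)) atTop (𝓝 (inl x + inr y))) :
    Tendsto (fun N : ℕ => P.E (word (normalizedSum a N) k b)) atTop (𝓝 x) ∧
      Tendsto (fun N : ℕ => P.E' (word (normalizedSum a N) k b)) atTop (𝓝 y) := by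
  simp only [dual_word] at h
  have h1 := (TrivSqZeroExt.continuous_fst.tendsto _).comp h
  have h2 := (TrivSqZeroExt.continuous_snd.tendsto _).comp h
  simp only [Function.comp_def, fst_smul, snd_smul, Space.fst_dual_E, Space.snd_dual_E, fst_inl,
    snd_inl, map_zero, add_zero, fst_add, snd_add, fst_inr, snd_inr, zero_add] at h1 h2
  simp only [normalizedSum, word_smul, map_smul]
  exact ⟨h1, h2⟩

section CentralLimit

variable [TopologicalSpace B] [ContinuousAdd B] [ContinuousSMul ℂ B]
  {a : ℕ → A} {η : B →+ B} {η' : B → B}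

/-- The central limit theorem for infinitesimally free elements, for any topology on `B`
compatible with its linear structure. -/
theorem InfFree.tendsto (h : InfFree P a) (hE : ∀ i, P.E (a i) = 0) (hE' : ∀ i, P.E' (a i) = 0)
    (hid : IdentDistributed P a) (hη : ∀ i b, η b = P.E (a i * (b : A) * a i))
    (hη' : ∀ i b, η' b = P.E' (a i * (b : A) * a i)) (k : ℕ) (b : ℕ → B) :
    Tendsto (fun N : ℕ => P.E (word (normalizedSum a N) k b)) atTop (𝓝 (semicircle η k b)) ∧
      Tendsto (fun N : ℕ => P.E' (word (normalizedSum a N) k b)) atTop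
        (𝓝 (infSemicircle η η' k b)) := by
  refine tendsto_of_dual ?_
  rw [← semicircle_dualMap]
  have hf : IsFree P.dual fun i => dualSubring (unitalAlg B (a i)).toSubring :=
    InfFreeAlgebras.dual (𝒜 := fun i => unitalAlg B (a i)) h
  have hid' : IsIdentical P.dual fun i => (inl (a i) : TrivSqZeroExt A A) := hid.dual
  exact hf.tendsto_semicircle (fun i => inl_mem_dualSubring (B := B) (a i))
    (dual_E_eq_zero hE hE') hid' (dualMap_variance hη hη') k (fun n => inl (b n))

/-- The central limit theorem for infinitesimally Boolean independent elements. -/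
theorem InfBoolean.tendsto (h : InfBoolean P a) (hE : ∀ i, P.E (a i) = 0)
    (hE' : ∀ i, P.E' (a i) = 0) (hid : IdentDistributed P a)
    (hη : ∀ i b, η b = P.E (a i * (b : A) * a i))
    (hη' : ∀ i b, η' b = P.E' (a i * (b : A) * a i)) (k : ℕ) (b : ℕ → B) :
    Tendsto (fun N : ℕ => P.E (word (normalizedSum a N) k b)) atTop (𝓝 (bernoulli η k b)) ∧
      Tendsto (fun N : ℕ => P.E' (word (normalizedSum a N) k b)) atTop
        (𝓝 (infBernoulli η η' k b)) := by
  refine tendsto_of_dual ?_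
  rw [← bernoulli_dualMap]
  have hf : IsBoolean P.dual fun i =>
      dualNonUnitalSubring (nonUnitalAlg B (a i)).toNonUnitalSubring :=
    InfBooleanAlgebras.dual (𝒜 := fun i => nonUnitalAlg B (a i)) h
  have hid' : IsIdentical P.dual fun i => (inl (a i) : TrivSqZeroExt A A) := hid.dual
  exact hf.tendsto_bernoulli (fun i => inl_mem_dualNonUnitalSubring (B := B) (a i))
    (dual_E_eq_zero hE hE') hid' (dualMap_variance hη hη') k (fun n => inl (b n))

/-- The central limit theorem for infinitesimally monotone independent elements. -/
theorem InfMonotone.tendsto (h : InfMonotone P a) (hE : ∀ i, P.E (a i) = 0)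
    (hE' : ∀ i, P.E' (a i) = 0) (hid : IdentDistributed P a)
    (hη : ∀ i b, η b = P.E (a i * (b : A) * a i))
    (hη' : ∀ i b, η' b = P.E' (a i * (b : A) * a i)) (k : ℕ) (b : ℕ → B) :
    Tendsto (fun N : ℕ => P.E (word (normalizedSum a N) k b)) atTop (𝓝 (arcsine η k b)) ∧
      Tendsto (fun N : ℕ => P.E' (word (normalizedSum a N) k b)) atTop
        (𝓝 (infArcsine η η' k b)) := by
  refine tendsto_of_dual ?_
  rw [← arcsine_dualMap]
  have hf : IsMonotone P.dual fun i =>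
      dualNonUnitalSubring (nonUnitalAlg B (a i)).toNonUnitalSubring :=
    InfMonotoneAlgebras.dual (𝒜 := fun i => nonUnitalAlg B (a i)) h
  have hid' : IsIdentical P.dual fun i => (inl (a i) : TrivSqZeroExt A A) := hid.dual
  exact hf.tendsto_arcsine (fun i => inl_mem_dualNonUnitalSubring (B := B) (a i))
    (dual_E_eq_zero hE hE') hid' (dualMap_variance hη hη') k (fun n => inl (b n))

end CentralLimit

end Transfer

end OVI

end

theorem mainTheorem9 {A : Type*} [NormedRing A] [NormedAlgebra ℂ A] [CompleteSpace A]
    (B : Subalgebra ℂ A) [CompleteSpace B] (P : OVI.Space A B)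
    (a : ℕ → A) (hE : ∀ i, P.E (a i) = 0) (hE' : ∀ i, P.E' (a i) = 0)
    (hid : OVI.IdentDistributed P a)
    (η η' : B → B) (hη : ∀ i b, η b = P.E (a i * (b : A) * a i))
    (hη' : ∀ i b, η' b = P.E' (a i * (b : A) * a i)) :
    (OVI.InfFree P a → ∀ (k : ℕ) (b : ℕ → B),
      Tendsto (fun N : ℕ => P.E (OVI.word (OVI.normalizedSum a N) k b)) atTop
        (𝓝 (OVI.semicircle η k b)) ∧
      Tendsto (fun N : ℕ => P.E' (OVI.word (OVI.normalizedSum a N) k b)) atTop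
        (𝓝 (OVI.infSemicircle η η' k b))) ∧
    (OVI.InfBoolean P a → ∀ (k : ℕ) (b : ℕ → B),
      Tendsto (fun N : ℕ => P.E (OVI.word (OVI.normalizedSum a N) k b)) atTop
        (𝓝 (OVI.bernoulli η k b)) ∧
      Tendsto (fun N : ℕ => P.E' (OVI.word (OVI.normalizedSum a N) k b)) atTop
        (𝓝 (OVI.infBernoulli η η' k b))) ∧
    (OVI.InfMonotone P a → ∀ (k : ℕ) (b : ℕ → B),
      Tendsto (fun N : ℕ => P.E (OVI.word (OVI.normalizedSum a N) k b)) atTop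
        (𝓝 (OVI.arcsine η k b)) ∧
      Tendsto (fun N : ℕ => P.E' (OVI.word (OVI.normalizedSum a N) k b)) atTop
        (𝓝 (OVI.infArcsine η η' k b))) := by
  -- the variance is additive, being given by `hη`
  obtain ⟨ηh, rfl⟩ : ∃ ηh : B →+ B, ⇑ηh = η :=
    ⟨{ toFun := η
       map_zero' := by simp [hη 0]
       map_add' := fun x y => by simp [hη 0, mul_add, add_mul] }, rfl⟩
  exact ⟨fun h => h.tendsto hE hE' hid hη hη', fun h => h.tendsto hE hE' hid hη hη',
    fun h => h.tendsto hE hE' hid hη hη'⟩
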